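/- Let $\mathcal T$ and $M$ be paracompact (Hausdorff) smooth manifolds of dimensions $m$ and $n$, and let $E^*=J^{1*}(\mathcal T,M)\to\mathcal T\times M$ be the dual of the 1-jet vector bundle $J^1(\mathcal T,M)\to\mathcal T\times M$ (whose fibre at $(t,x)$ is $\mathrm{Hom}(T_t\mathcal T,T_xM)$), with local coordinates $(t^a,x^i,p_i^a)$ induced by charts of $\mathcal T$ and $M$. A nonlinear connection $N$ on $E^*$ is a smooth distribution $\mathcal H$ on $E^*$ supplementary to the vertical distribution $\mathcal W$ (the kernel of the differential of $E^*\to\mathcal T\times M$). Locally $\mathcal H$ is spanned by $$\frac{\delta}{\delta t^a}=\frac{\partial}{\partial t^a}-\underset{1}{N}{}^{(b)}_{(j)a}\frac{\partial}{\partial p^b_j},\qquad \frac{\delta}{\delta x^i}=\frac{\partial}{\partial x^i}-\underset{2}{N}{}^{(b)}_{(j)i}\frac{\partial}{\partial p^b_j},$$ and $\mathcal H=\mathcal H_{\mathcal T}\oplus\mathcal H_M$ with $\mathcal H_{\mathcal T}$ spanned by the $\delta/\delta t^a$ and $\mathcal H_M$ spanned by the $\delta/\delta x^i$. An $N$-linear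 connection is a smooth linear connection $D$ on the manifold $E^*$ such that, for every vector field $X$ on $E^*$, $D_X$ maps sections of each of $\mathcal H_{\mathcal T}$, $\mathcal H_M$, $\mathcal W$ to sections of the same distribution. Then there exist a nonlinear connection $N$ on $E^*$ and an $N$-linear connection on $E^*$; moreover, for every nonlinear connection $N$ on $E^*$ there exists an $N$-linear connection on $E^*$. More precisely, there exist smooth linear connections on $\mathcal T$ and on $M$, and for all smooth linear connections on $\mathcal T$ and $M$, with local coefficients $\chi^a_{bc}(t)$ and $\Gamma^i_{jk}(x)$ (where $\nabla_{\partial_c}\partial_b=\chi^a_{bc}\partial_a$ and $\nabla_{\partial_k}\partial_j=\Gamma^i_{jk}\partial_i$), there are a nonlinear connection $N$ on $E^*$ whose coefficients in all induced coordinates are $$\underset{1}{N}{}^{(a)}_{(i)b}=\chi^a_{cb}\,p_i^c,\qquad \underset{2}{N}{}^{(b)}_{(j)k}=-\Gamma^i_{jk}\,p_i^b,$$ and an $N$-linear connection $D$ on $E^*$ (the canonical Berwald connection) satisfying, in all induced coordinates, $$D_{\frac{\delta}{\delta t^c}}\frac{\delta}{\delta t^b}=\chi^a_{bc}\frac{\delta}{\delta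 t^a},\quad D_{\frac{\delta}{\delta x^k}}\frac{\delta}{\delta x^j}=\Gamma^i_{jk}\frac{\delta}{\delta x^i},\quad D_{\frac{\delta}{\delta t^c}}\frac{\partial}{\partial p^b_j}=\chi^a_{bc}\frac{\partial}{\partial p^a_j},\quad D_{\frac{\delta}{\delta x^k}}\frac{\partial}{\partial p^b_j}=-\Gamma^j_{ik}\frac{\partial}{\partial p^b_i},$$ $$D_{\frac{\delta}{\delta t^c}}\frac{\delta}{\delta x^j}=0,\quad D_{\frac{\delta}{\delta x^k}}\frac{\delta}{\delta t^b}=0,\quad D_{\frac{\partial}{\partial p^c_k}}\frac{\delta}{\delta t^b}=0,\quad D_{\frac{\partial}{\partial p^c_k}}\frac{\delta}{\delta x^j}=0,\quad D_{\frac{\partial}{\partial p^c_k}}\frac{\partial}{\partial p^b_j}=0.$$ -/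

import Mathlib

open Bundle Module
open scoped Manifold ContDiff Topology Bundle

noncomputable section

/-! ### Smooth linear connections on a manifold, and local coordinates -/

section Generic

variable {E : Type*} [NormedAddCommGroup E] [NormedSpace ℝ E]
  {H : Type*} [TopologicalSpace H]

/-- A (smooth) linear connection on a smooth manifold `X`: a Koszul connection `D` on the tangent
bundle, `(X, Y) ↦ D_X Y`, which sends smooth vector fields to smooth vector fields.
Mathlib writes `D Y x v` for `(D_v Y)(x)`. -/
structure LinearConnection (I : ModelWithCorners ℝ E H) (X : Type*) [TopologicalSpace X]
    [ChartedSpace H X] [IsManifold I ∞ X]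
    extends CovariantDerivative I E (TangentSpace I : X → Type _) where
  /-- `D_X Y` is smooth whenever `X` and `Y` are. -/
  smooth : toCovariantDerivative.ContMDiffCovariantDerivative ∞

/-- A differentiable distribution of rank `k` on `X`: a field of subspaces of the tangent spaces
which near every point is spanned by `k` linearly independent smooth vector fields. -/
def IsSmoothDistribution (I : ModelWithCorners ℝ E H) {X : Type*} [TopologicalSpace X]
    [ChartedSpace H X] [IsManifold I ∞ X] (k : ℕ)
    (Δ : (x : X) → Submodule ℝ (TangentSpace I x)) : Prop :=
  ∀ x₀ : X, ∃ U : Set X, IsOpen U ∧ x₀ ∈ U ∧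
    ∃ Y : Fin k → (x : X) → TangentSpace I x,
      (∀ r, ContMDiffOn I I.tangent ∞ (fun x ↦ (⟨x, Y r x⟩ : TangentBundle I X)) U) ∧
      ∀ x ∈ U, LinearIndependent ℝ (fun r ↦ Y r x) ∧
        Δ x = Submodule.span ℝ (Set.range fun r ↦ Y r x)

end Generic

section Coordinates

variable {d : ℕ} {X : Type*} [TopologicalSpace X] [ChartedSpace (EuclideanSpace ℝ (Fin d)) X]

/-- The coordinate one-form `dt^a` of the chart `e` (meaningful on `e.source`). -/
def coordForm (e : OpenPartialHomeomorph X (EuclideanSpace ℝ (Fin d))) (a : Fin d) (t : X) :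
    TangentSpace (𝓡 d) t →L[ℝ] ℝ :=
  (EuclideanSpace.proj a : EuclideanSpace ℝ (Fin d) →L[ℝ] ℝ).comp (mfderiv (𝓡 d) (𝓡 d) e t)

/-- The coordinate vector field `∂/∂t^a` of the chart `e` (meaningful on `e.source`). -/
def coordField (e : OpenPartialHomeomorph X (EuclideanSpace ℝ (Fin d))) (a : Fin d) (t : X) :
    TangentSpace (𝓡 d) t :=
  (mfderiv (𝓡 d) (𝓡 d) e t).inverse
    (EuclideanSpace.single a (1 : ℝ) : EuclideanSpace ℝ (Fin d))

/-- The local coefficients `χ^a_{bc}` of a linear connection in the chart `e`, with the convention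
`∇_{∂/∂t^c} ∂/∂t^b = χ^a_{bc} ∂/∂t^a`. -/
def LinearConnection.coeff [IsManifold (𝓡 d) ∞ X] (D : LinearConnection (𝓡 d) X)
    (e : OpenPartialHomeomorph X (EuclideanSpace ℝ (Fin d))) (a b c : Fin d) (t : X) : ℝ :=
  coordForm e a t (D.toFun (coordField e b) t (coordField e c t))

end Coordinates

/-! ### The dual 1-jet bundle -/

section PullbackFibres

variable {B B' : Type*} (f : B' → B) (V : B → Type*)

instance pullbackAddCommGroup [∀ b, AddCommGroup (V b)] (b : B') : AddCommGroup ((f *ᵖ V) b) :=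
  inferInstanceAs (AddCommGroup (V (f b)))

instance pullbackIsTopologicalAddGroup [∀ b, AddCommGroup (V b)] [∀ b, TopologicalSpace (V b)]
    [∀ b, IsTopologicalAddGroup (V b)] (b : B') : IsTopologicalAddGroup ((f *ᵖ V) b) :=
  inferInstanceAs (IsTopologicalAddGroup (V (f b)))

instance pullbackContinuousSMul [∀ b, AddCommGroup (V b)] [∀ b, Module ℝ (V b)]
    [∀ b, TopologicalSpace (V b)] [∀ b, ContinuousSMul ℝ (V b)] (b : B') :
    ContinuousSMul ℝ ((f *ᵖ V) b) :=
  inferInstanceAs (ContinuousSMul ℝ (V (f b)))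

end PullbackFibres

section Jet

variable (m n : ℕ)
  (T : Type*) [TopologicalSpace T] [ChartedSpace (EuclideanSpace ℝ (Fin m)) T]
  (M : Type*) [TopologicalSpace M] [ChartedSpace (EuclideanSpace ℝ (Fin n)) M]

/-- The fibre of the 1-jet bundle `J¹(T, M) → T × M` over `(t, x)`: the 1-jet at `t` of a map `f`
with `f t = x` is its differential, a linear map `T_t T → T_x M`. -/
abbrev JetFibre (p : T × M) : Type _ :=
  ((ContMDiffMap.fst : C^∞⟮(𝓡 m).prod (𝓡 n), T × M; 𝓡 m, T⟯) *ᵖ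
      (TangentSpace (𝓡 m) : T → Type _)) p →L[ℝ]
    ((ContMDiffMap.snd : C^∞⟮(𝓡 m).prod (𝓡 n), T × M; 𝓡 n, M⟯) *ᵖ
      (TangentSpace (𝓡 n) : M → Type _)) p

/-- The fibre of the dual vector bundle `J^{1*}(T, M) → T × M` of the 1-jet bundle. -/
def DualJetFibre (p : T × M) : Type _ := JetFibre m n T M p →L[ℝ] Bundle.Trivial (T × M) ℝ p

/-- The model fibre of the 1-jet bundle. -/
abbrev JetModel : Type := EuclideanSpace ℝ (Fin m) →L[ℝ] EuclideanSpace ℝ (Fin n)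

/-- The model fibre of `J^{1*}(T, M)`. -/
abbrev DualJetModel : Type := JetModel m n →L[ℝ] ℝ

/-- The model with corners (without boundary) of the manifold `J^{1*}(T, M)`. -/
abbrev DualJetI := ((𝓡 m).prod (𝓡 n)).prod 𝓘(ℝ, DualJetModel m n)

/-- The dual 1-jet space `E* = J^{1*}(T, M)`, the total space of the dual 1-jet bundle. -/
abbrev DualJet : Type _ := TotalSpace (DualJetModel m n) (DualJetFibre m n T M)

instance dualJetFibreAddCommGroup (p : T × M) : AddCommGroup (DualJetFibre m n T M p) :=
  inferInstanceAs (AddCommGroup (JetFibre m n T M p →L[ℝ] Bundle.Trivial (T × M) ℝ p))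

instance dualJetFibreModule (p : T × M) : Module ℝ (DualJetFibre m n T M p) :=
  inferInstanceAs (Module ℝ (JetFibre m n T M p →L[ℝ] Bundle.Trivial (T × M) ℝ p))

instance dualJetFibreTopology (p : T × M) : TopologicalSpace (DualJetFibre m n T M p) :=
  inferInstanceAs (TopologicalSpace (JetFibre m n T M p →L[ℝ] Bundle.Trivial (T × M) ℝ p))

variable [IsManifold (𝓡 m) ∞ T] [IsManifold (𝓡 n) ∞ M]

/-! `E* → T × M` carries Mathlib's structure of a smooth vector bundle, as the bundle of linear
maps from the 1-jet bundle to the trivial line bundle. -/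

instance dualJetTopology : TopologicalSpace (DualJet m n T M) :=
  inferInstanceAs (TopologicalSpace (TotalSpace (JetModel m n →L[ℝ] ℝ)
    fun p : T × M ↦ JetFibre m n T M p →L[ℝ] Bundle.Trivial (T × M) ℝ p))

instance dualJetFiberBundle : FiberBundle (DualJetModel m n) (DualJetFibre m n T M) :=
  inferInstanceAs (FiberBundle (JetModel m n →L[ℝ] ℝ)
    fun p : T × M ↦ JetFibre m n T M p →L[ℝ] Bundle.Trivial (T × M) ℝ p)

instance dualJetVectorBundle : VectorBundle ℝ (DualJetModel m n) (DualJetFibre m n T M) :=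
  inferInstanceAs (VectorBundle ℝ (JetModel m n →L[ℝ] ℝ)
    fun p : T × M ↦ JetFibre m n T M p →L[ℝ] Bundle.Trivial (T × M) ℝ p)

instance dualJetContMDiffVectorBundle :
    ContMDiffVectorBundle ∞ (DualJetModel m n) (DualJetFibre m n T M) ((𝓡 m).prod (𝓡 n)) :=
  inferInstanceAs (ContMDiffVectorBundle ∞ (JetModel m n →L[ℝ] ℝ)
    (fun p : T × M ↦ JetFibre m n T M p →L[ℝ] Bundle.Trivial (T × M) ℝ p) ((𝓡 m).prod (𝓡 n)))

/-- `E*` is a smooth manifold. -/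
instance dualJetIsManifold : IsManifold (DualJetI m n) ∞ (DualJet m n T M) := inferInstance

end Jet

section Connections

variable {m n : ℕ}
  {T : Type*} [TopologicalSpace T] [ChartedSpace (EuclideanSpace ℝ (Fin m)) T]
  {M : Type*} [TopologicalSpace M] [ChartedSpace (EuclideanSpace ℝ (Fin n)) M]
  [IsManifold (𝓡 m) ∞ T] [IsManifold (𝓡 n) ∞ M]

/-! ### Nonlinear connections -/

/-- The vertical distribution `W` on `E*`: the kernel of the differential of `E* → T × M`. -/
def verticalSpace (u : DualJet m n T M) : Submodule ℝ (TangentSpace (DualJetI m n) u) :=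
  LinearMap.ker (mfderiv (DualJetI m n) ((𝓡 m).prod (𝓡 n))
    (fun v : DualJet m n T M ↦ v.proj) u).toLinearMap

variable (m n T M) in
/-- A nonlinear connection on `E*`: a differentiable distribution supplementary to the vertical
one. -/
structure NonlinearConnection where
  /-- The horizontal subspace at each point. -/
  horizontal : (u : DualJet m n T M) → Submodule ℝ (TangentSpace (DualJetI m n) u)
  isSmooth : IsSmoothDistribution (DualJetI m n) (m + n) horizontal
  isCompl : ∀ u, IsCompl (horizontal u) (verticalSpace u)

namespace NonlinearConnection

/-- The `T`-horizontal distribution (spanned by the `δ/δt^a`): the horizontal vectors whose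
projection to `T_t T × T_x M` has no component along `M`. -/
def timeHorizontal (N : NonlinearConnection m n T M) (u : DualJet m n T M) :
    Submodule ℝ (TangentSpace (DualJetI m n) u) :=
  N.horizontal u ⊓ LinearMap.ker (mfderiv (DualJetI m n) (𝓡 n)
    (fun v : DualJet m n T M ↦ v.proj.2) u).toLinearMap

/-- The `M`-horizontal distribution (spanned by the `δ/δx^i`): the horizontal vectors whose
projection to `T_t T × T_x M` has no component along `T`. -/
def spaceHorizontal (N : NonlinearConnection m n T M) (u : DualJet m n T M) :
    Submodule ℝ (TangentSpace (DualJetI m n) u) :=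
  N.horizontal u ⊓ LinearMap.ker (mfderiv (DualJetI m n) (𝓡 m)
    (fun v : DualJet m n T M ↦ v.proj.1) u).toLinearMap

end NonlinearConnection

/-! ### N-linear connections -/

/-- The linear connection `D` preserves the distribution `Δ`: for all vector fields `X` and all
vector fields `Y` tangent to `Δ`, the vector field `D_X Y` is tangent to `Δ`. -/
def Preserves (D : LinearConnection (DualJetI m n) (DualJet m n T M))
    (Δ : (u : DualJet m n T M) → Submodule ℝ (TangentSpace (DualJetI m n) u)) : Prop :=
  ∀ Y : (u : DualJet m n T M) → TangentSpace (DualJetI m n) u,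
    ContMDiff (DualJetI m n) (DualJetI m n).tangent ∞
      (fun u ↦ (⟨u, Y u⟩ : TangentBundle (DualJetI m n) (DualJet m n T M))) →
    (∀ u, Y u ∈ Δ u) →
    ∀ u, ∀ v : TangentSpace (DualJetI m n) u, D.toFun Y u v ∈ Δ u

/-- `D` is an `N`-linear connection: it preserves the `T`-horizontal, the `M`-horizontal and the
vertical distribution. -/
structure IsNLinear (N : NonlinearConnection m n T M)
    (D : LinearConnection (DualJetI m n) (DualJet m n T M)) : Prop where
  time : Preserves D N.timeHorizontal
  space : Preserves D N.spaceHorizontal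
  vertical : Preserves D verticalSpace

/-! ### Adapted bases and adapted coefficients -/

section Charts

variable (e : OpenPartialHomeomorph T (EuclideanSpace ℝ (Fin m)))
  (e' : OpenPartialHomeomorph M (EuclideanSpace ℝ (Fin n)))

/-- The domain in `E*` of the coordinates `(t^a, x^i, p_i^a)` induced by charts of `T` and `M`. -/
def coordDomain : Set (DualJet m n T M) :=
  {u | u.proj.1 ∈ e.source ∧ u.proj.2 ∈ e'.source}

/-- The polymomentum coordinate `p_i^a` of `u ∈ E*`: the value of the linear form `u` on the 1-jet
`∂/∂x^i ⊗ dt^a`. -/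
def polymomentum (i : Fin n) (a : Fin m) (u : DualJet m n T M) : ℝ :=
  (show JetFibre m n T M u.proj →L[ℝ] ℝ from u.snd)
    ((coordForm e a u.proj.1).smulRight (coordField e' i u.proj.2) :
      TangentSpace (𝓡 m) u.proj.1 →L[ℝ] TangentSpace (𝓡 n) u.proj.2)

/-- The space of values of the coordinates `(t^a, x^i, p_i^a)`. -/
abbrev CoordSpace (m n : ℕ) : Type :=
  EuclideanSpace ℝ (Fin m) × EuclideanSpace ℝ (Fin n) × (Fin n → Fin m → ℝ)

/-- The local coordinates `(t^a, x^i, p_i^a)` on `E*`. -/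
def coords (u : DualJet m n T M) : CoordSpace m n :=
  (e u.proj.1, e' u.proj.2, fun i a ↦ polymomentum e e' i a u)

/-- The tangent vector to `E*` at `u` with given components in the natural basis
`∂/∂t^a, ∂/∂x^i, ∂/∂p_i^a`. -/
def ofComponents (u : DualJet m n T M) (w : CoordSpace m n) : TangentSpace (DualJetI m n) u :=
  (mfderiv (DualJetI m n) 𝓘(ℝ, CoordSpace m n) (coords e e') u).inverse w

/-- `∂/∂t^a` on `E*`. -/
def natT (a : Fin m) (u : DualJet m n T M) : TangentSpace (DualJetI m n) u :=
  ofComponents e e' u (EuclideanSpace.single a 1, 0, 0)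

/-- `∂/∂x^i` on `E*`. -/
def natX (i : Fin n) (u : DualJet m n T M) : TangentSpace (DualJetI m n) u :=
  ofComponents e e' u (0, EuclideanSpace.single i 1, 0)

/-- `∂/∂p_i^a` on `E*`. -/
def natP (i : Fin n) (a : Fin m) (u : DualJet m n T M) : TangentSpace (DualJetI m n) u :=
  ofComponents e e' u (0, 0, Pi.single i (Pi.single a 1))

/-- Local functions `N₁^{(b)}_{(j)a}` and `N₂^{(b)}_{(j)i}` on `E*`, written `N₁ b j a` and
`N₂ b j i`. -/
structure NonlinearCoeffs (m n : ℕ) where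
  N₁ : Fin m → Fin n → Fin m → ℝ
  N₂ : Fin m → Fin n → Fin n → ℝ

/-- `δ/δt^a = ∂/∂t^a - N₁^{(b)}_{(j)a} ∂/∂p_j^b`. -/
def deltaT (N : DualJet m n T M → NonlinearCoeffs m n) (a : Fin m) (u : DualJet m n T M) :
    TangentSpace (DualJetI m n) u :=
  natT e e' a u - ∑ b, ∑ j, (N u).N₁ b j a • natP e e' j b u

/-- `δ/δx^i = ∂/∂x^i - N₂^{(b)}_{(j)i} ∂/∂p_j^b`. -/
def deltaX (N : DualJet m n T M → NonlinearCoeffs m n) (i : Fin n) (u : DualJet m n T M) :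
    TangentSpace (DualJetI m n) u :=
  natX e e' i u - ∑ b, ∑ j, (N u).N₂ b j i • natP e e' j b u

/-- The nonlinear connection `N` has the coefficients `K` in the given charts, i.e. its horizontal
spaces are spanned by the `δ/δt^a` and the `δ/δx^i`. -/
def NonlinearConnection.HasCoeffs (N : NonlinearConnection m n T M)
    (K : DualJet m n T M → NonlinearCoeffs m n) : Prop :=
  ∀ u ∈ coordDomain e e', N.horizontal u =
    Submodule.span ℝ (Set.range (fun a ↦ deltaT e e' K a u) ∪
      Set.range (fun i ↦ deltaX e e' K i u))

/-- Nine families of adapted coefficients; `A₁ a b c` is `A^a_{bc}`, `A₂ i j c` is `A^i_{jc}`,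
`A₃ a i j b c` is `A^{(a)(j)}_{(i)(b)c}`, and so on in the same order. -/
structure AdaptedCoeffs (m n : ℕ) where
  A₁ : (a b c : Fin m) → ℝ
  A₂ : (i j : Fin n) → (c : Fin m) → ℝ
  A₃ : (a : Fin m) → (i j : Fin n) → (b c : Fin m) → ℝ
  H₁ : (a b : Fin m) → (k : Fin n) → ℝ
  H₂ : (i j k : Fin n) → ℝ
  H₃ : (a : Fin m) → (i j : Fin n) → (b : Fin m) → (k : Fin n) → ℝ
  C₁ : (a b : Fin m) → (k : Fin n) → (c : Fin m) → ℝ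
  C₂ : (i j k : Fin n) → (c : Fin m) → ℝ
  C₃ : (a : Fin m) → (i j : Fin n) → (b : Fin m) → (k : Fin n) → (c : Fin m) → ℝ

/-- In the given charts, and in the adapted basis `δ/δt^a, δ/δx^i, ∂/∂p_i^a` belonging to the
coefficients `K` of a nonlinear connection, the linear connection `D` has the nine adapted
coefficients `Γ` (and no other ones). -/
structure HasAdaptedCoeffs (K : DualJet m n T M → NonlinearCoeffs m n)
    (D : LinearConnection (DualJetI m n) (DualJet m n T M))
    (Γ : DualJet m n T M → AdaptedCoeffs m n) : Prop where
  tt : ∀ u ∈ coordDomain e e', ∀ b c, D.toFun (deltaT e e' K b) u (deltaT e e' K c u) =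
    ∑ a, (Γ u).A₁ a b c • deltaT e e' K a u
  tx : ∀ u ∈ coordDomain e e', ∀ j c, D.toFun (deltaX e e' K j) u (deltaT e e' K c u) =
    ∑ i, (Γ u).A₂ i j c • deltaX e e' K i u
  tp : ∀ u ∈ coordDomain e e', ∀ j b c, D.toFun (natP e e' j b) u (deltaT e e' K c u) =
    -∑ a, ∑ i, (Γ u).A₃ a i j b c • natP e e' i a u
  xt : ∀ u ∈ coordDomain e e', ∀ b k, D.toFun (deltaT e e' K b) u (deltaX e e' K k u) =
    ∑ a, (Γ u).H₁ a b k • deltaT e e' K a u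
  xx : ∀ u ∈ coordDomain e e', ∀ j k, D.toFun (deltaX e e' K j) u (deltaX e e' K k u) =
    ∑ i, (Γ u).H₂ i j k • deltaX e e' K i u
  xp : ∀ u ∈ coordDomain e e', ∀ j b k, D.toFun (natP e e' j b) u (deltaX e e' K k u) =
    -∑ a, ∑ i, (Γ u).H₃ a i j b k • natP e e' i a u
  pt : ∀ u ∈ coordDomain e e', ∀ b k c, D.toFun (deltaT e e' K b) u (natP e e' k c u) =
    ∑ a, (Γ u).C₁ a b k c • deltaT e e' K a u
  px : ∀ u ∈ coordDomain e e', ∀ j k c, D.toFun (deltaX e e' K j) u (natP e e' k c u) =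
    ∑ i, (Γ u).C₂ i j k c • deltaX e e' K i u
  pp : ∀ u ∈ coordDomain e e', ∀ j b k c, D.toFun (natP e e' j b) u (natP e e' k c u) =
    -∑ a, ∑ i, (Γ u).C₃ a i j b k c • natP e e' i a u

/-- The coefficients `N₁^{(a)}_{(i)b} = χ^a_{cb} p_i^c` and `N₂^{(b)}_{(j)k} = -Γ^i_{jk} p_i^b`
attached to linear connections on `T` and `M` with local coefficients `χ` and `Γ`. -/
def berwaldNonlinearCoeffs (χ : LinearConnection (𝓡 m) T) (Γ : LinearConnection (𝓡 n) M)
    (u : DualJet m n T M) : NonlinearCoeffs m n where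
  N₁ a i b := ∑ c, χ.coeff e a c b u.proj.1 * polymomentum e e' i c u
  N₂ b j k := -∑ i, Γ.coeff e' i j k u.proj.2 * polymomentum e e' i b u

/-- The coefficients `(χ^a_{bc}, 0, -δ_i^j χ^a_{bc}, 0, Γ^i_{jk}, δ_b^a Γ^j_{ik}, 0, 0, 0)`. -/
def berwaldCoeffs (χ : LinearConnection (𝓡 m) T) (Γ : LinearConnection (𝓡 n) M)
    (u : DualJet m n T M) : AdaptedCoeffs m n where
  A₁ a b c := χ.coeff e a b c u.proj.1
  A₂ _ _ _ := 0
  A₃ a i j b c := if i = j then -χ.coeff e a b c u.proj.1 else 0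
  H₁ _ _ _ := 0
  H₂ i j k := Γ.coeff e' i j k u.proj.2
  H₃ a i j b k := if a = b then Γ.coeff e' j i k u.proj.2 else 0
  C₁ _ _ _ _ := 0
  C₂ _ _ _ _ := 0
  C₃ _ _ _ _ _ _ := 0

end Charts

/-- `N` is the nonlinear connection attached to the linear connections `χ` on `T` and `Γ` on `M`,
and `D` is their canonical Berwald connection: the formulas hold in all charts of the smooth
structures of `T` and `M`. -/
structure IsBerwald (χ : LinearConnection (𝓡 m) T) (Γ : LinearConnection (𝓡 n) M)
    (N : NonlinearConnection m n T M)
    (D : LinearConnection (DualJetI m n) (DualJet m n T M)) : Prop where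
  nonlinear : ∀ e ∈ IsManifold.maximalAtlas (𝓡 m) ∞ T, ∀ e' ∈ IsManifold.maximalAtlas (𝓡 n) ∞ M,
    N.HasCoeffs e e' (berwaldNonlinearCoeffs e e' χ Γ)
  linear : ∀ e ∈ IsManifold.maximalAtlas (𝓡 m) ∞ T, ∀ e' ∈ IsManifold.maximalAtlas (𝓡 n) ∞ M,
    HasAdaptedCoeffs e e' (berwaldNonlinearCoeffs e e' χ Γ) D (berwaldCoeffs e e' χ Γ)

end Connections

end

/-! Everything is done in moving coframes. If `Θ` is a local coframe with values in a fixed vector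
space `G` and `Ω` is a field of bilinear maps on `G`, then `D_v σ = Θ⁻¹(d(Θσ)(v) + Ω(Θv, Θσ))` is a
covariant derivative, smooth when `Θ` and `Ω` are (`isCovariantDerivativeOn_frameCov`,
`contMDiffAt_frameCov`). Two covariant derivatives differ by a tensor, so they agree at a point as
soon as they agree on fields whose values there span (`IsCovariantDerivativeOn.eq_of_span_eq_top`).
All connections below are built locally from these two facts and then glued.

On a paracompact manifold the flat connections of the charts are averaged by a smooth partition of
unity (`nonempty_linearConnection`). For any linear connection with connection forms `ω`, `ω₁` in
two charts, the Jacobian `J` of the coordinate change satisfies the gauge law `dJ = J ω₁ - ω J`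
(`LinearConnection.mvfderiv_transition`). All later chart comparisons rest on this law.

Let `ω` and `θ` be the connection forms of `χ` and `Γ`, pulled back to `E*`. The polymomenta
transform by `p = X J p₁`, where `J` is the Jacobian on `T` and `X` the reverse Jacobian on `M`. By
the product rule and the gauge laws, the covariant differential `δp = dp + ω p - p θ` transforms by
the same matrices with no derivative terms (`covPolymomentum_transition`). Its kernel is therefore
independent of the charts, and its coefficients are those of the theorem
(`adaptedMomentum_berwald`); this is `berwaldNonlinearConnection`.

An arbitrary nonlinear connection `N` has the adapted coframe `(dt, dx, δp)`, where `δp` is now `dp`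
after projection to the vertical space along the horizontal one. It is smooth
(`NonlinearConnection.smoothForm_adaptedForm`) and again changes by Jacobians. Let `ω` act on the
`t`-block, `θ` on the `x`-block, and `p ↦ ω p - p θ` on the `p`-block. The gauge law makes the
resulting local connections agree on overlaps (`NonlinearConnection.localCov_eq`), so they define a
global `berwaldConnection`. Since `Ω` is block diagonal, the three distributions, each given by the
vanishing of two blocks, are preserved, whatever `N` is
(`NonlinearConnection.isNLinear_berwaldConnection`). For the special `N` above, the coframe is dual
to `δ/δt, δ/δx, ∂/∂p`, and the nine formulas are the values of `Ω` on basis vectors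
(`NonlinearConnection.HasCoeffs.hasAdaptedCoeffs`). -/

noncomputable section

set_option synthInstance.maxHeartbeats 200000

/-! ### Smooth vector-valued one-forms and covariant derivatives in a coframe -/

section SmoothForms

variable {E : Type*} [NormedAddCommGroup E] [NormedSpace ℝ E]
  {H : Type*} [TopologicalSpace H] {I : ModelWithCorners ℝ E H}
  {X : Type*} [TopologicalSpace X] [ChartedSpace H X] [IsManifold I ∞ X]
  {G : Type*} [NormedAddCommGroup G] [NormedSpace ℝ G]
  {G' : Type*} [NormedAddCommGroup G'] [NormedSpace ℝ G']

/-- A one-form `Θ` on `X` with values in a normed space `G` is smooth at `x₀`. -/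
def SmoothForm (Θ : (x : X) → TangentSpace I x →L[ℝ] G) (x₀ : X) : Prop :=
  ContMDiffAt I 𝓘(ℝ, E →L[ℝ] G) ∞
    (fun x ↦ ((Θ x).comp ((trivializationAt E (TangentSpace I) x₀).symmL ℝ x) : E →L[ℝ] G)) x₀

lemma eventually_mem_trivializationAt_baseSet (x₀ : X) :
    ∀ᶠ x in 𝓝 x₀, x ∈ (trivializationAt E (TangentSpace I : X → Type _) x₀).baseSet :=
  (trivializationAt E (TangentSpace I) x₀).open_baseSet.mem_nhds
    (FiberBundle.mem_baseSet_trivializationAt' x₀)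

lemma symmL_trivializationAt_apply {x₀ x : X}
    (hx : x ∈ (trivializationAt E (TangentSpace I : X → Type _) x₀).baseSet)
    (v : TangentSpace I x) :
    (trivializationAt E (TangentSpace I : X → Type _) x₀).symmL ℝ x
      ((trivializationAt E (TangentSpace I : X → Type _) x₀) ⟨x, v⟩).2 = v := by
  rw [← Trivialization.continuousLinearMapAt_apply_of_mem ℝ _ hx]
  exact Trivialization.symmL_continuousLinearMapAt _ hx v

lemma SmoothForm.contMDiffAt_apply {Θ : (x : X) → TangentSpace I x →L[ℝ] G} {x₀ : X}
    (hΘ : SmoothForm Θ x₀) {σ : (x : X) → TangentSpace I x}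
    (hσ : ContMDiffAt I I.tangent ∞ (fun x ↦ (⟨x, σ x⟩ : TangentBundle I X)) x₀) :
    ContMDiffAt I 𝓘(ℝ, G) ∞ (fun x ↦ Θ x (σ x)) x₀ := by
  have h := (contMDiffAt_section (F := E) x₀).1 hσ
  refine (ContMDiffAt.clm_apply hΘ h).congr_of_eventuallyEq ?_
  filter_upwards [eventually_mem_trivializationAt_baseSet (I := I) x₀] with x hx
  simp only [ContinuousLinearMap.comp_apply]
  rw [symmL_trivializationAt_apply hx]

lemma SmoothForm.mdifferentiableAt_apply {Θ : (x : X) → TangentSpace I x →L[ℝ] G} {x₀ : X}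
    (hΘ : SmoothForm Θ x₀) {σ : (x : X) → TangentSpace I x}
    (hσ : MDifferentiableAt I I.tangent (fun x ↦ (⟨x, σ x⟩ : TangentBundle I X)) x₀) :
    MDifferentiableAt I 𝓘(ℝ, G) (fun x ↦ Θ x (σ x)) x₀ := by
  have h := ((mdifferentiableAt_totalSpace (F := E) I _).1 hσ).2
  have hΘ' := ContMDiffAt.mdifferentiableAt hΘ (by simp)
  refine (MDifferentiableAt.clm_apply hΘ' h).congr_of_eventuallyEq ?_
  filter_upwards [eventually_mem_trivializationAt_baseSet (I := I) x₀] with x hx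
  simp only [ContinuousLinearMap.comp_apply]
  rw [symmL_trivializationAt_apply hx]

lemma isInvertible_symmL {x₀ x : X}
    (hx : x ∈ (trivializationAt E (TangentSpace I : X → Type _) x₀).baseSet) :
    ((trivializationAt E (TangentSpace I : X → Type _) x₀).symmL ℝ x).IsInvertible :=
  ⟨((trivializationAt E (TangentSpace I : X → Type _) x₀).continuousLinearEquivAt ℝ x hx).symm,
    by ext; simp [Trivialization.symmL_apply _ hx]⟩

/-- Inversion of continuous linear maps is smooth at an invertible one, and the coframe stays
invertible when read in a trivialization. -/
lemma SmoothForm.contMDiffAt_inverse [CompleteSpace E]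
    {Θ : (x : X) → TangentSpace I x →L[ℝ] G} {x₀ : X}
    (hΘ : SmoothForm Θ x₀) (hi : (Θ x₀).IsInvertible) :
    ContMDiffAt I 𝓘(ℝ, G →L[ℝ] E) ∞ (fun x ↦ ((Θ x).comp
      ((trivializationAt E (TangentSpace I) x₀).symmL ℝ x) : E →L[ℝ] G).inverse) x₀ := by
  have hinv : ((Θ x₀).comp
      ((trivializationAt E (TangentSpace I) x₀).symmL ℝ x₀) : E →L[ℝ] G).IsInvertible :=
    hi.comp (isInvertible_symmL (FiberBundle.mem_baseSet_trivializationAt' x₀))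
  exact ContMDiffAt.comp x₀ (hinv.contDiffAt_map_inverse.contMDiffAt) hΘ

lemma trivializationAt_inverse_apply {Θ : (x : X) → TangentSpace I x →L[ℝ] G} {x₀ x : X}
    (hx : x ∈ (trivializationAt E (TangentSpace I : X → Type _) x₀).baseSet)
    (hi : (Θ x).IsInvertible) (g : G) :
    ((trivializationAt E (TangentSpace I : X → Type _) x₀) ⟨x, (Θ x).inverse g⟩).2 =
    ((Θ x).comp ((trivializationAt E (TangentSpace I) x₀).symmL ℝ x) : E →L[ℝ] G).inverse g := by
  symm
  rw [(hi.comp (isInvertible_symmL hx)).inverse_apply_eq, ContinuousLinearMap.comp_apply,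
    symmL_trivializationAt_apply hx, hi.self_apply_inverse]

/-- A field is `Θ⁻¹(Θσ)`, so its smoothness can be read off from its components in a smooth coframe.
This is how coordinate fields and adapted frames are seen to be smooth. -/
lemma SmoothForm.contMDiffAt_of_apply [CompleteSpace E]
    {Θ : (x : X) → TangentSpace I x →L[ℝ] G} {x₀ : X}
    (hΘ : SmoothForm Θ x₀) (hi : ∀ᶠ x in 𝓝 x₀, (Θ x).IsInvertible)
    {σ : (x : X) → TangentSpace I x}
    (hσ : ContMDiffAt I 𝓘(ℝ, G) ∞ (fun x ↦ Θ x (σ x)) x₀) :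
    ContMDiffAt I I.tangent ∞ (fun x ↦ (⟨x, σ x⟩ : TangentBundle I X)) x₀ := by
  refine (contMDiffAt_section (F := E) x₀).2 ?_
  refine (ContMDiffAt.clm_apply (hΘ.contMDiffAt_inverse hi.self_of_nhds) hσ).congr_of_eventuallyEq ?_
  filter_upwards [eventually_mem_trivializationAt_baseSet (I := I) x₀, hi] with x hx hx'
  rw [← trivializationAt_inverse_apply hx hx', hx'.inverse_apply_self]

lemma SmoothForm.mvfderiv {φ : X → G} {x₀ : X} (hφ : ContMDiffAt I 𝓘(ℝ, G) ∞ φ x₀) :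
    SmoothForm (fun x ↦ mvfderiv I φ x) x₀ := by
  have h := ContMDiffAt.mfderiv_const hφ (m := ∞) (by simp)
  refine h.congr_of_eventuallyEq ?_
  filter_upwards [eventually_mem_trivializationAt_baseSet (I := I) x₀] with x hx
  ext v
  simp [inTangentCoordinates, ContinuousLinearMap.inCoordinates, _root_.mvfderiv]
  rfl

lemma SmoothForm.clm_comp {Θ : (x : X) → TangentSpace I x →L[ℝ] G} {x₀ : X} (hΘ : SmoothForm Θ x₀)
    {L : X → G →L[ℝ] G'} (hL : ContMDiffAt I 𝓘(ℝ, G →L[ℝ] G') ∞ L x₀) :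
    SmoothForm (fun x ↦ (L x).comp (Θ x)) x₀ := by
  have h := ContMDiffAt.clm_comp hL hΘ
  exact h

lemma SmoothForm.congr_of_eventuallyEq {Θ Θ' : (x : X) → TangentSpace I x →L[ℝ] G} {x₀ : X}
    (hΘ : SmoothForm Θ x₀) (h : ∀ᶠ x in 𝓝 x₀, Θ' x = Θ x) : SmoothForm Θ' x₀ := by
  refine ContMDiffAt.congr_of_eventuallyEq hΘ ?_
  filter_upwards [h] with x hx
  rw [hx]

omit [IsManifold I ∞ X] in
lemma Filter.EventuallyEq.mvfderiv_eq {f g : X → G} {x : X} (h : f =ᶠ[𝓝 x] g) :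
    _root_.mvfderiv I f x = _root_.mvfderiv I g x := by
  have h' := h.mfderiv_eq (I := I) (I' := 𝓘(ℝ, G))
  ext v
  exact congrArg (fun L : TangentSpace I x →L[ℝ] G ↦ L v) h'

omit [IsManifold I ∞ X] in
lemma mvfderiv_clm_apply (L : G →L[ℝ] G') {f : X → G} {x : X}
    (hf : MDifferentiableAt I 𝓘(ℝ, G) f x) (v : TangentSpace I x) :
    _root_.mvfderiv I (fun y ↦ L (f y)) x v = L (_root_.mvfderiv I f x v) := by
  have h := (L.hasMFDerivAt.comp x hf.hasMFDerivAt).mfderiv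
  exact congrArg (fun L : TangentSpace I x →L[ℝ] G' ↦ L v) h

/-! ### The linear connection with given Christoffel symbols in a moving coframe -/

/-- The covariant derivative which has the Christoffel symbols `Ω` in the coframe `Θ`. -/
def frameCov (Θ : (x : X) → TangentSpace I x →L[ℝ] G) (Ω : X → G →L[ℝ] G →L[ℝ] G)
    (σ : (x : X) → TangentSpace I x) (x : X) : TangentSpace I x →L[ℝ] TangentSpace I x :=
  (Θ x).inverse.comp (_root_.mvfderiv I (fun y ↦ Θ y (σ y)) x +
    ((Ω x).flip (Θ x (σ x))).comp (Θ x))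

omit [IsManifold I ∞ X] in
lemma frameCov_apply (Θ : (x : X) → TangentSpace I x →L[ℝ] G) (Ω : X → G →L[ℝ] G →L[ℝ] G)
    (σ : (x : X) → TangentSpace I x) (x : X) (v : TangentSpace I x) :
    frameCov Θ Ω σ x v = (Θ x).inverse (_root_.mvfderiv I (fun y ↦ Θ y (σ y)) x v +
      Ω x (Θ x v) (Θ x (σ x))) := rfl

omit [IsManifold I ∞ X] in
lemma apply_frameCov {Θ : (x : X) → TangentSpace I x →L[ℝ] G} (Ω : X → G →L[ℝ] G →L[ℝ] G)
    (σ : (x : X) → TangentSpace I x) {x : X} (hx : (Θ x).IsInvertible) (v : TangentSpace I x) :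
    Θ x (frameCov Θ Ω σ x v) = _root_.mvfderiv I (fun y ↦ Θ y (σ y)) x v +
      Ω x (Θ x v) (Θ x (σ x)) := by
  rw [frameCov_apply, hx.self_apply_inverse]

/-- After applying the injective map `Θ x`, the derivative term carries the Leibniz rule of
functions and the `Ω` term is linear over functions. -/
lemma isCovariantDerivativeOn_frameCov {Θ : (x : X) → TangentSpace I x →L[ℝ] G}
    (Ω : X → G →L[ℝ] G →L[ℝ] G) {s : Set X} (hΘ : ∀ x ∈ s, SmoothForm Θ x)
    (hi : ∀ x ∈ s, (Θ x).IsInvertible) :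
    IsCovariantDerivativeOn E (I := I) (frameCov Θ Ω) s where
  add {σ σ' x} hσ hσ' hx := by
    have h := (hΘ x hx).mdifferentiableAt_apply hσ
    have h' := (hΘ x hx).mdifferentiableAt_apply hσ'
    ext v
    apply (hi x hx).injective
    simp only [_root_.add_apply, map_add, apply_frameCov _ _ (hi x hx), Pi.add_apply]
    have := mvfderiv_fun_add h h'
    rw [this]
    simp only [_root_.add_apply]
    abel
  leibniz {σ g x} hσ hg hx := by
    have h := (hΘ x hx).mdifferentiableAt_apply hσ
    ext v
    apply (hi x hx).injective
    simp only [_root_.add_apply, map_add, apply_frameCov _ _ (hi x hx), Pi.smul_apply',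
      map_smul, _root_.smul_apply, ContinuousLinearMap.smulRight_apply]
    have := mvfderiv_fun_smul hg h
    rw [this]
    simp only [_root_.add_apply, _root_.smul_apply,
      ContinuousLinearMap.smulRight_apply, smul_add]
    abel

lemma contMDiffAt_frameCov [CompleteSpace E] {Θ : (x : X) → TangentSpace I x →L[ℝ] G}
    {Ω : X → G →L[ℝ] G →L[ℝ] G} {x₀ : X} (hΘ : SmoothForm Θ x₀)
    (hi : ∀ᶠ x in 𝓝 x₀, (Θ x).IsInvertible)
    (hΩ : ContMDiffAt I 𝓘(ℝ, G →L[ℝ] G →L[ℝ] G) ∞ Ω x₀) {σ : (x : X) → TangentSpace I x}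
    (hσ : ContMDiffAt I I.tangent ∞ (fun x ↦ (⟨x, σ x⟩ : TangentBundle I X)) x₀) :
    ContMDiffAt I (I.prod 𝓘(ℝ, E →L[ℝ] E)) ∞
      (fun x ↦ (⟨x, frameCov Θ Ω σ x⟩ :
        TotalSpace (E →L[ℝ] E) fun x : X ↦ TangentSpace I x →L[ℝ] TangentSpace I x)) x₀ := by
  rw [contMDiffAt_hom_bundle]
  have hid := contMDiffAt_id (I := I) (n := ∞) (x := x₀)
  refine ⟨hid, ?_⟩
  have hs := hΘ.contMDiffAt_apply hσ
  have h1 := SmoothForm.mvfderiv hs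
  have h2 : SmoothForm (fun x ↦ ((Ω x).flip (Θ x (σ x))).comp (Θ x)) x₀ := by
    refine SmoothForm.clm_comp hΘ (ContMDiffAt.clm_apply ?_ hs)
    exact ((ContinuousLinearMap.flipₗᵢ ℝ G G G).toContinuousLinearEquiv.contDiff.contMDiff).contMDiffAt.comp
      x₀ hΩ
  refine (ContMDiffAt.clm_comp (hΘ.contMDiffAt_inverse hi.self_of_nhds)
    (ContMDiffAt.add h1 h2)).congr_of_eventuallyEq ?_
  filter_upwards [eventually_mem_trivializationAt_baseSet (I := I) x₀, hi] with x hx hx'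
  rw [ContinuousLinearMap.inCoordinates_eq hx hx]
  ext v
  simp only [ContinuousLinearMap.comp_apply, ContinuousLinearEquiv.coe_coe,
    Trivialization.continuousLinearEquivAt_apply, frameCov]
  rw [trivializationAt_inverse_apply hx hx']
  simp [Trivialization.symmL_apply _ hx]

/-- The difference of two covariant derivatives is a tensor, hence a linear map in the value of the
field at `x`; it is zero once it vanishes on a spanning set. -/
lemma IsCovariantDerivativeOn.eq_of_span_eq_top [FiniteDimensional ℝ E]
    {cov cov' : (Π x : X, TangentSpace I x) → (Π x : X, TangentSpace I x →L[ℝ] TangentSpace I x)}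
    {s : Set X} (hcov : IsCovariantDerivativeOn E cov s) (hcov' : IsCovariantDerivativeOn E cov' s)
    {x : X} (hx : x ∈ s) {S : Set (TangentSpace I x)} (hS : Submodule.span ℝ S = ⊤)
    (h : ∀ w ∈ S, ∃ σ : Π x : X, TangentSpace I x,
      MDifferentiableAt I I.tangent (fun x ↦ (⟨x, σ x⟩ : TangentBundle I X)) x ∧ σ x = w ∧
        cov σ x = cov' σ x) {σ : Π x : X, TangentSpace I x}
    (hσ : MDifferentiableAt I I.tangent (fun x ↦ (⟨x, σ x⟩ : TangentBundle I X)) x) :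
    cov σ x = cov' σ x := by
  have key : (hcov.difference hcov' x).toLinearMap = 0 := by
    refine LinearMap.ext_on hS fun w hw ↦ ?_
    obtain ⟨τ, hτ, rfl, e⟩ := h w hw
    simp [hcov.difference_apply hcov' hx hτ, e]
  have := hcov.difference_apply hcov' hx hσ
  rw [← sub_eq_zero, ← this]
  exact LinearMap.congr_fun key (σ x)

end SmoothForms

/-! ### Charts, Christoffel symbols and the gauge law of connection forms -/

section ChartForms

variable {d : ℕ} {X : Type*} [TopologicalSpace X] [ChartedSpace (EuclideanSpace ℝ (Fin d)) X]

/-- The differential of a chart, as a one-form with values in the model space. -/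
def chartForm (e : OpenPartialHomeomorph X (EuclideanSpace ℝ (Fin d))) (x : X) :
    TangentSpace (𝓡 d) x →L[ℝ] EuclideanSpace ℝ (Fin d) :=
  mvfderiv (𝓡 d) e x

lemma coordForm_eq (e : OpenPartialHomeomorph X (EuclideanSpace ℝ (Fin d))) (a : Fin d) (x : X)
    (v : TangentSpace (𝓡 d) x) : coordForm e a x v = chartForm e x v a := rfl

variable [IsManifold (𝓡 d) ∞ X] {e e₁ : OpenPartialHomeomorph X (EuclideanSpace ℝ (Fin d))}

omit [IsManifold (𝓡 d) ∞ X] in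
lemma isInvertible_chartForm (he : e ∈ IsManifold.maximalAtlas (𝓡 d) ∞ X) {x : X}
    (hx : x ∈ e.source) : (chartForm e x).IsInvertible := by
  have h : e.MDifferentiable (𝓡 d) (𝓡 d) :=
    ⟨(contMDiffOn_of_mem_maximalAtlas he).mdifferentiableOn (by simp),
      (contMDiffOn_symm_of_mem_maximalAtlas he).mdifferentiableOn (by simp)⟩
  exact ⟨h.mfderiv hx, rfl⟩

omit [IsManifold (𝓡 d) ∞ X] in
lemma eventually_isInvertible_chartForm (he : e ∈ IsManifold.maximalAtlas (𝓡 d) ∞ X) {x : X}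
    (hx : x ∈ e.source) : ∀ᶠ y in 𝓝 x, (chartForm e y).IsInvertible :=
  (e.open_source.eventually_mem hx).mono fun _ hy ↦ isInvertible_chartForm he hy

lemma smoothForm_chartForm (he : e ∈ IsManifold.maximalAtlas (𝓡 d) ∞ X) {x : X}
    (hx : x ∈ e.source) : SmoothForm (chartForm e) x :=
  SmoothForm.mvfderiv (contMDiffAt_of_mem_maximalAtlas he hx)

omit [IsManifold (𝓡 d) ∞ X] in
lemma chartForm_coordField (he : e ∈ IsManifold.maximalAtlas (𝓡 d) ∞ X) {x : X}
    (hx : x ∈ e.source) (b : Fin d) :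
    chartForm e x (coordField e b x) = EuclideanSpace.single b 1 :=
  (isInvertible_chartForm he hx).self_apply_inverse _

omit [IsManifold (𝓡 d) ∞ X] in
lemma sum_coordForm_smul_coordField (he : e ∈ IsManifold.maximalAtlas (𝓡 d) ∞ X) {x : X}
    (hx : x ∈ e.source) (v : TangentSpace (𝓡 d) x) :
    ∑ a, coordForm e a x v • coordField e a x = v := by
  apply (isInvertible_chartForm he hx).injective
  simp only [map_sum, map_smul, chartForm_coordField he hx, coordForm_eq]
  ext a
  simp [Finset.sum_apply, Pi.single_apply]

lemma contMDiffAt_coordField (he : e ∈ IsManifold.maximalAtlas (𝓡 d) ∞ X) {x : X}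
    (hx : x ∈ e.source) (b : Fin d) :
    ContMDiffAt (𝓡 d) (𝓡 d).tangent ∞ (fun y ↦ (⟨y, coordField e b y⟩ : TangentBundle (𝓡 d) X)) x := by
  refine (smoothForm_chartForm he hx).contMDiffAt_of_apply (eventually_isInvertible_chartForm he hx) ?_
  refine (contMDiffAt_const (c := (EuclideanSpace.single b 1 : EuclideanSpace ℝ (Fin d)))).congr_of_eventuallyEq ?_
  filter_upwards [e.open_source.eventually_mem hx] with y hy using chartForm_coordField he hy b

omit [IsManifold (𝓡 d) ∞ X] in
lemma span_range_coordField (he : e ∈ IsManifold.maximalAtlas (𝓡 d) ∞ X) {x : X}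
    (hx : x ∈ e.source) : Submodule.span ℝ (Set.range fun a ↦ coordField e a x) = ⊤ := by
  refine eq_top_iff.2 fun v _ ↦ ?_
  rw [← sum_coordForm_smul_coordField he hx v]
  exact Submodule.sum_mem _ fun a _ ↦ Submodule.smul_mem _ _ (Submodule.subset_span ⟨a, rfl⟩)

lemma contMDiffAt_coordForm_apply (he : e ∈ IsManifold.maximalAtlas (𝓡 d) ∞ X) {x : X}
    (hx : x ∈ e.source) (a : Fin d) {σ : (x : X) → TangentSpace (𝓡 d) x}
    (hσ : ContMDiffAt (𝓡 d) (𝓡 d).tangent ∞ (fun x ↦ (⟨x, σ x⟩ : TangentBundle (𝓡 d) X)) x) :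
    ContMDiffAt (𝓡 d) 𝓘(ℝ, ℝ) ∞ (fun x ↦ coordForm e a x (σ x)) x :=
  ((EuclideanSpace.proj a : EuclideanSpace ℝ (Fin d) →L[ℝ] ℝ).contMDiff).contMDiffAt.comp x
    ((smoothForm_chartForm he hx).contMDiffAt_apply hσ)

/-- Smoothness of a connection is a statement about globally smooth fields, whereas a coordinate
field is only meaningful on the chart domain. Multiplying it by a bump function equal to 1 near the
point makes it global, and locality of the connection leaves the coefficients unchanged nearby. -/
lemma LinearConnection.contMDiffAt_coeff [T2Space X] (D : LinearConnection (𝓡 d) X)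
    (he : e ∈ IsManifold.maximalAtlas (𝓡 d) ∞ X) {x : X} (hx : x ∈ e.source) (a b c : Fin d) :
    ContMDiffAt (𝓡 d) 𝓘(ℝ, ℝ) ∞ (D.coeff e a b c) x := by
  obtain ⟨f, -, hf⟩ := (SmoothBumpFunction.nhds_basis_tsupport (I := 𝓡 d) x).mem_iff.1
    (e.open_source.mem_nhds hx)
  have hfσ : ContMDiff (𝓡 d) (𝓡 d).tangent ∞
      (fun y ↦ (⟨y, f y • coordField e b y⟩ : TangentBundle (𝓡 d) X)) := by
    intro y
    by_cases hy : y ∈ tsupport f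
    · exact (f.contMDiff.contMDiffAt).smul_section (contMDiffAt_coordField he (hf hy) b)
    · refine (contMDiffAt_zeroSection ℝ (TangentSpace (𝓡 d))).congr_of_eventuallyEq ?_
      filter_upwards [(isClosed_tsupport f).isOpen_compl.eventually_mem hy] with z hz
      simp [image_eq_zero_of_notMem_tsupport hz, zeroSection]
  have h1 := (D.smooth.contMDiff.contMDiff (σ := fun y ↦ f y • coordField e b y)
    (contMDiffOn_univ.2 (hfσ.of_le (by simp)))).contMDiffAt Filter.univ_mem (x := x)
  have h2 := ContMDiffAt.clm_bundle_apply h1 (contMDiffAt_coordField he hx c)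
  refine (contMDiffAt_coordForm_apply he hx a h2).congr_of_eventuallyEq ?_
  filter_upwards [e.open_source.eventually_mem hx, f.eventuallyEq_one.eventually_nhds] with y hy hfy
  simp only [LinearConnection.coeff]
  congr 2
  refine D.isCovariantDerivativeOnUniv.congr_of_eventuallyEq
    ((contMDiffAt_coordField he hy b).mdifferentiableAt (by simp))
    (hfσ.contMDiffAt.mdifferentiableAt (by simp)) Filter.univ_mem ?_
  filter_upwards [hfy] with z hz
  simp [hz]

/-- The connection forms `ω^a_b = χ^a_{bc} dt^c` of a linear connection in the chart `e`. -/
def LinearConnection.connForm (D : LinearConnection (𝓡 d) X)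
    (e : OpenPartialHomeomorph X (EuclideanSpace ℝ (Fin d))) (a b : Fin d) (x : X)
    (v : TangentSpace (𝓡 d) x) : ℝ :=
  ∑ c, D.coeff e a b c x * coordForm e c x v

lemma LinearConnection.coordForm_apply_coordField (D : LinearConnection (𝓡 d) X)
    (he : e ∈ IsManifold.maximalAtlas (𝓡 d) ∞ X) {x : X} (hx : x ∈ e.source) (a b : Fin d)
    (v : TangentSpace (𝓡 d) x) :
    coordForm e a x (D.toFun (coordField e b) x v) = D.connForm e a b x v := by
  conv_lhs => rw [← sum_coordForm_smul_coordField he hx v]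
  simp [LinearConnection.connForm, LinearConnection.coeff, mul_comm]

lemma LinearConnection.apply_coordField (D : LinearConnection (𝓡 d) X)
    (he : e ∈ IsManifold.maximalAtlas (𝓡 d) ∞ X) {x : X} (hx : x ∈ e.source) (b : Fin d)
    (v : TangentSpace (𝓡 d) x) :
    D.toFun (coordField e b) x v = ∑ a, D.connForm e a b x v • coordField e a x := by
  simp only [← D.coordForm_apply_coordField he hx]
  exact (sum_coordForm_smul_coordField he hx _).symm

/-- The elementary bilinear map `(τ, τ') ↦ τ^c τ'^b e_a`. -/
def elemBilin (a b c : Fin d) : EuclideanSpace ℝ (Fin d) →L[ℝ] EuclideanSpace ℝ (Fin d) →L[ℝ]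
    EuclideanSpace ℝ (Fin d) :=
  (EuclideanSpace.proj c : EuclideanSpace ℝ (Fin d) →L[ℝ] ℝ).smulRight
    ((EuclideanSpace.proj b : EuclideanSpace ℝ (Fin d) →L[ℝ] ℝ).smulRight
      (EuclideanSpace.single a 1))

/-- The Christoffel symbols of a linear connection in the chart `e`, as bilinear maps. -/
def LinearConnection.christoffel (D : LinearConnection (𝓡 d) X)
    (e : OpenPartialHomeomorph X (EuclideanSpace ℝ (Fin d))) (x : X) :
    EuclideanSpace ℝ (Fin d) →L[ℝ] EuclideanSpace ℝ (Fin d) →L[ℝ] EuclideanSpace ℝ (Fin d) :=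
  ∑ a, ∑ b, ∑ c, D.coeff e a b c x • elemBilin a b c

lemma LinearConnection.christoffel_apply (D : LinearConnection (𝓡 d) X) (x : X)
    (v : TangentSpace (𝓡 d) x) (s : EuclideanSpace ℝ (Fin d)) (a : Fin d) :
    D.christoffel e x (chartForm e x v) s a = ∑ b, D.connForm e a b x v * s b := by
  simp only [LinearConnection.christoffel, elemBilin, LinearConnection.connForm]
  simp [Finset.sum_apply, Pi.single_apply, Finset.sum_mul, coordForm_eq, mul_assoc]

/-- Local expression of a linear connection in a chart. -/
lemma LinearConnection.toFun_eq_frameCov (D : LinearConnection (𝓡 d) X)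
    (he : e ∈ IsManifold.maximalAtlas (𝓡 d) ∞ X) {x : X} (hx : x ∈ e.source)
    {σ : (x : X) → TangentSpace (𝓡 d) x}
    (hσ : MDifferentiableAt (𝓡 d) (𝓡 d).tangent (fun x ↦ (⟨x, σ x⟩ : TangentBundle (𝓡 d) X)) x) :
    D.toFun σ x = frameCov (chartForm e) (D.christoffel e) σ x := by
  refine IsCovariantDerivativeOn.eq_of_span_eq_top (s := e.source) D.isCovariantDerivativeOn
    (isCovariantDerivativeOn_frameCov _ (fun x hx ↦ smoothForm_chartForm he hx)
      fun x hx ↦ isInvertible_chartForm he hx) hx (span_range_coordField he hx) ?_ hσ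
  -- On coordinate fields the derivative term vanishes, because their components are constant on the
  -- chart domain, and both sides reduce to the connection forms.
  rintro _ ⟨b, rfl⟩
  refine ⟨coordField e b, (contMDiffAt_coordField he hx b).mdifferentiableAt (by simp), rfl, ?_⟩
  ext v
  apply (isInvertible_chartForm he hx).injective
  rw [apply_frameCov _ _ (isInvertible_chartForm he hx)]
  have h0 : mvfderiv (𝓡 d) (fun y ↦ chartForm e y (coordField e b y)) x = 0 := by
    have : (fun y ↦ chartForm e y (coordField e b y)) =ᶠ[𝓝 x]
        fun _ ↦ (EuclideanSpace.single b 1 : EuclideanSpace ℝ (Fin d)) := by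
      filter_upwards [e.open_source.eventually_mem hx] with y hy using chartForm_coordField he hy b
    rw [this.mvfderiv_eq, mvfderiv_const]
  rw [h0, chartForm_coordField he hx, D.apply_coordField he hx]
  ext a
  simp [D.christoffel_apply, chartForm_coordField he hx, Finset.sum_apply, Pi.single_apply]

lemma LinearConnection.chartForm_toFun (D : LinearConnection (𝓡 d) X)
    (he : e ∈ IsManifold.maximalAtlas (𝓡 d) ∞ X) {x : X} (hx : x ∈ e.source)
    {σ : (x : X) → TangentSpace (𝓡 d) x}
    (hσ : MDifferentiableAt (𝓡 d) (𝓡 d).tangent (fun x ↦ (⟨x, σ x⟩ : TangentBundle (𝓡 d) X)) x)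
    (v : TangentSpace (𝓡 d) x) :
    chartForm e x (D.toFun σ x v) = mvfderiv (𝓡 d) (fun y ↦ chartForm e y (σ y)) x v +
      D.christoffel e x (chartForm e x v) (chartForm e x (σ x)) := by
  rw [D.toFun_eq_frameCov he hx hσ, apply_frameCov _ _ (isInvertible_chartForm he hx)]

/-- The entries of the Jacobian matrix of the coordinate change from `e₁` to `e`. -/
def transition (e e₁ : OpenPartialHomeomorph X (EuclideanSpace ℝ (Fin d))) (a b : Fin d) (x : X) :
    ℝ :=
  coordForm e a x (coordField e₁ b x)

lemma contMDiffAt_transition (he : e ∈ IsManifold.maximalAtlas (𝓡 d) ∞ X)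
    (he₁ : e₁ ∈ IsManifold.maximalAtlas (𝓡 d) ∞ X) {x : X} (hx : x ∈ e.source)
    (hx₁ : x ∈ e₁.source) (a b : Fin d) :
    ContMDiffAt (𝓡 d) 𝓘(ℝ, ℝ) ∞ (transition e e₁ a b) x :=
  contMDiffAt_coordForm_apply he hx a (contMDiffAt_coordField he₁ hx₁ b)

omit [IsManifold (𝓡 d) ∞ X] in
lemma coordForm_eq_sum_transition (he₁ : e₁ ∈ IsManifold.maximalAtlas (𝓡 d) ∞ X) {x : X}
    (hx₁ : x ∈ e₁.source) (a : Fin d) (v : TangentSpace (𝓡 d) x) :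
    coordForm e a x v = ∑ c, transition e e₁ a c x * coordForm e₁ c x v := by
  conv_lhs => rw [← sum_coordForm_smul_coordField he₁ hx₁ v]
  simp [transition, mul_comm]

omit [IsManifold (𝓡 d) ∞ X] in
lemma coordField_eq_sum_transition (he : e ∈ IsManifold.maximalAtlas (𝓡 d) ∞ X) {x : X}
    (hx : x ∈ e.source) (b : Fin d) :
    coordField e₁ b x = ∑ c, transition e e₁ c b x • coordField e c x :=
  (sum_coordForm_smul_coordField he hx _).symm

/-- The gauge law `dJ = J ω₁ - ω J`. The `e`-components of the covariant derivative of a coordinate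
field of `e₁` are computed twice: in `e` they are `dJ + ω J`, while expanding in the `e₁`-frame
first gives `J ω₁`. -/
lemma LinearConnection.mvfderiv_transition (D : LinearConnection (𝓡 d) X)
    (he : e ∈ IsManifold.maximalAtlas (𝓡 d) ∞ X) (he₁ : e₁ ∈ IsManifold.maximalAtlas (𝓡 d) ∞ X)
    {x : X} (hx : x ∈ e.source) (hx₁ : x ∈ e₁.source) (a b : Fin d) (v : TangentSpace (𝓡 d) x) :
    mvfderiv (𝓡 d) (transition e e₁ a b) x v =
      ∑ c, transition e e₁ a c x * D.connForm e₁ c b x v -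
        ∑ c, D.connForm e a c x v * transition e e₁ c b x := by
  have hσ := contMDiffAt_coordField he₁ hx₁ b
  have h := congrArg (EuclideanSpace.proj a : EuclideanSpace ℝ (Fin d) →L[ℝ] ℝ)
    (D.chartForm_toFun he hx (hσ.mdifferentiableAt (by simp)) v)
  have h2 : mvfderiv (𝓡 d) (transition e e₁ a b) x v =
      (EuclideanSpace.proj a : EuclideanSpace ℝ (Fin d) →L[ℝ] ℝ)
        (mvfderiv (𝓡 d) (fun y ↦ chartForm e y (coordField e₁ b y)) x v) := by
    have hf : MDifferentiableAt (𝓡 d) 𝓘(ℝ, EuclideanSpace ℝ (Fin d))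
        (fun y ↦ chartForm e y (coordField e₁ b y)) x :=
      ((smoothForm_chartForm he hx).contMDiffAt_apply hσ).mdifferentiableAt (by simp)
    have := mvfderiv_clm_apply (EuclideanSpace.proj a : EuclideanSpace ℝ (Fin d) →L[ℝ] ℝ) hf v
    exact this
  rw [h2, eq_sub_iff_add_eq]
  rw [D.apply_coordField he₁ hx₁, map_add] at h
  rw [map_sum, map_sum] at h
  change _ = _ + D.christoffel e x (chartForm e x v) (chartForm e x (coordField e₁ b x)) a at h
  rw [D.christoffel_apply] at h
  refine Eq.trans h.symm ?_
  simp [transition, coordForm_eq, mul_comm]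

end ChartForms

/-! ### Linear connections on paracompact manifolds -/

section Existence

variable {d : ℕ} {X : Type*} [TopologicalSpace X] [ChartedSpace (EuclideanSpace ℝ (Fin d)) X]
  [IsManifold (𝓡 d) ∞ X]

/-- A compact set in an open set carries a smooth bump function. -/
lemma IsCompact.exists_contMDiff_pos_tsupport_subset [T2Space X] {K V : Set X} (hK : IsCompact K)
    (hV : IsOpen V) (hKV : K ⊆ V) :
    ∃ h : X → ℝ, ContMDiff (𝓡 d) 𝓘(ℝ, ℝ) ∞ h ∧ (∀ x, 0 ≤ h x) ∧ (∀ x ∈ K, 0 < h x) ∧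
      tsupport h ⊆ V := by
  refine hK.induction_on (p := fun K ↦ ∃ h : X → ℝ, ContMDiff (𝓡 d) 𝓘(ℝ, ℝ) ∞ h ∧ (∀ x, 0 ≤ h x) ∧
      (∀ x ∈ K, 0 < h x) ∧ tsupport h ⊆ V) ?_ ?_ ?_ ?_
  · exact ⟨fun _ ↦ 0, contMDiff_const, fun _ ↦ le_rfl, by simp, by simp [tsupport]⟩
  · rintro s t hst ⟨h, h1, h2, h3, h4⟩
    exact ⟨h, h1, h2, fun x hx ↦ h3 x (hst hx), h4⟩
  · rintro s t ⟨h, h1, h2, h3, h4⟩ ⟨k, k1, k2, k3, k4⟩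
    refine ⟨h + k, h1.add k1, fun x ↦ add_nonneg (h2 x) (k2 x), ?_,
      (tsupport_add h k).trans (Set.union_subset h4 k4)⟩
    rintro x (hx | hx)
    · exact add_pos_of_pos_of_nonneg (h3 x hx) (k2 x)
    · exact add_pos_of_nonneg_of_pos (h2 x) (k3 x hx)
  -- Compactness reduces the claim to neighbourhoods of single points, where a bump function does
  -- it; the functions of finitely many points are added.
  · intro x hx
    obtain ⟨f, -, hf⟩ := (SmoothBumpFunction.nhds_basis_tsupport (I := 𝓡 d) x).mem_iff.1
      (hV.mem_nhds (hKV hx))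
    refine ⟨Function.support f, mem_nhdsWithin_of_mem_nhds f.support_mem_nhds, f, f.contMDiff,
      fun _ ↦ f.nonneg, fun y hy ↦ lt_of_le_of_ne f.nonneg (Ne.symm hy), hf⟩

-- Uses paracompactness without any countability. The supports of chart bump functions are refined
-- to a locally finite cover `V`, which is shrunk to `W` with `closure (W i) ⊆ V i`. Each closure is
-- compact, as it lies in the compact support of a bump function, so a smooth function positive on
-- it and supported in `V i` exists.
variable (d X) in
lemma exists_locallyFinite_bump [T2Space X] [ParacompactSpace X] :
    ∃ f : X → X → ℝ, LocallyFinite (fun i ↦ Function.support (f i)) ∧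
      (∀ i, ContMDiff (𝓡 d) 𝓘(ℝ, ℝ) ∞ (f i)) ∧ (∀ i x, 0 ≤ f i x) ∧
      (∀ i, tsupport (f i) ⊆ (chartAt (EuclideanSpace ℝ (Fin d)) i).source) ∧
      ∀ x, ∃ i, 0 < f i x := by
  let g (i : X) : SmoothBumpFunction (𝓡 d) i := Classical.arbitrary _
  obtain ⟨V, hVo, hVc, hVf, hVg⟩ := precise_refinement (fun i ↦ Function.support (g i))
    (fun i ↦ (g i).isOpen_support) (Set.iUnion_eq_univ_iff.2 fun x ↦ ⟨x, mem_of_mem_nhds (g x).support_mem_nhds⟩)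
  obtain ⟨W, hWc, hWo, hWV⟩ := exists_iUnion_eq_closure_subset hVo hVf.point_finite hVc
  have hK (i : X) : IsCompact (closure (W i)) :=
    (g i).hasCompactSupport.isCompact.of_isClosed_subset isClosed_closure
      ((hWV i).trans ((hVg i).trans subset_closure))
  choose f f1 f2 f3 f4 using fun i ↦
    (hK i).exists_contMDiff_pos_tsupport_subset (d := d) (hVo i) (hWV i)
  refine ⟨f, hVf.subset fun i ↦ subset_closure.trans (f4 i), f1, f2, fun i ↦ ?_, fun x ↦ ?_⟩
  · exact (f4 i).trans ((hVg i).trans (subset_closure.trans (g i).tsupport_subset_chartAt_source))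
  · obtain ⟨i, hi⟩ := Set.iUnion_eq_univ_iff.1 hWc x
    exact ⟨i, f3 i x (subset_closure hi)⟩

variable (d X) in
/-- A paracompact smooth manifold carries a smooth linear connection. -/
theorem nonempty_linearConnection [T2Space X] [ParacompactSpace X] :
    Nonempty (LinearConnection (𝓡 d) X) := by
  obtain ⟨f, hf, fs, f0, fc, fp⟩ := exists_locallyFinite_bump d X
  let g (x : X) : ℝ := ∑ᶠ i, f i x
  have hg : ContMDiff (𝓡 d) 𝓘(ℝ, ℝ) ∞ g := contMDiff_finsum fs hf
  have gpos (x : X) : 0 < g x := by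
    obtain ⟨i, hi⟩ := fp x
    exact finsum_pos (fun j ↦ f0 j x) ⟨i, hi⟩ (hf.point_finite x)
  let ρ (i x : X) : ℝ := (g x)⁻¹ * f i x
  have hρs (i : X) : ContMDiff (𝓡 d) 𝓘(ℝ, ℝ) ∞ (ρ i) :=
    (hg.inv₀ fun x ↦ (gpos x).ne').mul (fs i)
  have hρsupp (i : X) : Function.support (ρ i) ⊆ Function.support (f i) := fun x hx hx' ↦ hx (by
    simp [ρ, hx'])
  -- With zero Christoffel symbols this is the flat connection of the chart at `i`, a covariant
  -- derivative only on the chart domain.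
  let D (i : X) := frameCov (chartForm (chartAt (EuclideanSpace ℝ (Fin d)) i))
    (0 : X → EuclideanSpace ℝ (Fin d) →L[ℝ] EuclideanSpace ℝ (Fin d) →L[ℝ] EuclideanSpace ℝ (Fin d))
  have hat (i : X) : chartAt (EuclideanSpace ℝ (Fin d)) i ∈ IsManifold.maximalAtlas (𝓡 d) ∞ X :=
    IsManifold.chart_mem_maximalAtlas i
  have hD (i : X) : IsCovariantDerivativeOn (EuclideanSpace ℝ (Fin d)) (I := 𝓡 d) (D i)
      (chartAt (EuclideanSpace ℝ (Fin d)) i).source :=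
    isCovariantDerivativeOn_frameCov _ (fun x hx ↦ smoothForm_chartForm (hat i) hx)
      fun x hx ↦ isInvertible_chartForm (hat i) hx
  -- The finitely many indices that contribute at `x`; the chart domain of each contains `x`, so the
  -- axioms can be checked summand by summand.
  let S (x : X) : Finset X := (hf.point_finite x).toFinset
  have hS {x i : X} (hi : i ∈ S x) : x ∈ (chartAt (EuclideanSpace ℝ (Fin d)) i).source :=
    fc i (subset_closure (by simpa [S] using hi))
  have hρ1 (x : X) : ∑ i ∈ S x, ρ i x = 1 := by
    have : g x = ∑ i ∈ S x, f i x :=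
      finsum_eq_sum_of_support_subset _ (by intro i hi; simpa [S] using hi)
    rw [← Finset.mul_sum, ← this, inv_mul_cancel₀ (gpos x).ne']
  let C (σ : (x : X) → TangentSpace (𝓡 d) x) (x : X) :
    TangentSpace (𝓡 d) x →L[ℝ] TangentSpace (𝓡 d) x := ∑ᶠ i, ρ i x • D i σ x
  have hC (σ : (x : X) → TangentSpace (𝓡 d) x) (x : X) : C σ x = ∑ i ∈ S x, ρ i x • D i σ x := by
    refine finsum_eq_sum_of_support_subset _ fun i hi ↦ ?_
    have : f i x ≠ 0 := fun h ↦ hi (by simp [ρ, h])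
    simpa [S] using this
  refine ⟨⟨⟨C, ?_, ?_⟩, ⟨⟨?_⟩⟩⟩⟩
  · intro σ σ' x hσ hσ' _
    rw [hC, hC, hC, ← Finset.sum_add_distrib]
    refine Finset.sum_congr rfl fun i hi ↦ ?_
    rw [(hD i).add hσ hσ' (hS hi), smul_add]
  · intro σ g x hσ hg _
    rw [hC, hC, Finset.smul_sum]
    -- The Leibniz term is spread over the summands by writing 1 as the sum of the weights: an
    -- average of connections is a connection only because of this.
    conv_rhs => rw [← one_smul ℝ ((mvfderiv (𝓡 d) g x).smulRight (σ x)), ← hρ1 x, Finset.sum_smul,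
      ← Finset.sum_add_distrib]
    refine Finset.sum_congr rfl fun i hi ↦ ?_
    rw [(hD i).leibniz hσ hg (hS hi), smul_add, smul_comm]
  · intro σ hσ x _
    refine ContMDiffAt.contMDiffWithinAt ?_
    refine ContMDiffAt.finsum_section_of_locallyFinite (t := fun i x ↦ ρ i x • D i σ x) ?_ ?_
    · refine hf.subset fun i x hx ↦ hρsupp i fun h ↦ hx ?_
      simp [h]
    · intro i
      by_cases hx : x ∈ (chartAt (EuclideanSpace ℝ (Fin d)) i).source
      · refine (hρs i).contMDiffAt.smul_section ?_
        exact contMDiffAt_frameCov (smoothForm_chartForm (hat i) hx)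
          (eventually_isInvertible_chartForm (hat i) hx) contMDiffAt_const
          ((hσ.of_le (by simp)).contMDiffAt Filter.univ_mem)
      -- Off the chart domain the flat connection says nothing, but the weight vanishes in a whole
      -- neighbourhood.
      · have hx' : x ∉ tsupport (f i) := fun h ↦ hx (fc i h)
        refine (contMDiffAt_zeroSection ℝ
          (fun x : X ↦ TangentSpace (𝓡 d) x →L[ℝ] TangentSpace (𝓡 d) x)).congr_of_eventuallyEq ?_
        filter_upwards [(isClosed_tsupport (f i)).isOpen_compl.eventually_mem hx'] with z hz
        have : f i z = 0 := image_eq_zero_of_notMem_tsupport hz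
        simp [ρ, this, zeroSection]

end Existence

/-! ### Elementary 1-jets and the polymomentum coordinates -/

section DualJetCoordinates

variable {m n : ℕ}
  {T : Type*} [TopologicalSpace T] [ChartedSpace (EuclideanSpace ℝ (Fin m)) T]
  {M : Type*} [TopologicalSpace M] [ChartedSpace (EuclideanSpace ℝ (Fin n)) M]
  [IsManifold (𝓡 m) ∞ T] [IsManifold (𝓡 n) ∞ M]
  {e : OpenPartialHomeomorph T (EuclideanSpace ℝ (Fin m))}
  {e' : OpenPartialHomeomorph M (EuclideanSpace ℝ (Fin n))}

/-- The 1-jet `∂/∂x^i ⊗ dt^a`. -/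
def elemJet (e : OpenPartialHomeomorph T (EuclideanSpace ℝ (Fin m)))
    (e' : OpenPartialHomeomorph M (EuclideanSpace ℝ (Fin n))) (i : Fin n) (a : Fin m) (p : T × M) :
    JetFibre m n T M p :=
  ((coordForm e a p.1).smulRight (coordField e' i p.2) :
    TangentSpace (𝓡 m) p.1 →L[ℝ] TangentSpace (𝓡 n) p.2)

/-- Both sides are the vector of the fibre over `f b` that `e` sends to `v`, since a pulled-back
trivialization acts on fibres as the original one does. -/
lemma pullback_trivialization_symmL {B B' F : Type*} {V : B → Type*} [TopologicalSpace B]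
    [TopologicalSpace B'] [NormedAddCommGroup F] [NormedSpace ℝ F] [TopologicalSpace (TotalSpace F V)]
    [∀ x, AddCommGroup (V x)] [∀ x, Module ℝ (V x)] [∀ x, TopologicalSpace (V x)]
    [FiberBundle F V] [VectorBundle ℝ F V] {K : Type*} [FunLike K B' B]
    [ContinuousMapClass K B' B] (f : K) (e : Trivialization F (π F V))
    [MemTrivializationAtlas e] {b : B'} (hb : f b ∈ e.baseSet) (v : F) :
    ((e.pullback f).symm b v : V (f b)) = e.symm (f b) v := by
  have h1 : (e.pullback f) ⟨b, (e.pullback f).symm b v⟩ = (b, v) :=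
    (e.pullback f).apply_mk_symm hb v
  have h2 : e ⟨f b, ((e.pullback f).symm b v : V (f b))⟩ = (f b, v) := by
    have h3 : ((e.pullback f) ⟨b, (e.pullback f).symm b v⟩).2 = v := by rw [h1]
    exact Prod.ext (e.coe_fst' hb) h3
  rw [← e.symm_apply_apply_mk hb (((e.pullback f).symm b v : V (f b))), h2]

/-- In bundle coordinates the jet is the rank-one map formed from the local expressions of `dt^a`
and `∂/∂x^i`. Both are smooth, and forming rank-one maps is a fixed continuous bilinear operation.
-/
lemma contMDiffAt_elemJet (he : e ∈ IsManifold.maximalAtlas (𝓡 m) ∞ T)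
    (he' : e' ∈ IsManifold.maximalAtlas (𝓡 n) ∞ M) (i : Fin n) (a : Fin m) {p : T × M}
    (hp : p.1 ∈ e.source) (hp' : p.2 ∈ e'.source) :
    ContMDiffAt ((𝓡 m).prod (𝓡 n)) (((𝓡 m).prod (𝓡 n)).prod 𝓘(ℝ, JetModel m n)) ∞
      (fun q ↦ (⟨q, elemJet e e' i a q⟩ : TotalSpace (JetModel m n) (JetFibre m n T M))) p := by
  rw [contMDiffAt_hom_bundle]
  refine ⟨contMDiffAt_id (I := (𝓡 m).prod (𝓡 n)) (n := ∞) (x := p), ?_⟩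
  have h1 : ContMDiffAt ((𝓡 m).prod (𝓡 n)) 𝓘(ℝ, EuclideanSpace ℝ (Fin m) →L[ℝ] ℝ) ∞
      (fun q : T × M ↦ ((coordForm e a q.1).comp ((trivializationAt (EuclideanSpace ℝ (Fin m))
        (TangentSpace (𝓡 m)) p.1).symmL ℝ q.1) : EuclideanSpace ℝ (Fin m) →L[ℝ] ℝ)) p :=
    ContMDiffAt.comp p (f := Prod.fst) (SmoothForm.clm_comp (smoothForm_chartForm he hp)
      (L := fun _ ↦ EuclideanSpace.proj a) contMDiffAt_const) contMDiffAt_fst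
  have h2 : ContMDiffAt ((𝓡 m).prod (𝓡 n)) 𝓘(ℝ, EuclideanSpace ℝ (Fin n)) ∞
      (fun q : T × M ↦ (trivializationAt (EuclideanSpace ℝ (Fin n)) (TangentSpace (𝓡 n)) p.2
        ⟨q.2, coordField e' i q.2⟩).2) p :=
    ContMDiffAt.comp p (f := Prod.snd) ((contMDiffAt_section _).1
      (contMDiffAt_coordField he' hp' i)) contMDiffAt_snd
  have h3 := ContMDiffAt.clm_apply (ContMDiffAt.clm_apply (contMDiffAt_const
    (c := ContinuousLinearMap.smulRightL ℝ (EuclideanSpace ℝ (Fin m)) (EuclideanSpace ℝ (Fin n)))) h1) h2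
  refine h3.congr_of_eventuallyEq ?_
  have t1 : ∀ᶠ q : T × M in 𝓝 p, q.1 ∈ (trivializationAt (EuclideanSpace ℝ (Fin m))
      (TangentSpace (𝓡 m) : T → Type _) p.1).baseSet :=
    continuous_fst.continuousAt.eventually (eventually_mem_trivializationAt_baseSet (I := 𝓡 m) p.1)
  have t2 : ∀ᶠ q : T × M in 𝓝 p, q.2 ∈ (trivializationAt (EuclideanSpace ℝ (Fin n))
      (TangentSpace (𝓡 n) : M → Type _) p.2).baseSet :=
    continuous_snd.continuousAt.eventually (eventually_mem_trivializationAt_baseSet (I := 𝓡 n) p.2)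
  filter_upwards [t1, t2] with q hq1 hq2
  ext v : 1
  rw [ContinuousLinearMap.inCoordinates_eq (by exact hq1) (by exact hq2)]
  have h4 : (((trivializationAt (EuclideanSpace ℝ (Fin m)) (TangentSpace (𝓡 m) : T → Type _)
      p.1).pullback (ContMDiffMap.fst : C^∞⟮(𝓡 m).prod (𝓡 n), T × M; 𝓡 m, T⟯)).symm q v :
        TangentSpace (𝓡 m) q.1) = (trivializationAt (EuclideanSpace ℝ (Fin m))
        (TangentSpace (𝓡 m)) p.1).symmL ℝ q.1 v := by
    rw [Trivialization.symmL_apply _ hq1]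
    exact pullback_trivialization_symmL
      (ContMDiffMap.fst : C^∞⟮(𝓡 m).prod (𝓡 n), T × M; 𝓡 m, T⟯) _ hq1 v
  change ((trivializationAt (EuclideanSpace ℝ (Fin n)) (TangentSpace (𝓡 n)) p.2)
    ⟨q.2, (coordForm e a q.1 (((trivializationAt (EuclideanSpace ℝ (Fin m))
      (TangentSpace (𝓡 m) : T → Type _) p.1).pullback
      (ContMDiffMap.fst : C^∞⟮(𝓡 m).prod (𝓡 n), T × M; 𝓡 m, T⟯)).symm q v)) • coordField e' i q.2⟩).2 =
    (coordForm e a q.1 ((trivializationAt (EuclideanSpace ℝ (Fin m))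
        (TangentSpace (𝓡 m)) p.1).symmL ℝ q.1 v)) •
      ((trivializationAt (EuclideanSpace ℝ (Fin n)) (TangentSpace (𝓡 n)) p.2)
        ⟨q.2, coordField e' i q.2⟩).2
  rw [h4]
  exact ((trivializationAt (EuclideanSpace ℝ (Fin n)) (TangentSpace (𝓡 n) : M → Type _) p.2).linear ℝ hq2).map_smul _ _

/-- The coordinate function of the fibre in the preferred trivialization at `p`. -/
def fibreCoord (p : T × M) (u : DualJet m n T M) : DualJetModel m n :=
  (trivializationAt (DualJetModel m n) (DualJetFibre m n T M) p u).2

/-- The trivialization of a bundle of linear maps conjugates by the trivializations of source and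
target. Pairing a form with a jet therefore gives the same number in bundle coordinates, where
smoothness and derivatives are accessible. -/
lemma polymomentum_eq_fibreCoord (i : Fin n) (a : Fin m) {p : T × M} {u : DualJet m n T M}
    (hu : u.proj ∈ (trivializationAt (JetModel m n) (JetFibre m n T M) p).baseSet) :
    polymomentum e e' i a u = fibreCoord p u
      (trivializationAt (JetModel m n) (JetFibre m n T M) p ⟨u.proj, elemJet e e' i a u.proj⟩).2 := by
  let φ : JetFibre m n T M u.proj →L[ℝ] Bundle.Trivial (T × M) ℝ u.proj := u.snd
  have h2 : u.proj ∈ (trivializationAt ℝ (Bundle.Trivial (T × M) ℝ) p).baseSet := Set.mem_univ _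
  have h : fibreCoord p u = _ := ContinuousLinearMap.inCoordinates_eq (F := JetModel m n)
    (E := JetFibre m n T M) (F' := ℝ) (E' := Bundle.Trivial (T × M) ℝ) (ϕ := φ) hu h2
  rw [h]
  simp only [ContinuousLinearMap.comp_apply, ContinuousLinearEquiv.coe_coe]
  have h3 : ((trivializationAt (JetModel m n) (JetFibre m n T M) p).continuousLinearEquivAt ℝ
    u.proj hu).symm (trivializationAt (JetModel m n) (JetFibre m n T M) p
      ⟨u.proj, elemJet e e' i a u.proj⟩).2 = elemJet e e' i a u.proj :=
    ((trivializationAt (JetModel m n) (JetFibre m n T M) p).continuousLinearEquivAt ℝ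
      u.proj hu).symm_apply_apply _
  rw [h3]
  rfl

lemma mem_coordDomain_eventually (e : OpenPartialHomeomorph T (EuclideanSpace ℝ (Fin m)))
    (e' : OpenPartialHomeomorph M (EuclideanSpace ℝ (Fin n))) {u : DualJet m n T M}
    (hu : u ∈ coordDomain e e') : ∀ᶠ v in 𝓝 u, v ∈ coordDomain e e' := by
  have hc : Continuous (fun v : DualJet m n T M ↦ v.proj) := FiberBundle.continuous_proj _ _
  exact ((e.open_source.preimage (continuous_fst.comp hc)).inter
    (e'.open_source.preimage (continuous_snd.comp hc))).eventually_mem hu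

end DualJetCoordinates

/-! ### Smoothness and differential of the induced coordinates -/

section DualJetDifferentials

variable {m n : ℕ}
  {T : Type*} [TopologicalSpace T] [ChartedSpace (EuclideanSpace ℝ (Fin m)) T]
  {M : Type*} [TopologicalSpace M] [ChartedSpace (EuclideanSpace ℝ (Fin n)) M]
  [IsManifold (𝓡 m) ∞ T] [IsManifold (𝓡 n) ∞ M]
  {e : OpenPartialHomeomorph T (EuclideanSpace ℝ (Fin m))}
  {e' : OpenPartialHomeomorph M (EuclideanSpace ℝ (Fin n))}

/-- The differential of the projection `E* → T`. -/
def baseT (u : DualJet m n T M) : TangentSpace (DualJetI m n) u →L[ℝ] TangentSpace (𝓡 m) u.proj.1 :=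
  mfderiv (DualJetI m n) (𝓡 m) (fun v : DualJet m n T M ↦ v.proj.1) u

/-- The differential of the projection `E* → M`. -/
def baseM (u : DualJet m n T M) : TangentSpace (DualJetI m n) u →L[ℝ] TangentSpace (𝓡 n) u.proj.2 :=
  mfderiv (DualJetI m n) (𝓡 n) (fun v : DualJet m n T M ↦ v.proj.2) u

lemma contMDiff_dualJet_proj : ContMDiff (DualJetI m n) ((𝓡 m).prod (𝓡 n)) ∞
    (fun v : DualJet m n T M ↦ v.proj) := contMDiff_proj _

lemma contMDiff_dualJet_fst : ContMDiff (DualJetI m n) (𝓡 m) ∞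
    (fun v : DualJet m n T M ↦ v.proj.1) := contMDiff_fst.comp contMDiff_dualJet_proj

lemma contMDiff_dualJet_snd : ContMDiff (DualJetI m n) (𝓡 n) ∞
    (fun v : DualJet m n T M ↦ v.proj.2) := contMDiff_snd.comp contMDiff_dualJet_proj

lemma mfderiv_dualJet_proj (u : DualJet m n T M) (v : TangentSpace (DualJetI m n) u) :
    mfderiv (DualJetI m n) ((𝓡 m).prod (𝓡 n)) (fun v : DualJet m n T M ↦ v.proj) u v =
      (baseT u v, baseM u v) := by
  have h := mfderiv_prodMk (contMDiff_dualJet_fst (T := T) (M := M) |>.mdifferentiable (by simp) u)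
    (contMDiff_dualJet_snd (T := T) (M := M) |>.mdifferentiable (by simp) u)
  exact congrArg (fun L : TangentSpace (DualJetI m n) u →L[ℝ] _ ↦ L v) h

lemma mem_verticalSpace_iff (u : DualJet m n T M) (v : TangentSpace (DualJetI m n) u) :
    v ∈ verticalSpace u ↔ baseT u v = 0 ∧ baseM u v = 0 := by
  have h := mfderiv_dualJet_proj u v
  rw [verticalSpace, LinearMap.mem_ker]
  change mfderiv (DualJetI m n) ((𝓡 m).prod (𝓡 n)) (fun v : DualJet m n T M ↦ v.proj) u v = 0 ↔ _
  rw [h]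
  exact Prod.mk_eq_zero

lemma contMDiffAt_fibreCoord (u : DualJet m n T M) :
    ContMDiffAt (DualJetI m n) 𝓘(ℝ, DualJetModel m n) ∞ (fibreCoord u.proj) u :=
  (contMDiffAt_totalSpace.1 (contMDiffAt_id (I := DualJetI m n) (x := u))).2

/-- `elemJet` in the preferred trivialization at `p`. -/
def elemJetCoord (e : OpenPartialHomeomorph T (EuclideanSpace ℝ (Fin m)))
    (e' : OpenPartialHomeomorph M (EuclideanSpace ℝ (Fin n))) (p : T × M) (i : Fin n) (a : Fin m)
    (q : T × M) : JetModel m n :=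
  (trivializationAt (JetModel m n) (JetFibre m n T M) p ⟨q, elemJet e e' i a q⟩).2

lemma contMDiffAt_elemJetCoord (he : e ∈ IsManifold.maximalAtlas (𝓡 m) ∞ T)
    (he' : e' ∈ IsManifold.maximalAtlas (𝓡 n) ∞ M) (i : Fin n) (a : Fin m) {p : T × M}
    (hp : p.1 ∈ e.source) (hp' : p.2 ∈ e'.source) :
    ContMDiffAt ((𝓡 m).prod (𝓡 n)) 𝓘(ℝ, JetModel m n) ∞ (elemJetCoord e e' p i a) p :=
  (contMDiffAt_section p).1 (contMDiffAt_elemJet he he' i a hp hp')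

lemma polymomentum_eventuallyEq (i : Fin n) (a : Fin m) (u : DualJet m n T M) :
    polymomentum e e' i a =ᶠ[𝓝 u]
      fun v ↦ fibreCoord u.proj v (elemJetCoord e e' u.proj i a v.proj) := by
  have hc : Continuous (fun v : DualJet m n T M ↦ v.proj) := FiberBundle.continuous_proj _ _
  have h : u.proj ∈ (trivializationAt (JetModel m n) (JetFibre m n T M) u.proj).baseSet :=
    FiberBundle.mem_baseSet_trivializationAt' _
  filter_upwards [hc.continuousAt.eventually
    ((trivializationAt (JetModel m n) (JetFibre m n T M) u.proj).open_baseSet.eventually_mem h)]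
    with v hv using polymomentum_eq_fibreCoord i a hv

lemma contMDiffAt_polymomentum (he : e ∈ IsManifold.maximalAtlas (𝓡 m) ∞ T)
    (he' : e' ∈ IsManifold.maximalAtlas (𝓡 n) ∞ M) (i : Fin n) (a : Fin m) {u : DualJet m n T M}
    (hu : u ∈ coordDomain e e') :
    ContMDiffAt (DualJetI m n) 𝓘(ℝ, ℝ) ∞ (polymomentum e e' i a) u := by
  refine ContMDiffAt.congr_of_eventuallyEq ?_ (polymomentum_eventuallyEq i a u)
  exact (contMDiffAt_fibreCoord u).clm_apply
    ((contMDiffAt_elemJetCoord he he' i a hu.1 hu.2).comp u contMDiff_dualJet_proj.contMDiffAt)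

lemma contMDiffAt_coords (he : e ∈ IsManifold.maximalAtlas (𝓡 m) ∞ T)
    (he' : e' ∈ IsManifold.maximalAtlas (𝓡 n) ∞ M) {u : DualJet m n T M}
    (hu : u ∈ coordDomain e e') :
    ContMDiffAt (DualJetI m n) 𝓘(ℝ, CoordSpace m n) ∞ (coords e e') u := by
  refine ContMDiffAt.prodMk_space ?_ (ContMDiffAt.prodMk_space ?_ ?_)
  · exact (contMDiffAt_of_mem_maximalAtlas he hu.1).comp u contMDiff_dualJet_fst.contMDiffAt
  · exact (contMDiffAt_of_mem_maximalAtlas he' hu.2).comp u contMDiff_dualJet_snd.contMDiffAt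
  · exact contMDiffAt_pi_space.2 fun i ↦ contMDiffAt_pi_space.2 fun a ↦
      contMDiffAt_polymomentum he he' i a hu

/-- The differential of the coordinates `(t^a, x^i, p_i^a)`. -/
def coordDiff (e : OpenPartialHomeomorph T (EuclideanSpace ℝ (Fin m)))
    (e' : OpenPartialHomeomorph M (EuclideanSpace ℝ (Fin n))) (u : DualJet m n T M) :
    TangentSpace (DualJetI m n) u →L[ℝ] CoordSpace m n :=
  mvfderiv (DualJetI m n) (coords e e') u

lemma smoothForm_coordDiff (he : e ∈ IsManifold.maximalAtlas (𝓡 m) ∞ T)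
    (he' : e' ∈ IsManifold.maximalAtlas (𝓡 n) ∞ M) {u : DualJet m n T M}
    (hu : u ∈ coordDomain e e') : SmoothForm (coordDiff e e') u :=
  SmoothForm.mvfderiv (contMDiffAt_coords he he' hu)

lemma coordDiff_fst (he : e ∈ IsManifold.maximalAtlas (𝓡 m) ∞ T)
    (he' : e' ∈ IsManifold.maximalAtlas (𝓡 n) ∞ M) {u : DualJet m n T M}
    (hu : u ∈ coordDomain e e') (v : TangentSpace (DualJetI m n) u) :
    (coordDiff e e' u v).1 = chartForm e u.proj.1 (baseT u v) := by
  have h := mvfderiv_clm_apply (I := DualJetI m n) (ContinuousLinearMap.fst ℝ (EuclideanSpace ℝ (Fin m))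
    (EuclideanSpace ℝ (Fin n) × (Fin n → Fin m → ℝ)))
    ((contMDiffAt_coords he he' hu).mdifferentiableAt (by simp)) v
  refine h.symm.trans ?_
  have h2 := mfderiv_comp_apply (I := DualJetI m n) (I' := 𝓡 m) (I'' := 𝓡 m) u (g := e)
    (f := fun v : DualJet m n T M ↦ v.proj.1)
    ((contMDiffAt_of_mem_maximalAtlas he hu.1).mdifferentiableAt (by simp))
    (contMDiff_dualJet_fst.mdifferentiable (by simp) u) v
  exact h2

lemma coordDiff_snd (he : e ∈ IsManifold.maximalAtlas (𝓡 m) ∞ T)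
    (he' : e' ∈ IsManifold.maximalAtlas (𝓡 n) ∞ M) {u : DualJet m n T M}
    (hu : u ∈ coordDomain e e') (v : TangentSpace (DualJetI m n) u) :
    (coordDiff e e' u v).2.1 = chartForm e' u.proj.2 (baseM u v) := by
  have h := mvfderiv_clm_apply (I := DualJetI m n)
    ((ContinuousLinearMap.fst ℝ (EuclideanSpace ℝ (Fin n)) (Fin n → Fin m → ℝ)).comp
      (ContinuousLinearMap.snd ℝ (EuclideanSpace ℝ (Fin m))
        (EuclideanSpace ℝ (Fin n) × (Fin n → Fin m → ℝ))))
    ((contMDiffAt_coords he he' hu).mdifferentiableAt (by simp)) v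
  refine h.symm.trans ?_
  have h2 := mfderiv_comp_apply (I := DualJetI m n) (I' := 𝓡 n) (I'' := 𝓡 n) u (g := e')
    (f := fun v : DualJet m n T M ↦ v.proj.2)
    ((contMDiffAt_of_mem_maximalAtlas he' hu.2).mdifferentiableAt (by simp))
    (contMDiff_dualJet_snd.mdifferentiable (by simp) u) v
  exact h2

/-- The coordinate projection `(t, x, p) ↦ p_i^a`. -/
def momentumProj (i : Fin n) (a : Fin m) : CoordSpace m n →L[ℝ] ℝ :=
  (ContinuousLinearMap.proj (φ := fun _ : Fin m ↦ ℝ) a).comp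
    ((ContinuousLinearMap.proj (φ := fun _ : Fin n ↦ Fin m → ℝ) i).comp
    ((ContinuousLinearMap.snd ℝ (EuclideanSpace ℝ (Fin n)) (Fin n → Fin m → ℝ)).comp
      (ContinuousLinearMap.snd ℝ (EuclideanSpace ℝ (Fin m))
        (EuclideanSpace ℝ (Fin n) × (Fin n → Fin m → ℝ)))))

lemma coordDiff_momentum (he : e ∈ IsManifold.maximalAtlas (𝓡 m) ∞ T)
    (he' : e' ∈ IsManifold.maximalAtlas (𝓡 n) ∞ M) {u : DualJet m n T M}
    (hu : u ∈ coordDomain e e') (v : TangentSpace (DualJetI m n) u) (i : Fin n) (a : Fin m) :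
    (coordDiff e e' u v).2.2 i a = mvfderiv (DualJetI m n) (polymomentum e e' i a) u v :=
  (mvfderiv_clm_apply (I := DualJetI m n) (momentumProj i a)
    ((contMDiffAt_coords he he' hu).mdifferentiableAt (by simp)) v).symm

-- The jets `∂/∂x^i ⊗ dt^a` span the jet fibre: any linear map is their combination with its matrix
-- entries in the coordinate bases as coefficients.
omit [IsManifold (𝓡 m) ∞ T] [IsManifold (𝓡 n) ∞ M] in
lemma eq_zero_of_polymomentum_eq_zero (he : e ∈ IsManifold.maximalAtlas (𝓡 m) ∞ T)
    (he' : e' ∈ IsManifold.maximalAtlas (𝓡 n) ∞ M) {u : DualJet m n T M}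
    (hu : u ∈ coordDomain e e') (h : ∀ i a, polymomentum e e' i a u = 0) : u.snd = 0 := by
  let φ : JetFibre m n T M u.proj →L[ℝ] ℝ := u.snd
  suffices φ = 0 from this
  refine ContinuousLinearMap.ext fun A ↦ ?_
  let A' : TangentSpace (𝓡 m) u.proj.1 →L[ℝ] TangentSpace (𝓡 n) u.proj.2 := A
  have hA : A = ∑ i, ∑ a, coordForm e' i u.proj.2 (A' (coordField e a u.proj.1)) •
      elemJet e e' i a u.proj := by
    change A' = ∑ i, ∑ a, coordForm e' i u.proj.2 (A' (coordField e a u.proj.1)) •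
      (coordForm e a u.proj.1).smulRight (coordField e' i u.proj.2)
    refine ContinuousLinearMap.ext fun v ↦ ?_
    have h1 : A' v = ∑ a, coordForm e a u.proj.1 v • A' (coordField e a u.proj.1) := by
      conv_lhs => rw [← sum_coordForm_smul_coordField he hu.1 v]
      simp
    have h2 (a : Fin m) : A' (coordField e a u.proj.1) =
        ∑ i, coordForm e' i u.proj.2 (A' (coordField e a u.proj.1)) • coordField e' i u.proj.2 :=
      (sum_coordForm_smul_coordField he' hu.2 _).symm
    simp only [_root_.sum_apply, _root_.smul_apply, ContinuousLinearMap.smulRight_apply]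
    rw [h1, Finset.sum_comm]
    refine Finset.sum_congr rfl fun a _ ↦ ?_
    conv_lhs => rw [h2 a]
    rw [Finset.smul_sum]
    exact Finset.sum_congr rfl fun i _ ↦ smul_comm _ _ _
  rw [hA, map_sum]
  refine Finset.sum_eq_zero fun i _ ↦ ?_
  rw [map_sum]
  refine Finset.sum_eq_zero fun a _ ↦ ?_
  rw [map_smul]
  exact (congrArg _ (h i a)).trans (smul_zero _)

end DualJetDifferentials

/-! ### The induced coordinates have invertible differential -/

section DualJetInvertibility

variable {m n : ℕ}
  {T : Type*} [TopologicalSpace T] [ChartedSpace (EuclideanSpace ℝ (Fin m)) T]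
  {M : Type*} [TopologicalSpace M] [ChartedSpace (EuclideanSpace ℝ (Fin n)) M]
  [IsManifold (𝓡 m) ∞ T] [IsManifold (𝓡 n) ∞ M]
  {e : OpenPartialHomeomorph T (EuclideanSpace ℝ (Fin m))}
  {e' : OpenPartialHomeomorph M (EuclideanSpace ℝ (Fin n))}

/-- A local trivialization has a smooth inverse. Differentiating `τ⁻¹ ∘ τ = id` exhibits `v` as the
image of the zero vector. -/
lemma eq_zero_of_mfderiv_proj_eq_zero {EB : Type*} [NormedAddCommGroup EB] [NormedSpace ℝ EB]
    {HB : Type*} [TopologicalSpace HB] {IB : ModelWithCorners ℝ EB HB}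
    {B : Type*} [TopologicalSpace B] [ChartedSpace HB B] [IsManifold IB ∞ B]
    {F : Type*} [NormedAddCommGroup F] [NormedSpace ℝ F] {V : B → Type*}
    [TopologicalSpace (TotalSpace F V)] [∀ x, AddCommGroup (V x)] [∀ x, Module ℝ (V x)]
    [∀ x, TopologicalSpace (V x)] [FiberBundle F V] [VectorBundle ℝ F V]
    [ContMDiffVectorBundle ∞ F V IB] {u : TotalSpace F V}
    {v : TangentSpace (IB.prod 𝓘(ℝ, F)) u}
    (h : mfderiv (IB.prod 𝓘(ℝ, F)) IB (fun w : TotalSpace F V ↦ w.proj) u v = 0)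
    (h' : mvfderiv (IB.prod 𝓘(ℝ, F))
      (fun w : TotalSpace F V ↦ (trivializationAt F V u.proj w).2) u v = 0) : v = 0 := by
  let τ := trivializationAt F V u.proj
  have hb : u.proj ∈ τ.baseSet := FiberBundle.mem_baseSet_trivializationAt' _
  have hmem : u ∈ τ.source := (Trivialization.mem_source _).2 hb
  let g : TotalSpace F V → B × F := fun w ↦ (w.proj, (τ w).2)
  have hp : MDifferentiableAt (IB.prod 𝓘(ℝ, F)) IB (fun w : TotalSpace F V ↦ w.proj) u :=
    ((contMDiff_proj V (IB := IB) (n := ∞)).mdifferentiable (by simp)) u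
  have hτ : MDifferentiableAt (IB.prod 𝓘(ℝ, F)) 𝓘(ℝ, F) (fun w : TotalSpace F V ↦ (τ w).2) u :=
    ((contMDiffAt_totalSpace.1 (contMDiffAt_id (I := IB.prod 𝓘(ℝ, F)) (n := ∞)
      (x := u))).2).mdifferentiableAt (by simp)
  have hg : MDifferentiableAt (IB.prod 𝓘(ℝ, F)) (IB.prod 𝓘(ℝ, F)) g u := hp.prodMk hτ
  have hgv : mfderiv (IB.prod 𝓘(ℝ, F)) (IB.prod 𝓘(ℝ, F)) g u v = 0 := by
    have h2 : mfderiv (IB.prod 𝓘(ℝ, F)) (IB.prod 𝓘(ℝ, F)) g u v =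
      (mfderiv (IB.prod 𝓘(ℝ, F)) IB (fun w : TotalSpace F V ↦ w.proj) u v,
        mvfderiv (IB.prod 𝓘(ℝ, F)) (fun w : TotalSpace F V ↦ (τ w).2) u v) :=
      congrArg (fun L : TangentSpace (IB.prod 𝓘(ℝ, F)) u →L[ℝ] _ ↦ L v) (mfderiv_prodMk hp hτ)
    rw [h2, h, h']
    rfl
  have hs : MDifferentiableAt (IB.prod 𝓘(ℝ, F)) (IB.prod 𝓘(ℝ, F))
      τ.toOpenPartialHomeomorph.symm (g u) := by
    have h1 := (τ.contMDiffOn_symm (n := ∞) (IB := IB)).contMDiffAt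
      (τ.open_target.mem_nhds (x := g u) (by rw [Trivialization.mem_target]; exact hb))
    exact h1.mdifferentiableAt (by simp)
  have hid : (fun w ↦ τ.toOpenPartialHomeomorph.symm (g w)) =ᶠ[𝓝 u] id := by
    filter_upwards [τ.open_source.mem_nhds hmem] with w hw
    have : g w = τ w := Prod.ext (τ.coe_fst hw).symm rfl
    rw [this]
    exact τ.symm_apply_apply hw
  have h3 := mfderiv_comp_apply u hs hg v
  rw [hgv, map_zero] at h3
  have h4 := hid.mfderiv_eq (I := IB.prod 𝓘(ℝ, F)) (I' := IB.prod 𝓘(ℝ, F))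
  rw [mfderiv_id] at h4
  exact (congrArg (fun L : TangentSpace (IB.prod 𝓘(ℝ, F)) u →L[ℝ] _ ↦ L v) h4).symm.trans h3

lemma finrank_continuousLinearMap (E F : Type*) [NormedAddCommGroup E] [NormedSpace ℝ E]
    [FiniteDimensional ℝ E] [NormedAddCommGroup F] [NormedSpace ℝ F] [FiniteDimensional ℝ F] :
    Module.finrank ℝ (E →L[ℝ] F) = Module.finrank ℝ E * Module.finrank ℝ F := by
  rw [← LinearMap.toContinuousLinearMap.finrank_eq, Module.finrank_linearMap]

lemma ContinuousLinearMap.isInvertible_of_ker_trivial {E F : Type*} [NormedAddCommGroup E]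
    [NormedSpace ℝ E] [FiniteDimensional ℝ E] [NormedAddCommGroup F] [NormedSpace ℝ F]
    [FiniteDimensional ℝ F] (f : E →L[ℝ] F) (h : ∀ v, f v = 0 → v = 0)
    (hd : Module.finrank ℝ E = Module.finrank ℝ F) : f.IsInvertible :=
  ⟨(LinearEquiv.ofInjectiveOfFinrankEq f.toLinearMap
    ((injective_iff_map_eq_zero f.toLinearMap).2 h) hd).toContinuousLinearEquiv, rfl⟩

lemma mvfderiv_clm_apply_apply {E : Type*} [NormedAddCommGroup E] [NormedSpace ℝ E]
    {H : Type*} [TopologicalSpace H] {I : ModelWithCorners ℝ E H}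
    {X : Type*} [TopologicalSpace X] [ChartedSpace H X]
    {F F' : Type*} [NormedAddCommGroup F] [NormedSpace ℝ F] [NormedAddCommGroup F'] [NormedSpace ℝ F']
    {A : X → F →L[ℝ] F'} {f : X → F} {x : X} (hA : MDifferentiableAt I 𝓘(ℝ, F →L[ℝ] F') A x)
    (hf : MDifferentiableAt I 𝓘(ℝ, F) f x) (v : TangentSpace I x) :
    mvfderiv I (fun y ↦ A y (f y)) x v = A x (mvfderiv I f x v) + mvfderiv I A x v (f x) := by
  have h1 : MDifferentiableAt I 𝓘(ℝ, (F →L[ℝ] F') × F) (fun y ↦ (A y, f y)) x := hA.prodMk_space hf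
  have h2 : mvfderiv I (fun y ↦ (A y, f y)) x v = (mvfderiv I A x v, mvfderiv I f x v) :=
    Prod.ext (mvfderiv_clm_apply (ContinuousLinearMap.fst ℝ (F →L[ℝ] F') F) h1 v).symm
      (mvfderiv_clm_apply (ContinuousLinearMap.snd ℝ (F →L[ℝ] F') F) h1 v).symm
  have h := ((isBoundedBilinearMap_apply (𝕜 := ℝ) (E := F) (F := F')).hasFDerivAt
    (A x, f x)).hasMFDerivAt.comp x h1.hasMFDerivAt
  refine (congrArg (fun L : TangentSpace I x →L[ℝ] F' ↦ L v) h.mfderiv).trans ?_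
  exact congrArg (isBoundedBilinearMap_apply.deriv (A x, f x)) h2

lemma trivializationAt_zero_snd {B F : Type*} [TopologicalSpace B] [NormedAddCommGroup F]
    [NormedSpace ℝ F] {V : B → Type*}
    [TopologicalSpace (TotalSpace F V)] [∀ x, AddCommGroup (V x)] [∀ x, Module ℝ (V x)]
    [∀ x, TopologicalSpace (V x)] [FiberBundle F V] [VectorBundle ℝ F V] (p : B) :
    (trivializationAt F V p ⟨p, 0⟩).2 = 0 :=
  ((trivializationAt F V p).linear ℝ (FiberBundle.mem_baseSet_trivializationAt' p)).map_zero

/-- The base components show that `v` is vertical, so only the derivative `y` of the fibre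
coordinate along `v` is left. Differentiating the pairing of fibre coordinates with elementary jets
shows that `y` annihilates all of these jets, which forces `y = 0`. -/
lemma eq_zero_of_coordDiff_eq_zero (he : e ∈ IsManifold.maximalAtlas (𝓡 m) ∞ T)
    (he' : e' ∈ IsManifold.maximalAtlas (𝓡 n) ∞ M) {u : DualJet m n T M}
    (hu : u ∈ coordDomain e e') (v : TangentSpace (DualJetI m n) u)
    (hv : coordDiff e e' u v = 0) : v = 0 := by
  have hT : baseT u v = 0 := by
    apply (isInvertible_chartForm he hu.1).injective
    rw [← coordDiff_fst he he' hu, hv, map_zero]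
    rfl
  have hM : baseM u v = 0 := by
    apply (isInvertible_chartForm he' hu.2).injective
    rw [← coordDiff_snd he he' hu, hv, map_zero]
    rfl
  have hproj : mfderiv (DualJetI m n) ((𝓡 m).prod (𝓡 n)) (fun v : DualJet m n T M ↦ v.proj) u v = 0 := by
    rw [mfderiv_dualJet_proj, hT, hM]; rfl
  refine eq_zero_of_mfderiv_proj_eq_zero hproj ?_
  change mvfderiv (DualJetI m n) (fibreCoord u.proj) u v = 0
  set y := mvfderiv (DualJetI m n) (fibreCoord u.proj) u v with hy
  have key (i : Fin n) (a : Fin m) : y (elemJetCoord e e' u.proj i a u.proj) = 0 := by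
    have h1 : mvfderiv (DualJetI m n) (polymomentum e e' i a) u v = 0 := by
      rw [← coordDiff_momentum he he' hu, hv]; rfl
    have hj := (contMDiffAt_elemJetCoord he he' i a hu.1 hu.2).mdifferentiableAt (by simp)
    have hp := contMDiff_dualJet_proj (T := T) (M := M) |>.mdifferentiable (by simp) u
    have hjp : MDifferentiableAt (DualJetI m n) 𝓘(ℝ, JetModel m n)
      (fun v : DualJet m n T M ↦ elemJetCoord e e' u.proj i a v.proj) u := hj.comp u hp
    rw [(polymomentum_eventuallyEq i a u).mvfderiv_eq, mvfderiv_clm_apply_apply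
      ((contMDiffAt_fibreCoord u).mdifferentiableAt (by simp)) hjp] at h1
    -- The elementary jet depends on the base point alone, so it does not vary along a vertical
    -- vector.
    have h2 : mvfderiv (DualJetI m n)
        (fun v : DualJet m n T M ↦ elemJetCoord e e' u.proj i a v.proj) u v = 0 := by
      refine (mfderiv_comp_apply u hj hp v).trans ?_
      exact (congrArg (mfderiv ((𝓡 m).prod (𝓡 n)) 𝓘(ℝ, JetModel m n)
        (elemJetCoord e e' u.proj i a) u.proj) hproj).trans (ContinuousLinearMap.map_zero _)
    rw [h2, map_zero, zero_add] at h1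
    exact h1
  let τ := trivializationAt (DualJetModel m n) (DualJetFibre m n T M) u.proj
  have hb : u.proj ∈ τ.baseSet := FiberBundle.mem_baseSet_trivializationAt' _
  -- The point of the same fibre with fibre coordinate `y`: all its polymomenta vanish, hence it is
  -- the zero form.
  let w : DualJet m n T M := ⟨u.proj, τ.symm u.proj y⟩
  have hw : fibreCoord u.proj w = y := congrArg Prod.snd (τ.apply_mk_symm hb y)
  have hw0 : w.snd = 0 := by
    refine eq_zero_of_polymomentum_eq_zero he he' (u := w) hu fun i a ↦ ?_
    refine (polymomentum_eq_fibreCoord (p := u.proj) (u := w) i a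
      (FiberBundle.mem_baseSet_trivializationAt' _)).trans ?_
    rw [hw]
    exact key i a
  have hlin := trivializationAt_zero_snd (F := DualJetModel m n) (V := DualJetFibre m n T M) u.proj
  rw [← hw, ← hlin]
  change (τ ⟨u.proj, w.snd⟩).2 = _
  rw [hw0]

/-- The shape of the source is that of the tangent spaces of `E*`, which are modelled on the product
of the two base models and the fibre model. -/
lemma ContinuousLinearMap.isInvertible_of_ker_trivial_prod {E F K G : Type*}
    [NormedAddCommGroup E] [NormedSpace ℝ E] [FiniteDimensional ℝ E]
    [NormedAddCommGroup F] [NormedSpace ℝ F] [FiniteDimensional ℝ F]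
    [NormedAddCommGroup K] [NormedSpace ℝ K] [FiniteDimensional ℝ K]
    [NormedAddCommGroup G] [NormedSpace ℝ G] [FiniteDimensional ℝ G]
    (f : ((E × F) × K) →L[ℝ] G) (h : ∀ v, f v = 0 → v = 0)
    (hd : Module.finrank ℝ E + Module.finrank ℝ F + Module.finrank ℝ K = Module.finrank ℝ G) :
    f.IsInvertible :=
  f.isInvertible_of_ker_trivial h (by rw [← hd, Module.finrank_prod, Module.finrank_prod])

variable (m n) in
lemma finrank_dualJetModel : Module.finrank ℝ (DualJetModel m n) = m * n := by
  rw [finrank_continuousLinearMap (JetModel m n) ℝ, finrank_continuousLinearMap]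
  simp

variable (m n) in
lemma finrank_coordSpace : Module.finrank ℝ (CoordSpace m n) = m + (n + m * n) := by
  rw [Module.finrank_prod, Module.finrank_prod, Module.finrank_pi_fintype]
  simp [mul_comm]

/-- Injectivity suffices, because both sides have dimension `m + n + mn`. -/
lemma isInvertible_coordDiff (he : e ∈ IsManifold.maximalAtlas (𝓡 m) ∞ T)
    (he' : e' ∈ IsManifold.maximalAtlas (𝓡 n) ∞ M) {u : DualJet m n T M}
    (hu : u ∈ coordDomain e e') : (coordDiff e e' u).IsInvertible := by
  have hd : Module.finrank ℝ (EuclideanSpace ℝ (Fin m)) + Module.finrank ℝ (EuclideanSpace ℝ (Fin n)) +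
      Module.finrank ℝ (DualJetModel m n) = Module.finrank ℝ (CoordSpace m n) := by
    rw [finrank_dualJetModel, finrank_coordSpace]
    simp [add_assoc]
  exact ContinuousLinearMap.isInvertible_of_ker_trivial_prod (E := EuclideanSpace ℝ (Fin m))
    (F := EuclideanSpace ℝ (Fin n)) (K := DualJetModel m n) (G := CoordSpace m n)
    (coordDiff e e' u) (fun v hv ↦ eq_zero_of_coordDiff_eq_zero he he' hu v hv) hd

end DualJetInvertibility

/-! ### Derivatives of finite sums and products -/

section MvfderivAlgebra

variable {E : Type*} [NormedAddCommGroup E] [NormedSpace ℝ E]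
  {H : Type*} [TopologicalSpace H] {I : ModelWithCorners ℝ E H}
  {X : Type*} [TopologicalSpace X] [ChartedSpace H X]

lemma mdifferentiableAt_fun_sum {ι : Type*} (s : Finset ι) {f : ι → X → ℝ} {x : X}
    (hf : ∀ i ∈ s, MDifferentiableAt I 𝓘(ℝ, ℝ) (f i) x) :
    MDifferentiableAt I 𝓘(ℝ, ℝ) (fun y ↦ ∑ i ∈ s, f i y) x := by
  classical
  induction s using Finset.induction_on with
  | empty => simpa using mdifferentiableAt_const (I := I) (I' := 𝓘(ℝ, ℝ)) (c := (0 : ℝ)) (x := x)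
  | insert i s hi ih =>
    simp only [Finset.sum_insert hi]
    exact (hf i (Finset.mem_insert_self i s)).add
      (ih fun j hj ↦ hf j (Finset.mem_insert_of_mem hj))

lemma mvfderiv_sum_apply {ι : Type*} (s : Finset ι) {f : ι → X → ℝ} {x : X}
    (hf : ∀ i ∈ s, MDifferentiableAt I 𝓘(ℝ, ℝ) (f i) x) (v : TangentSpace I x) :
    mvfderiv I (fun y ↦ ∑ i ∈ s, f i y) x v = ∑ i ∈ s, mvfderiv I (f i) x v := by
  classical
  induction s using Finset.induction_on with
  | empty => simp [mvfderiv_const]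
  | insert i s hi ih =>
    have hs : ∀ j ∈ s, MDifferentiableAt I 𝓘(ℝ, ℝ) (f j) x :=
      fun j hj ↦ hf j (Finset.mem_insert_of_mem hj)
    simp only [Finset.sum_insert hi]
    rw [← ih hs, mvfderiv_fun_add (hf i (Finset.mem_insert_self i s))
      (mdifferentiableAt_fun_sum s hs)]
    rfl

lemma mvfderiv_mul_apply {f g : X → ℝ} {x : X} (hf : MDifferentiableAt I 𝓘(ℝ, ℝ) f x)
    (hg : MDifferentiableAt I 𝓘(ℝ, ℝ) g x) (v : TangentSpace I x) :
    mvfderiv I (fun y ↦ f y * g y) x v = mvfderiv I f x v * g x + f x * mvfderiv I g x v := by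
  have h := mvfderiv_mul hf hg
  have h2 : mvfderiv I (fun y ↦ f y * g y) x v = _ :=
    congrArg (fun L : TangentSpace I x →L[ℝ] ℝ ↦ L v) h
  rw [h2]
  simp [add_comm, mul_comm]

end MvfderivAlgebra

/-- Insert `dX = X B - B₁ X` and `dJ = J A₁ - A J` into the derivative of `X J p`, with `q` for the
derivative of `p`, and add the connection terms of the first chart: all terms in `A` and `B` cancel
and those in `A₁` and `B₁` survive. It serves twice, for the covariant differential of the
polymomenta and, with constant `p` and `q = 0`, for the Berwald connection. -/
lemma bilinear_gauge_identity {m n : ℕ} (X : Fin n → Fin n → ℝ) (J A A₁ : Fin m → Fin m → ℝ)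
    (B B₁ : Fin n → Fin n → ℝ) (p q : Fin n → Fin m → ℝ) (i : Fin n) (a : Fin m) :
    ∑ k, ∑ c, ((∑ l, X k l * B l i - ∑ l, B₁ k l * X l i) * (J a c * p k c) +
        X k i * ((∑ b, J a b * A₁ b c - ∑ b, A a b * J b c) * p k c + J a c * q k c)) +
      ∑ b, A a b * ∑ k, ∑ c, X k i * (J b c * p k c) -
      ∑ l, B l i * ∑ k, ∑ c, X k l * (J a c * p k c) =
    ∑ k, ∑ c, X k i * (J a c * (q k c + ∑ b, A₁ c b * p k b - ∑ l, B₁ l k * p l c)) := by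
  have h1 : ∑ b, A a b * ∑ k, ∑ c, X k i * (J b c * p k c) =
      ∑ k, ∑ c, X k i * ((∑ b, A a b * J b c) * p k c) := by
    simp only [Finset.mul_sum, Finset.sum_mul]
    rw [Finset.sum_comm]
    refine Finset.sum_congr rfl fun k _ ↦ ?_
    rw [Finset.sum_comm]
    exact Finset.sum_congr rfl fun c _ ↦ Finset.sum_congr rfl fun b _ ↦ by ring
  have h2 : ∑ l, B l i * ∑ k, ∑ c, X k l * (J a c * p k c) =
      ∑ k, ∑ c, (∑ l, X k l * B l i) * (J a c * p k c) := by
    simp only [Finset.mul_sum, Finset.sum_mul]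
    rw [Finset.sum_comm]
    refine Finset.sum_congr rfl fun k _ ↦ ?_
    rw [Finset.sum_comm]
    exact Finset.sum_congr rfl fun c _ ↦ Finset.sum_congr rfl fun b _ ↦ by ring
  have h3 : ∑ k, ∑ c, X k i * (J a c * ∑ b, A₁ c b * p k b) =
      ∑ k, ∑ c, X k i * ((∑ b, J a b * A₁ b c) * p k c) := by
    refine Finset.sum_congr rfl fun k _ ↦ ?_
    simp only [Finset.mul_sum, Finset.sum_mul]
    rw [Finset.sum_comm]
    exact Finset.sum_congr rfl fun c _ ↦ Finset.sum_congr rfl fun b _ ↦ by ring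
  have h4 : ∑ k, ∑ c, X k i * (J a c * ∑ l, B₁ l k * p l c) =
      ∑ k, ∑ c, (∑ l, B₁ k l * X l i) * (J a c * p k c) := by
    rw [Finset.sum_comm]
    conv_rhs => rw [Finset.sum_comm]
    refine Finset.sum_congr rfl fun c _ ↦ ?_
    simp only [Finset.mul_sum, Finset.sum_mul]
    rw [Finset.sum_comm]
    exact Finset.sum_congr rfl fun k _ ↦ Finset.sum_congr rfl fun l _ ↦ by ring
  simp only [mul_add, mul_sub, Finset.sum_add_distrib, Finset.sum_sub_distrib]
  rw [h1, h2, h3, h4]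
  simp only [sub_mul, mul_sub, Finset.sum_sub_distrib]
  ring

/-! ### Transformation of polymomenta and of their covariant differential -/

section PolymomentumTransition

variable {m n : ℕ}
  {T : Type*} [TopologicalSpace T] [ChartedSpace (EuclideanSpace ℝ (Fin m)) T]
  {M : Type*} [TopologicalSpace M] [ChartedSpace (EuclideanSpace ℝ (Fin n)) M]
  [IsManifold (𝓡 m) ∞ T] [IsManifold (𝓡 n) ∞ M]
  {e e₁ : OpenPartialHomeomorph T (EuclideanSpace ℝ (Fin m))}
  {e' e₁' : OpenPartialHomeomorph M (EuclideanSpace ℝ (Fin n))}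

-- The covector `dt^a` is expanded in the other chart by the Jacobian, the vector `∂/∂x^i` by the
-- Jacobian in the opposite direction; this is why the two `transition` factors have their charts in
-- opposite orders.
omit [IsManifold (𝓡 m) ∞ T] [IsManifold (𝓡 n) ∞ M] in
lemma polymomentum_transition (he₁ : e₁ ∈ IsManifold.maximalAtlas (𝓡 m) ∞ T)
    (he₁' : e₁' ∈ IsManifold.maximalAtlas (𝓡 n) ∞ M) {u : DualJet m n T M}
    (hu₁ : u ∈ coordDomain e₁ e₁') (i : Fin n) (a : Fin m) :
    polymomentum e e' i a u = ∑ k, ∑ c, transition e₁' e' k i u.proj.2 *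
      (transition e e₁ a c u.proj.1 * polymomentum e₁ e₁' k c u) := by
  let φ : JetFibre m n T M u.proj →L[ℝ] ℝ := u.snd
  have hA : elemJet e e' i a u.proj = ∑ k, ∑ c, (transition e₁' e' k i u.proj.2 *
      transition e e₁ a c u.proj.1) • elemJet e₁ e₁' k c u.proj := by
    change ((coordForm e a u.proj.1).smulRight (coordField e' i u.proj.2) :
      TangentSpace (𝓡 m) u.proj.1 →L[ℝ] TangentSpace (𝓡 n) u.proj.2) =
      ∑ k, ∑ c, (transition e₁' e' k i u.proj.2 * transition e e₁ a c u.proj.1) •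
      (coordForm e₁ c u.proj.1).smulRight (coordField e₁' k u.proj.2)
    refine ContinuousLinearMap.ext fun v ↦ ?_
    simp only [_root_.sum_apply, _root_.smul_apply, ContinuousLinearMap.smulRight_apply]
    rw [coordForm_eq_sum_transition he₁ hu₁.1, coordField_eq_sum_transition he₁' hu₁.2,
      Finset.smul_sum]
    refine Finset.sum_congr rfl fun k _ ↦ ?_
    rw [Finset.sum_smul]
    refine Finset.sum_congr rfl fun c _ ↦ ?_
    simp only [smul_smul]
    congr 1
    ring
  change φ (elemJet e e' i a u.proj) = ∑ k, ∑ c, transition e₁' e' k i u.proj.2 *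
      (transition e e₁ a c u.proj.1 * φ (elemJet e₁ e₁' k c u.proj))
  rw [hA, map_sum]
  refine Finset.sum_congr rfl fun k _ ↦ ?_
  rw [map_sum]
  refine Finset.sum_congr rfl fun c _ ↦ ?_
  rw [map_smul, smul_eq_mul, mul_assoc]

lemma mdifferentiableAt_comp_fst {f : T → ℝ} {u : DualJet m n T M}
    (hf : MDifferentiableAt (𝓡 m) 𝓘(ℝ, ℝ) f u.proj.1) :
    MDifferentiableAt (DualJetI m n) 𝓘(ℝ, ℝ) (fun w : DualJet m n T M ↦ f w.proj.1) u :=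
  hf.comp u (contMDiff_dualJet_fst.mdifferentiable (by simp) u)

lemma mdifferentiableAt_comp_snd {f : M → ℝ} {u : DualJet m n T M}
    (hf : MDifferentiableAt (𝓡 n) 𝓘(ℝ, ℝ) f u.proj.2) :
    MDifferentiableAt (DualJetI m n) 𝓘(ℝ, ℝ) (fun w : DualJet m n T M ↦ f w.proj.2) u :=
  hf.comp u (contMDiff_dualJet_snd.mdifferentiable (by simp) u)

lemma mvfderiv_comp_fst {f : T → ℝ} {u : DualJet m n T M}
    (hf : MDifferentiableAt (𝓡 m) 𝓘(ℝ, ℝ) f u.proj.1) (v : TangentSpace (DualJetI m n) u) :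
    mvfderiv (DualJetI m n) (fun w : DualJet m n T M ↦ f w.proj.1) u v =
      mvfderiv (𝓡 m) f u.proj.1 (baseT u v) :=
  mfderiv_comp_apply (I := DualJetI m n) (I' := 𝓡 m) u (g := f)
    (f := fun w : DualJet m n T M ↦ w.proj.1) hf
    (contMDiff_dualJet_fst.mdifferentiable (by simp) u) v

lemma mvfderiv_comp_snd {f : M → ℝ} {u : DualJet m n T M}
    (hf : MDifferentiableAt (𝓡 n) 𝓘(ℝ, ℝ) f u.proj.2) (v : TangentSpace (DualJetI m n) u) :
    mvfderiv (DualJetI m n) (fun w : DualJet m n T M ↦ f w.proj.2) u v =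
      mvfderiv (𝓡 n) f u.proj.2 (baseM u v) :=
  mfderiv_comp_apply (I := DualJetI m n) (I' := 𝓡 n) u (g := f)
    (f := fun w : DualJet m n T M ↦ w.proj.2) hf
    (contMDiff_dualJet_snd.mdifferentiable (by simp) u) v

lemma mdifferentiableAt_transition {d : ℕ} {X : Type*} [TopologicalSpace X]
    [ChartedSpace (EuclideanSpace ℝ (Fin d)) X] [IsManifold (𝓡 d) ∞ X]
    {e e₁ : OpenPartialHomeomorph X (EuclideanSpace ℝ (Fin d))}
    (he : e ∈ IsManifold.maximalAtlas (𝓡 d) ∞ X)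
    (he₁ : e₁ ∈ IsManifold.maximalAtlas (𝓡 d) ∞ X) {x : X} (hx : x ∈ e.source)
    (hx₁ : x ∈ e₁.source) (a b : Fin d) :
    MDifferentiableAt (𝓡 d) 𝓘(ℝ, ℝ) (transition e e₁ a b) x :=
  (contMDiffAt_transition he he₁ hx hx₁ a b).mdifferentiableAt (by simp)

lemma mvfderiv_polymomentum_transition (he : e ∈ IsManifold.maximalAtlas (𝓡 m) ∞ T)
    (he' : e' ∈ IsManifold.maximalAtlas (𝓡 n) ∞ M)
    (he₁ : e₁ ∈ IsManifold.maximalAtlas (𝓡 m) ∞ T)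
    (he₁' : e₁' ∈ IsManifold.maximalAtlas (𝓡 n) ∞ M) {u : DualJet m n T M}
    (hu : u ∈ coordDomain e e') (hu₁ : u ∈ coordDomain e₁ e₁') (i : Fin n) (a : Fin m)
    (v : TangentSpace (DualJetI m n) u) :
    mvfderiv (DualJetI m n) (polymomentum e e' i a) u v = ∑ k, ∑ c,
      (mvfderiv (𝓡 n) (transition e₁' e' k i) u.proj.2 (baseM u v) *
          (transition e e₁ a c u.proj.1 * polymomentum e₁ e₁' k c u) +
        transition e₁' e' k i u.proj.2 *
          (mvfderiv (𝓡 m) (transition e e₁ a c) u.proj.1 (baseT u v) * polymomentum e₁ e₁' k c u +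
        transition e e₁ a c u.proj.1 * mvfderiv (DualJetI m n) (polymomentum e₁ e₁' k c) u v)) := by
  have hev : polymomentum e e' i a =ᶠ[𝓝 u] fun w ↦ ∑ k, ∑ c, transition e₁' e' k i w.proj.2 *
      (transition e e₁ a c w.proj.1 * polymomentum e₁ e₁' k c w) := by
    filter_upwards [mem_coordDomain_eventually e₁ e₁' hu₁] with w hw
      using polymomentum_transition he₁ he₁' hw i a
  have hX (k : Fin n) := mdifferentiableAt_transition he₁' he' hu₁.2 hu.2 k i
  have hT (c : Fin m) := mdifferentiableAt_transition he he₁ hu.1 hu₁.1 a c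
  have hp (k : Fin n) (c : Fin m) :=
    (contMDiffAt_polymomentum he₁ he₁' k c hu₁).mdifferentiableAt (by simp)
  have hTp (k : Fin n) (c : Fin m) : MDifferentiableAt (DualJetI m n) 𝓘(ℝ, ℝ)
      (fun w : DualJet m n T M ↦ transition e e₁ a c w.proj.1 * polymomentum e₁ e₁' k c w) u :=
    (mdifferentiableAt_comp_fst (hT c)).mul (hp k c)
  have hXTp (k : Fin n) (c : Fin m) : MDifferentiableAt (DualJetI m n) 𝓘(ℝ, ℝ)
      (fun w : DualJet m n T M ↦ transition e₁' e' k i w.proj.2 *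
        (transition e e₁ a c w.proj.1 * polymomentum e₁ e₁' k c w)) u :=
    (mdifferentiableAt_comp_snd (hX k)).mul (hTp k c)
  rw [hev.mvfderiv_eq, mvfderiv_sum_apply _ fun k _ ↦
    mdifferentiableAt_fun_sum _ fun c _ ↦ hXTp k c]
  refine Finset.sum_congr rfl fun k _ ↦ ?_
  rw [mvfderiv_sum_apply _ fun c _ ↦ hXTp k c]
  refine Finset.sum_congr rfl fun c _ ↦ ?_
  rw [mvfderiv_mul_apply (mdifferentiableAt_comp_snd (hX k)) (hTp k c),
    mvfderiv_mul_apply (mdifferentiableAt_comp_fst (hT c)) (hp k c), mvfderiv_comp_snd (hX k),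
    mvfderiv_comp_fst (hT c)]

/-- The Jacobians are functions on the base, so their derivatives drop out along vertical vectors:
there `dp` is already tensorial, with no connection needed. -/
lemma mvfderiv_polymomentum_transition_of_vertical (he : e ∈ IsManifold.maximalAtlas (𝓡 m) ∞ T)
    (he' : e' ∈ IsManifold.maximalAtlas (𝓡 n) ∞ M)
    (he₁ : e₁ ∈ IsManifold.maximalAtlas (𝓡 m) ∞ T)
    (he₁' : e₁' ∈ IsManifold.maximalAtlas (𝓡 n) ∞ M) {u : DualJet m n T M}
    (hu : u ∈ coordDomain e e') (hu₁ : u ∈ coordDomain e₁ e₁') (i : Fin n) (a : Fin m)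
    {v : TangentSpace (DualJetI m n) u} (hv : v ∈ verticalSpace u) :
    mvfderiv (DualJetI m n) (polymomentum e e' i a) u v = ∑ k, ∑ c,
      transition e₁' e' k i u.proj.2 * (transition e e₁ a c u.proj.1 *
        mvfderiv (DualJetI m n) (polymomentum e₁ e₁' k c) u v) := by
  obtain ⟨hT, hM⟩ := (mem_verticalSpace_iff u v).1 hv
  rw [mvfderiv_polymomentum_transition he he' he₁ he₁' hu hu₁]
  refine Finset.sum_congr rfl fun k _ ↦ Finset.sum_congr rfl fun c _ ↦ ?_
  rw [hT, hM, ContinuousLinearMap.map_zero, ContinuousLinearMap.map_zero, zero_mul, zero_mul,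
    zero_add, zero_add]

/-- The covariant differential of the polymomentum `p_i^a`:
`δp_i^a = dp_i^a + χ^a_{bc} p_i^b dt^c - Γ^l_{ik} p_l^a dx^k`. -/
def covPolymomentum (χ : LinearConnection (𝓡 m) T) (Γ : LinearConnection (𝓡 n) M)
    (e : OpenPartialHomeomorph T (EuclideanSpace ℝ (Fin m)))
    (e' : OpenPartialHomeomorph M (EuclideanSpace ℝ (Fin n))) (i : Fin n) (a : Fin m)
    (u : DualJet m n T M) (v : TangentSpace (DualJetI m n) u) : ℝ :=
  mvfderiv (DualJetI m n) (polymomentum e e' i a) u v +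
    ∑ b, χ.connForm e a b u.proj.1 (baseT u v) * polymomentum e e' i b u -
    ∑ l, Γ.connForm e' l i u.proj.2 (baseM u v) * polymomentum e e' l a u

/-- The derivatives of the Jacobians, rewritten by the gauge laws on `T` and `M`, are exactly
absorbed by the two connection terms. -/
lemma covPolymomentum_transition (χ : LinearConnection (𝓡 m) T) (Γ : LinearConnection (𝓡 n) M)
    (he : e ∈ IsManifold.maximalAtlas (𝓡 m) ∞ T)
    (he' : e' ∈ IsManifold.maximalAtlas (𝓡 n) ∞ M)
    (he₁ : e₁ ∈ IsManifold.maximalAtlas (𝓡 m) ∞ T)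
    (he₁' : e₁' ∈ IsManifold.maximalAtlas (𝓡 n) ∞ M) {u : DualJet m n T M}
    (hu : u ∈ coordDomain e e') (hu₁ : u ∈ coordDomain e₁ e₁') (i : Fin n) (a : Fin m)
    (v : TangentSpace (DualJetI m n) u) :
    covPolymomentum χ Γ e e' i a u v = ∑ k, ∑ c, transition e₁' e' k i u.proj.2 *
      (transition e e₁ a c u.proj.1 * covPolymomentum χ Γ e₁ e₁' k c u v) := by
  simp only [covPolymomentum, mvfderiv_polymomentum_transition he he' he₁ he₁' hu hu₁]
  simp only [polymomentum_transition (e := e) (e' := e') he₁ he₁' hu₁,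
    χ.mvfderiv_transition he he₁ hu.1 hu₁.1, Γ.mvfderiv_transition he₁' he' hu₁.2 hu.2]
  set X := fun k i ↦ transition e₁' e' k i u.proj.2
  set J := fun a c ↦ transition e e₁ a c u.proj.1
  set p := fun k c ↦ polymomentum e₁ e₁' k c u
  set A := fun a b ↦ χ.connForm e a b u.proj.1 (baseT u v)
  set A₁ := fun a b ↦ χ.connForm e₁ a b u.proj.1 (baseT u v)
  set B := fun a b ↦ Γ.connForm e' a b u.proj.2 (baseM u v)
  set B₁ := fun a b ↦ Γ.connForm e₁' a b u.proj.2 (baseM u v)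
  set q := fun k c ↦ mvfderiv (DualJetI m n) (polymomentum e₁ e₁' k c) u v
  exact bilinear_gauge_identity X J A A₁ B B₁ p q i a

end PolymomentumTransition

/-! ### Horizontal spaces and adapted frames from given coefficients -/

section AdaptedFrames

variable {m n : ℕ}
  {T : Type*} [TopologicalSpace T] [ChartedSpace (EuclideanSpace ℝ (Fin m)) T]
  {M : Type*} [TopologicalSpace M] [ChartedSpace (EuclideanSpace ℝ (Fin n)) M]
  [IsManifold (𝓡 m) ∞ T] [IsManifold (𝓡 n) ∞ M]
  {e e₁ : OpenPartialHomeomorph T (EuclideanSpace ℝ (Fin m))}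
  {e' e₁' : OpenPartialHomeomorph M (EuclideanSpace ℝ (Fin n))}

lemma isOpen_coordDomain (e : OpenPartialHomeomorph T (EuclideanSpace ℝ (Fin m)))
    (e' : OpenPartialHomeomorph M (EuclideanSpace ℝ (Fin n))) :
    IsOpen (coordDomain e e' : Set (DualJet m n T M)) :=
  isOpen_iff_mem_nhds.2 fun _ hu ↦ mem_coordDomain_eventually e e' hu

lemma coordDiff_ofComponents (he : e ∈ IsManifold.maximalAtlas (𝓡 m) ∞ T)
    (he' : e' ∈ IsManifold.maximalAtlas (𝓡 n) ∞ M) {u : DualJet m n T M}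
    (hu : u ∈ coordDomain e e') (w : CoordSpace m n) :
    coordDiff e e' u (ofComponents e e' u w) = w :=
  (isInvertible_coordDiff he he' hu).self_apply_inverse w

lemma coordDiff_natP (he : e ∈ IsManifold.maximalAtlas (𝓡 m) ∞ T)
    (he' : e' ∈ IsManifold.maximalAtlas (𝓡 n) ∞ M) {u : DualJet m n T M}
    (hu : u ∈ coordDomain e e') (i : Fin n) (a : Fin m) :
    coordDiff e e' u (natP e e' i a u) = (0, 0, Pi.single i (Pi.single a 1)) :=
  coordDiff_ofComponents he he' hu _

lemma sum_sum_smul_single (f : Fin m → Fin n → ℝ) :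
    ∑ b, ∑ j, f b j • ((0, 0, Pi.single j (Pi.single b 1)) : CoordSpace m n) =
      (0, 0, fun j b ↦ f b j) := by
  refine Prod.ext ?_ (Prod.ext ?_ ?_)
  · simp [Prod.fst_sum]
  · simp [Prod.fst_sum, Prod.snd_sum]
  · ext i a
    simp [Prod.snd_sum, Finset.sum_apply, Pi.single_apply]

lemma coordDiff_deltaT (he : e ∈ IsManifold.maximalAtlas (𝓡 m) ∞ T)
    (he' : e' ∈ IsManifold.maximalAtlas (𝓡 n) ∞ M) {u : DualJet m n T M}
    (hu : u ∈ coordDomain e e') (K : DualJet m n T M → NonlinearCoeffs m n) (a : Fin m) :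
    coordDiff e e' u (deltaT e e' K a u) =
      (EuclideanSpace.single a 1, 0, fun j b ↦ -(K u).N₁ b j a) := by
  rw [deltaT, map_sub, map_sum]
  simp only [map_sum, map_smul, coordDiff_natP he he' hu]
  rw [sum_sum_smul_single, natT, coordDiff_ofComponents he he' hu]
  refine Prod.ext ?_ (Prod.ext ?_ ?_)
  · simp
  · simp
  · ext; simp

lemma coordDiff_deltaX (he : e ∈ IsManifold.maximalAtlas (𝓡 m) ∞ T)
    (he' : e' ∈ IsManifold.maximalAtlas (𝓡 n) ∞ M) {u : DualJet m n T M}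
    (hu : u ∈ coordDomain e e') (K : DualJet m n T M → NonlinearCoeffs m n) (i : Fin n) :
    coordDiff e e' u (deltaX e e' K i u) =
      (0, EuclideanSpace.single i 1, fun j b ↦ -(K u).N₂ b j i) := by
  rw [deltaX, map_sub, map_sum]
  simp only [map_sum, map_smul, coordDiff_natP he he' hu]
  rw [sum_sum_smul_single, natX, coordDiff_ofComponents he he' hu]
  refine Prod.ext ?_ (Prod.ext ?_ ?_)
  · simp
  · simp
  · ext; simp

/-- The components `δp_i^a = dp_i^a + N₁^{(a)}_{(i)b} dt^b + N₂^{(a)}_{(i)k} dx^k`. -/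
def adaptedMomentum (K : NonlinearCoeffs m n) : CoordSpace m n →ₗ[ℝ] (Fin n → Fin m → ℝ) where
  toFun w i a := w.2.2 i a + ∑ b, K.N₁ a i b * w.1 b + ∑ k, K.N₂ a i k * w.2.1 k
  map_add' w w' := by
    ext i a
    simp [mul_add, Finset.sum_add_distrib]
    ring
  map_smul' r w := by
    ext i a
    simp [Finset.mul_sum, mul_add, mul_left_comm]

/-- Vanishing of `δp` determines the `p`-components from the base components, so these alone are the
coefficients in the horizontal frame. -/
lemma eq_sum_of_adaptedMomentum_eq_zero (K : NonlinearCoeffs m n) {w : CoordSpace m n}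
    (hw : adaptedMomentum K w = 0) :
    w = ∑ a, w.1 a • ((EuclideanSpace.single a 1, 0, fun j b ↦ -K.N₁ b j a) : CoordSpace m n) +
      ∑ i, w.2.1 i • ((0, EuclideanSpace.single i 1, fun j b ↦ -K.N₂ b j i) : CoordSpace m n) := by
  refine Prod.ext ?_ (Prod.ext ?_ ?_)
  · ext a
    simp [Prod.fst_sum, Finset.sum_apply, Pi.single_apply]
  · ext a
    simp [Prod.fst_sum, Prod.snd_sum, Finset.sum_apply, Pi.single_apply]
  · ext i a
    have h := congrFun (congrFun hw i) a
    simp only [adaptedMomentum, LinearMap.coe_mk, AddHom.coe_mk, Pi.zero_apply] at h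
    simp only [Prod.snd_add, Prod.snd_sum, Prod.smul_snd, Pi.add_apply, Finset.sum_apply,
      Pi.smul_apply, smul_eq_mul, mul_neg, Finset.sum_neg_distrib]
    have h1 : ∑ b, w.1 b * K.N₁ a i b = ∑ b, K.N₁ a i b * w.1 b :=
      Finset.sum_congr rfl fun _ _ ↦ mul_comm _ _
    have h2 : ∑ b, w.2.1 b * K.N₂ a i b = ∑ b, K.N₂ a i b * w.2.1 b :=
      Finset.sum_congr rfl fun _ _ ↦ mul_comm _ _
    rw [h1, h2]
    linarith

/-- The horizontal space determined by the coefficients `K` in the given charts. -/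
def horizontalOf (e : OpenPartialHomeomorph T (EuclideanSpace ℝ (Fin m)))
    (e' : OpenPartialHomeomorph M (EuclideanSpace ℝ (Fin n)))
    (K : DualJet m n T M → NonlinearCoeffs m n) (u : DualJet m n T M) :
    Submodule ℝ (TangentSpace (DualJetI m n) u) :=
  LinearMap.ker (adaptedMomentum (K u) ∘ₗ (coordDiff e e' u).toLinearMap)

lemma mem_horizontalOf (K : DualJet m n T M → NonlinearCoeffs m n) {u : DualJet m n T M}
    {v : TangentSpace (DualJetI m n) u} :
    v ∈ horizontalOf e e' K u ↔ adaptedMomentum (K u) (coordDiff e e' u v) = 0 := Iff.rfl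

lemma deltaT_mem_horizontalOf (he : e ∈ IsManifold.maximalAtlas (𝓡 m) ∞ T)
    (he' : e' ∈ IsManifold.maximalAtlas (𝓡 n) ∞ M) {u : DualJet m n T M}
    (hu : u ∈ coordDomain e e') (K : DualJet m n T M → NonlinearCoeffs m n) (a : Fin m) :
    deltaT e e' K a u ∈ horizontalOf e e' K u := by
  rw [mem_horizontalOf, coordDiff_deltaT he he' hu]
  ext i b
  simp [adaptedMomentum]

lemma deltaX_mem_horizontalOf (he : e ∈ IsManifold.maximalAtlas (𝓡 m) ∞ T)
    (he' : e' ∈ IsManifold.maximalAtlas (𝓡 n) ∞ M) {u : DualJet m n T M}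
    (hu : u ∈ coordDomain e e') (K : DualJet m n T M → NonlinearCoeffs m n) (i : Fin n) :
    deltaX e e' K i u ∈ horizontalOf e e' K u := by
  rw [mem_horizontalOf, coordDiff_deltaX he he' hu]
  ext j b
  simp [adaptedMomentum]

lemma horizontalOf_eq_span (he : e ∈ IsManifold.maximalAtlas (𝓡 m) ∞ T)
    (he' : e' ∈ IsManifold.maximalAtlas (𝓡 n) ∞ M) {u : DualJet m n T M}
    (hu : u ∈ coordDomain e e') (K : DualJet m n T M → NonlinearCoeffs m n) :
    horizontalOf e e' K u = Submodule.span ℝ (Set.range (fun a ↦ deltaT e e' K a u) ∪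
      Set.range (fun i ↦ deltaX e e' K i u)) := by
  refine le_antisymm (fun v hv ↦ ?_) (Submodule.span_le.2 ?_)
  · have h := eq_sum_of_adaptedMomentum_eq_zero (K u) ((mem_horizontalOf K).1 hv)
    set w := coordDiff e e' u v with hw
    have hv' : v = ∑ a, w.1 a • deltaT e e' K a u + ∑ i, w.2.1 i • deltaX e e' K i u := by
      apply (isInvertible_coordDiff he he' hu).injective
      rw [← hw, map_add, map_sum, map_sum]
      simp only [map_smul, coordDiff_deltaT he he' hu, coordDiff_deltaX he he' hu]
      exact h
    rw [hv']
    refine Submodule.add_mem _ (Submodule.sum_mem _ fun a _ ↦ Submodule.smul_mem _ _ ?_)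
      (Submodule.sum_mem _ fun i _ ↦ Submodule.smul_mem _ _ ?_)
    · exact Submodule.subset_span (Or.inl ⟨a, rfl⟩)
    · exact Submodule.subset_span (Or.inr ⟨i, rfl⟩)
  · rintro _ (⟨a, rfl⟩ | ⟨i, rfl⟩)
    · exact deltaT_mem_horizontalOf he he' hu K a
    · exact deltaX_mem_horizontalOf he he' hu K i

lemma mem_verticalSpace_iff_coordDiff (he : e ∈ IsManifold.maximalAtlas (𝓡 m) ∞ T)
    (he' : e' ∈ IsManifold.maximalAtlas (𝓡 n) ∞ M) {u : DualJet m n T M}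
    (hu : u ∈ coordDomain e e') (v : TangentSpace (DualJetI m n) u) :
    v ∈ verticalSpace u ↔ (coordDiff e e' u v).1 = 0 ∧ (coordDiff e e' u v).2.1 = 0 := by
  rw [mem_verticalSpace_iff, coordDiff_fst he he' hu, coordDiff_snd he he' hu]
  refine and_congr ⟨fun h ↦ ?_, fun h ↦ ?_⟩ ⟨fun h ↦ ?_, fun h ↦ ?_⟩
  · rw [h, map_zero]
  · exact (isInvertible_chartForm he hu.1).injective (h.trans (map_zero _).symm)
  · rw [h, map_zero]
  · exact (isInvertible_chartForm he' hu.2).injective (h.trans (map_zero _).symm)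

lemma isCompl_horizontalOf (he : e ∈ IsManifold.maximalAtlas (𝓡 m) ∞ T)
    (he' : e' ∈ IsManifold.maximalAtlas (𝓡 n) ∞ M) {u : DualJet m n T M}
    (hu : u ∈ coordDomain e e') (K : DualJet m n T M → NonlinearCoeffs m n) :
    IsCompl (horizontalOf e e' K u) (verticalSpace u) := by
  constructor
  · rw [Submodule.disjoint_def]
    intro v hv hv'
    rw [mem_horizontalOf] at hv
    rw [mem_verticalSpace_iff_coordDiff he he' hu] at hv'
    refine eq_zero_of_coordDiff_eq_zero he he' hu v ?_
    rw [eq_sum_of_adaptedMomentum_eq_zero (K u) hv, hv'.1, hv'.2]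
    simp
  · rw [codisjoint_iff, eq_top_iff]
    intro v _
    -- The vertical vector with the same `δp` as `v`; subtracting it leaves a horizontal vector.
    let w := ofComponents e e' u (0, 0, adaptedMomentum (K u) (coordDiff e e' u v))
    have hw : coordDiff e e' u w = (0, 0, adaptedMomentum (K u) (coordDiff e e' u v)) :=
      coordDiff_ofComponents he he' hu _
    rw [Submodule.mem_sup]
    refine ⟨v - w, ?_, w, ?_, sub_add_cancel v w⟩
    · rw [mem_horizontalOf, map_sub, map_sub, hw]
      ext i a
      simp [adaptedMomentum]
    · rw [mem_verticalSpace_iff_coordDiff he he' hu, hw]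
      exact ⟨rfl, rfl⟩

/-- The adapted vector fields `δ/δt^a`, `δ/δx^i` as one family. -/
def adaptedFrame (e : OpenPartialHomeomorph T (EuclideanSpace ℝ (Fin m)))
    (e' : OpenPartialHomeomorph M (EuclideanSpace ℝ (Fin n)))
    (K : DualJet m n T M → NonlinearCoeffs m n) (r : Fin (m + n)) (u : DualJet m n T M) :
    TangentSpace (DualJetI m n) u :=
  Fin.append (fun a ↦ deltaT e e' K a u) (fun i ↦ deltaX e e' K i u) r

lemma linearIndependent_adaptedFrame (he : e ∈ IsManifold.maximalAtlas (𝓡 m) ∞ T)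
    (he' : e' ∈ IsManifold.maximalAtlas (𝓡 n) ∞ M) {u : DualJet m n T M}
    (hu : u ∈ coordDomain e e') (K : DualJet m n T M → NonlinearCoeffs m n) :
    LinearIndependent ℝ (fun r ↦ adaptedFrame e e' K r u) := by
  rw [Fintype.linearIndependent_iff]
  intro g hg r
  have h := congrArg (coordDiff e e' u) hg
  simp only [map_sum, map_zero, map_smul, Fin.sum_univ_add, adaptedFrame, Fin.append_left,
    Fin.append_right, coordDiff_deltaT he he' hu, coordDiff_deltaX he he' hu, map_add] at h
  refine Fin.addCases (fun a ↦ ?_) (fun i ↦ ?_) r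
  · have := congrArg (fun w : CoordSpace m n ↦ w.1 a) h
    simpa [Prod.fst_sum, Finset.sum_apply, Pi.single_apply] using this
  · have := congrArg (fun w : CoordSpace m n ↦ w.2.1 i) h
    simpa [Prod.fst_sum, Prod.snd_sum, Finset.sum_apply, Pi.single_apply] using this

lemma span_range_adaptedFrame (K : DualJet m n T M → NonlinearCoeffs m n) (u : DualJet m n T M) :
    Submodule.span ℝ (Set.range fun r ↦ adaptedFrame e e' K r u) =
      Submodule.span ℝ (Set.range (fun a ↦ deltaT e e' K a u) ∪
      Set.range (fun i ↦ deltaX e e' K i u)) := by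
  congr 1
  ext v
  constructor
  · rintro ⟨r, rfl⟩
    refine Fin.addCases (fun a ↦ ?_) (fun i ↦ ?_) r
    · exact Or.inl ⟨a, by simp [adaptedFrame]⟩
    · exact Or.inr ⟨i, by simp [adaptedFrame]⟩
  · rintro (⟨a, rfl⟩ | ⟨i, rfl⟩)
    · exact ⟨Fin.castAdd n a, by simp [adaptedFrame]⟩
    · exact ⟨Fin.natAdd m i, by simp [adaptedFrame]⟩

lemma eventually_isInvertible_coordDiff (he : e ∈ IsManifold.maximalAtlas (𝓡 m) ∞ T)
    (he' : e' ∈ IsManifold.maximalAtlas (𝓡 n) ∞ M) {u : DualJet m n T M}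
    (hu : u ∈ coordDomain e e') : ∀ᶠ w in 𝓝 u, (coordDiff e e' w).IsInvertible :=
  (mem_coordDomain_eventually e e' hu).mono fun _ hw ↦ isInvertible_coordDiff he he' hw

lemma contMDiffAt_adaptedFrame (he : e ∈ IsManifold.maximalAtlas (𝓡 m) ∞ T)
    (he' : e' ∈ IsManifold.maximalAtlas (𝓡 n) ∞ M) {u : DualJet m n T M}
    (hu : u ∈ coordDomain e e') {K : DualJet m n T M → NonlinearCoeffs m n}
    (hK₁ : ∀ a i b, ContMDiffAt (DualJetI m n) 𝓘(ℝ, ℝ) ∞ (fun w ↦ (K w).N₁ a i b) u)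
    (hK₂ : ∀ a i k, ContMDiffAt (DualJetI m n) 𝓘(ℝ, ℝ) ∞ (fun w ↦ (K w).N₂ a i k) u)
    (r : Fin (m + n)) :
    ContMDiffAt (DualJetI m n) (DualJetI m n).tangent ∞
      (fun w ↦ (⟨w, adaptedFrame e e' K r w⟩ : TangentBundle (DualJetI m n) (DualJet m n T M)))
      u := by
  refine (smoothForm_coordDiff he he' hu).contMDiffAt_of_apply
    (eventually_isInvertible_coordDiff he he' hu) ?_
  have hdom := mem_coordDomain_eventually e e' hu
  refine Fin.addCases (fun a ↦ ?_) (fun i ↦ ?_) r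
  · have h : ContMDiffAt (DualJetI m n) 𝓘(ℝ, CoordSpace m n) ∞
        (fun w ↦ ((EuclideanSpace.single a 1, 0, fun j b ↦ -(K w).N₁ b j a) : CoordSpace m n)) u :=
      contMDiffAt_const.prodMk_space (contMDiffAt_const.prodMk_space
        (contMDiffAt_pi_space.2 fun j ↦ contMDiffAt_pi_space.2 fun b ↦ (hK₁ b j a).neg))
    refine h.congr_of_eventuallyEq ?_
    filter_upwards [hdom] with w hw
    rw [adaptedFrame, Fin.append_left, coordDiff_deltaT he he' hw]
  · have h : ContMDiffAt (DualJetI m n) 𝓘(ℝ, CoordSpace m n) ∞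
        (fun w ↦ ((0, EuclideanSpace.single i 1, fun j b ↦ -(K w).N₂ b j i) : CoordSpace m n)) u :=
      contMDiffAt_const.prodMk_space (contMDiffAt_const.prodMk_space
        (contMDiffAt_pi_space.2 fun j ↦ contMDiffAt_pi_space.2 fun b ↦ (hK₂ b j i).neg))
    refine h.congr_of_eventuallyEq ?_
    filter_upwards [hdom] with w hw
    rw [adaptedFrame, Fin.append_right, coordDiff_deltaX he he' hw]

end AdaptedFrames

/-! ### The nonlinear connection attached to connections on `T` and `M` -/

section BerwaldNonlinearConnection

variable {m n : ℕ}
  {T : Type*} [TopologicalSpace T] [ChartedSpace (EuclideanSpace ℝ (Fin m)) T]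
  {M : Type*} [TopologicalSpace M] [ChartedSpace (EuclideanSpace ℝ (Fin n)) M]
  [IsManifold (𝓡 m) ∞ T] [IsManifold (𝓡 n) ∞ M]
  {e e₁ : OpenPartialHomeomorph T (EuclideanSpace ℝ (Fin m))}
  {e' e₁' : OpenPartialHomeomorph M (EuclideanSpace ℝ (Fin n))}
  (χ : LinearConnection (𝓡 m) T) (Γ : LinearConnection (𝓡 n) M)

/-- Contracting `N₁` with `dt` and `N₂` with `dx` turns the coefficients into connection forms
acting on `p`. This links the local formula for `N` to the expression whose transformation law is
known. -/
lemma adaptedMomentum_berwald (he : e ∈ IsManifold.maximalAtlas (𝓡 m) ∞ T)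
    (he' : e' ∈ IsManifold.maximalAtlas (𝓡 n) ∞ M) {u : DualJet m n T M}
    (hu : u ∈ coordDomain e e') (v : TangentSpace (DualJetI m n) u) (i : Fin n) (a : Fin m) :
    adaptedMomentum (berwaldNonlinearCoeffs e e' χ Γ u) (coordDiff e e' u v) i a =
      covPolymomentum χ Γ e e' i a u v := by
  simp only [adaptedMomentum, LinearMap.coe_mk, AddHom.coe_mk, covPolymomentum,
    coordDiff_momentum he he' hu, coordDiff_fst he he' hu, coordDiff_snd he he' hu,
    berwaldNonlinearCoeffs, LinearConnection.connForm, ← coordForm_eq]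
  have h1 : ∑ b, (∑ c, χ.coeff e a c b u.proj.1 * polymomentum e e' i c u) *
      coordForm e b u.proj.1 (baseT u v) = ∑ c, (∑ b, χ.coeff e a c b u.proj.1 *
      coordForm e b u.proj.1 (baseT u v)) * polymomentum e e' i c u := by
    simp only [Finset.sum_mul]
    rw [Finset.sum_comm]
    exact Finset.sum_congr rfl fun _ _ ↦ Finset.sum_congr rfl fun _ _ ↦ by ring
  have h2 : ∑ k, (-∑ l, Γ.coeff e' l i k u.proj.2 * polymomentum e e' l a u) *
      coordForm e' k u.proj.2 (baseM u v) = -∑ l, (∑ k, Γ.coeff e' l i k u.proj.2 *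
      coordForm e' k u.proj.2 (baseM u v)) * polymomentum e e' l a u := by
    simp only [neg_mul, Finset.sum_neg_distrib, Finset.sum_mul]
    rw [Finset.sum_comm]
    exact congrArg _ (Finset.sum_congr rfl fun _ _ ↦ Finset.sum_congr rfl fun _ _ ↦ by ring)
  rw [h1, h2]
  ring

lemma mem_horizontalOf_berwald (he : e ∈ IsManifold.maximalAtlas (𝓡 m) ∞ T)
    (he' : e' ∈ IsManifold.maximalAtlas (𝓡 n) ∞ M) {u : DualJet m n T M}
    (hu : u ∈ coordDomain e e') (v : TangentSpace (DualJetI m n) u) :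
    v ∈ horizontalOf e e' (berwaldNonlinearCoeffs e e' χ Γ) u ↔
      ∀ i a, covPolymomentum χ Γ e e' i a u v = 0 := by
  simp only [mem_horizontalOf, funext_iff, adaptedMomentum_berwald χ Γ he he' hu, Pi.zero_apply]

/-- The forms `δp` of one chart pair are combinations of those of the other, so their common kernels
are comparable; exchanging the charts gives equality. -/
lemma horizontalOf_berwald_le (he : e ∈ IsManifold.maximalAtlas (𝓡 m) ∞ T)
    (he' : e' ∈ IsManifold.maximalAtlas (𝓡 n) ∞ M)
    (he₁ : e₁ ∈ IsManifold.maximalAtlas (𝓡 m) ∞ T)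
    (he₁' : e₁' ∈ IsManifold.maximalAtlas (𝓡 n) ∞ M) {u : DualJet m n T M}
    (hu : u ∈ coordDomain e e') (hu₁ : u ∈ coordDomain e₁ e₁') :
    horizontalOf e₁ e₁' (berwaldNonlinearCoeffs e₁ e₁' χ Γ) u ≤
      horizontalOf e e' (berwaldNonlinearCoeffs e e' χ Γ) u := by
  intro v hv
  rw [mem_horizontalOf_berwald χ Γ he₁ he₁' hu₁] at hv
  rw [mem_horizontalOf_berwald χ Γ he he' hu]
  intro i a
  rw [covPolymomentum_transition χ Γ he he' he₁ he₁' hu hu₁]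
  simp [hv]

lemma horizontalOf_berwald_eq (he : e ∈ IsManifold.maximalAtlas (𝓡 m) ∞ T)
    (he' : e' ∈ IsManifold.maximalAtlas (𝓡 n) ∞ M)
    (he₁ : e₁ ∈ IsManifold.maximalAtlas (𝓡 m) ∞ T)
    (he₁' : e₁' ∈ IsManifold.maximalAtlas (𝓡 n) ∞ M) {u : DualJet m n T M}
    (hu : u ∈ coordDomain e e') (hu₁ : u ∈ coordDomain e₁ e₁') :
    horizontalOf e₁ e₁' (berwaldNonlinearCoeffs e₁ e₁' χ Γ) u =
      horizontalOf e e' (berwaldNonlinearCoeffs e e' χ Γ) u :=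
  le_antisymm (horizontalOf_berwald_le χ Γ he he' he₁ he₁' hu hu₁)
    (horizontalOf_berwald_le χ Γ he₁ he₁' he he' hu₁ hu)

lemma contMDiffAt_coeff_fst [T2Space T] (he : e ∈ IsManifold.maximalAtlas (𝓡 m) ∞ T)
    {u : DualJet m n T M} (hu : u.proj.1 ∈ e.source) (a b c : Fin m) :
    ContMDiffAt (DualJetI m n) 𝓘(ℝ, ℝ) ∞
      (fun w : DualJet m n T M ↦ χ.coeff e a b c w.proj.1) u :=
  (χ.contMDiffAt_coeff he hu a b c).comp u contMDiff_dualJet_fst.contMDiffAt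

lemma contMDiffAt_coeff_snd [T2Space M] (he' : e' ∈ IsManifold.maximalAtlas (𝓡 n) ∞ M)
    {u : DualJet m n T M} (hu : u.proj.2 ∈ e'.source) (i j k : Fin n) :
    ContMDiffAt (DualJetI m n) 𝓘(ℝ, ℝ) ∞
      (fun w : DualJet m n T M ↦ Γ.coeff e' i j k w.proj.2) u :=
  (Γ.contMDiffAt_coeff he' hu i j k).comp u contMDiff_dualJet_snd.contMDiffAt

omit [IsManifold (𝓡 m) ∞ T] [IsManifold (𝓡 n) ∞ M] in
lemma mem_coordDomain_chartAt (u : DualJet m n T M) :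
    u ∈ coordDomain (chartAt (EuclideanSpace ℝ (Fin m)) u.proj.1)
      (chartAt (EuclideanSpace ℝ (Fin n)) u.proj.2) :=
  ⟨mem_chart_source _ _, mem_chart_source _ _⟩

/-- The nonlinear connection attached to linear connections on `T` and `M`. -/
def berwaldNonlinearConnection [T2Space T] [T2Space M] : NonlinearConnection m n T M where
  horizontal u := horizontalOf (chartAt (EuclideanSpace ℝ (Fin m)) u.proj.1)
    (chartAt (EuclideanSpace ℝ (Fin n)) u.proj.2) (berwaldNonlinearCoeffs _ _ χ Γ) u
  isCompl u := isCompl_horizontalOf (IsManifold.chart_mem_maximalAtlas _)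
    (IsManifold.chart_mem_maximalAtlas _) (mem_coordDomain_chartAt u) _
  isSmooth u₀ := by
    have he := IsManifold.chart_mem_maximalAtlas (I := 𝓡 m) (n := ∞) u₀.proj.1
    have he' := IsManifold.chart_mem_maximalAtlas (I := 𝓡 n) (n := ∞) u₀.proj.2
    set e := chartAt (EuclideanSpace ℝ (Fin m)) u₀.proj.1
    set e' := chartAt (EuclideanSpace ℝ (Fin n)) u₀.proj.2
    -- The horizontal space at `u` is defined through charts depending on `u`; a smooth local frame
    -- needs one chart pair near `u₀`, and chart independence identifies its span with the given
    -- spaces.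
    refine ⟨coordDomain e e', isOpen_coordDomain e e', mem_coordDomain_chartAt u₀,
      adaptedFrame e e' (berwaldNonlinearCoeffs e e' χ Γ), fun r u hu ↦ ?_, fun u hu ↦
      ⟨linearIndependent_adaptedFrame he he' hu _, ?_⟩⟩
    · refine (contMDiffAt_adaptedFrame he he' hu (fun a i b ↦ ?_) (fun a i k ↦ ?_)
        r).contMDiffWithinAt
      · have h (c : Fin m) : ContMDiffAt (DualJetI m n) 𝓘(ℝ, ℝ) ∞
            (fun w ↦ χ.coeff e a c b w.proj.1 * polymomentum e e' i c w) u :=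
          (contMDiffAt_coeff_fst χ he hu.1 a c b).mul (contMDiffAt_polymomentum he he' i c hu)
        exact contMDiffAt_finsetSum (t := Finset.univ) fun c _ ↦ h c
      · exact (contMDiffAt_finsetSum fun l _ ↦ (contMDiffAt_coeff_snd Γ he' hu.2 l i k).mul
          (contMDiffAt_polymomentum he he' l a hu)).neg
    · rw [span_range_adaptedFrame, ← horizontalOf_eq_span he he' hu]
      exact horizontalOf_berwald_eq χ Γ he he' (IsManifold.chart_mem_maximalAtlas _)
        (IsManifold.chart_mem_maximalAtlas _) hu (mem_coordDomain_chartAt u)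

lemma berwaldNonlinearConnection_hasCoeffs [T2Space T] [T2Space M]
    (he : e ∈ IsManifold.maximalAtlas (𝓡 m) ∞ T) (he' : e' ∈ IsManifold.maximalAtlas (𝓡 n) ∞ M) :
    (berwaldNonlinearConnection χ Γ).HasCoeffs e e' (berwaldNonlinearCoeffs e e' χ Γ) := by
  intro u hu
  rw [← horizontalOf_eq_span he he' hu]
  exact horizontalOf_berwald_eq χ Γ he he' (IsManifold.chart_mem_maximalAtlas _)
    (IsManifold.chart_mem_maximalAtlas _) hu (mem_coordDomain_chartAt u)

end BerwaldNonlinearConnection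

/-! ### The coframe adapted to an arbitrary nonlinear connection -/

section VerticalProjection

lemma exists_continuous_projection_of_isCompl {E : Type*} [NormedAddCommGroup E] [NormedSpace ℝ E]
    [FiniteDimensional ℝ E] {p q : Submodule ℝ E} (h : IsCompl p q) :
    ∃ P : E →L[ℝ] E, (∀ v, P v ∈ p) ∧ (∀ v ∈ p, P v = v) ∧ ∀ v ∈ q, P v = 0 :=
  ⟨LinearMap.toContinuousLinearMap (p.projection q h), fun v ↦ Submodule.projection_apply_mem h v,
    fun _ hv ↦ Submodule.projection_apply_of_mem_left h hv,
    fun _ hv ↦ Submodule.projection_apply_of_mem_right h hv⟩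

lemma exists_continuous_projection_tangentSpace {E : Type*} [NormedAddCommGroup E]
    [NormedSpace ℝ E] [FiniteDimensional ℝ E] {H : Type*} [TopologicalSpace H]
    {I : ModelWithCorners ℝ E H} {X : Type*} [TopologicalSpace X] [ChartedSpace H X] {x : X}
    {p q : Submodule ℝ (TangentSpace I x)} (h : IsCompl p q) :
    ∃ P : TangentSpace I x →L[ℝ] TangentSpace I x,
      (∀ v, P v ∈ p) ∧ (∀ v ∈ p, P v = v) ∧ ∀ v ∈ q, P v = 0 :=
  exists_continuous_projection_of_isCompl (E := E) h

variable {m n : ℕ}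
  {T : Type*} [TopologicalSpace T] [ChartedSpace (EuclideanSpace ℝ (Fin m)) T]
  {M : Type*} [TopologicalSpace M] [ChartedSpace (EuclideanSpace ℝ (Fin n)) M]
  [IsManifold (𝓡 m) ∞ T] [IsManifold (𝓡 n) ∞ M]
  {e e₁ : OpenPartialHomeomorph T (EuclideanSpace ℝ (Fin m))}
  {e' e₁' : OpenPartialHomeomorph M (EuclideanSpace ℝ (Fin n))}

/-- The projection of the tangent spaces of `E*` onto the vertical subspaces along the horizontal
ones. -/
def NonlinearConnection.vertProj (N : NonlinearConnection m n T M) (u : DualJet m n T M) :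
    TangentSpace (DualJetI m n) u →L[ℝ] TangentSpace (DualJetI m n) u :=
  (exists_continuous_projection_tangentSpace (N.isCompl u).symm).choose

lemma NonlinearConnection.vertProj_mem (N : NonlinearConnection m n T M) {u : DualJet m n T M}
    (v : TangentSpace (DualJetI m n) u) : N.vertProj u v ∈ verticalSpace u :=
  (exists_continuous_projection_tangentSpace (N.isCompl u).symm).choose_spec.1 v

lemma NonlinearConnection.vertProj_of_vertical (N : NonlinearConnection m n T M)
    {u : DualJet m n T M} {v : TangentSpace (DualJetI m n) u} (hv : v ∈ verticalSpace u) :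
    N.vertProj u v = v :=
  (exists_continuous_projection_tangentSpace (N.isCompl u).symm).choose_spec.2.1 v hv

lemma NonlinearConnection.vertProj_of_horizontal (N : NonlinearConnection m n T M)
    {u : DualJet m n T M} {v : TangentSpace (DualJetI m n) u} (hv : v ∈ N.horizontal u) :
    N.vertProj u v = 0 :=
  (exists_continuous_projection_tangentSpace (N.isCompl u).symm).choose_spec.2.2 v hv

lemma NonlinearConnection.mem_horizontal_iff (N : NonlinearConnection m n T M)
    {u : DualJet m n T M} {v : TangentSpace (DualJetI m n) u} :
    v ∈ N.horizontal u ↔ N.vertProj u v = 0 := by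
  refine ⟨N.vertProj_of_horizontal, fun h ↦ ?_⟩
  obtain ⟨a, ha, b, hb, rfl⟩ := Submodule.mem_sup.1
    ((N.isCompl u).sup_eq_top ▸ Submodule.mem_top : v ∈ N.horizontal u ⊔ verticalSpace u)
  rw [map_add, N.vertProj_of_horizontal ha, N.vertProj_of_vertical hb, zero_add] at h
  rwa [h, add_zero]

/-- The projection of coordinate vectors to their `(t, x)`-components. -/
def basePart (m n : ℕ) :
    CoordSpace m n →L[ℝ] EuclideanSpace ℝ (Fin m) × EuclideanSpace ℝ (Fin n) :=
  (ContinuousLinearMap.fst ℝ _ _).prod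
    ((ContinuousLinearMap.fst ℝ _ _).comp (ContinuousLinearMap.snd ℝ _ _))

/-- The projection of coordinate vectors to their `p`-components. -/
def momentumPart (m n : ℕ) : CoordSpace m n →L[ℝ] CoordSpace m n :=
  (0 : CoordSpace m n →L[ℝ] EuclideanSpace ℝ (Fin m)).prod
    ((0 : CoordSpace m n →L[ℝ] EuclideanSpace ℝ (Fin n)).prod
    ((ContinuousLinearMap.snd ℝ _ _).comp (ContinuousLinearMap.snd ℝ _ _)))

lemma basePart_apply (w : CoordSpace m n) : basePart m n w = (w.1, w.2.1) := rfl

lemma momentumPart_apply (w : CoordSpace m n) : momentumPart m n w = (0, 0, w.2.2) := rfl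

/-- The coframe `(dt^a, dx^i, δp_i^a)` adapted to the nonlinear connection `N`. -/
def NonlinearConnection.adaptedForm (N : NonlinearConnection m n T M)
    (e : OpenPartialHomeomorph T (EuclideanSpace ℝ (Fin m)))
    (e' : OpenPartialHomeomorph M (EuclideanSpace ℝ (Fin n))) (u : DualJet m n T M) :
    TangentSpace (DualJetI m n) u →L[ℝ] CoordSpace m n :=
  coordDiff e e' u - (momentumPart m n).comp ((coordDiff e e' u).comp
    (ContinuousLinearMap.id ℝ _ - N.vertProj u))

variable (N : NonlinearConnection m n T M)

lemma NonlinearConnection.adaptedForm_apply (u : DualJet m n T M)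
    (v : TangentSpace (DualJetI m n) u) :
    N.adaptedForm e e' u v =
      ((coordDiff e e' u v).1, (coordDiff e e' u v).2.1,
        (coordDiff e e' u (N.vertProj u v)).2.2) := by
  have h : N.adaptedForm e e' u v = coordDiff e e' u v -
      momentumPart m n (coordDiff e e' u (v - N.vertProj u v)) := rfl
  rw [h, map_sub, momentumPart_apply]
  refine Prod.ext ?_ (Prod.ext ?_ ?_) <;> simp

lemma NonlinearConnection.adaptedForm_of_vertical {u : DualJet m n T M}
    {v : TangentSpace (DualJetI m n) u} (hv : v ∈ verticalSpace u) :
    N.adaptedForm e e' u v = coordDiff e e' u v := by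
  rw [N.adaptedForm_apply, N.vertProj_of_vertical hv]

lemma NonlinearConnection.mem_verticalSpace_iff_adaptedForm
    (he : e ∈ IsManifold.maximalAtlas (𝓡 m) ∞ T)
    (he' : e' ∈ IsManifold.maximalAtlas (𝓡 n) ∞ M) {u : DualJet m n T M}
    (hu : u ∈ coordDomain e e') (v : TangentSpace (DualJetI m n) u) :
    v ∈ verticalSpace u ↔ (N.adaptedForm e e' u v).1 = 0 ∧ (N.adaptedForm e e' u v).2.1 = 0 := by
  rw [mem_verticalSpace_iff_coordDiff he he' hu, N.adaptedForm_apply]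

lemma coordDiff_of_vertical (he : e ∈ IsManifold.maximalAtlas (𝓡 m) ∞ T)
    (he' : e' ∈ IsManifold.maximalAtlas (𝓡 n) ∞ M) {u : DualJet m n T M}
    (hu : u ∈ coordDomain e e') {v : TangentSpace (DualJetI m n) u} (hv : v ∈ verticalSpace u) :
    coordDiff e e' u v = (0, 0, (coordDiff e e' u v).2.2) := by
  obtain ⟨h1, h2⟩ := (mem_verticalSpace_iff_coordDiff he he' hu v).1 hv
  exact Prod.ext h1 (Prod.ext h2 rfl)

/-- Horizontal means that the vertical projection is zero, and a vertical vector is determined by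
its `p`-components. -/
lemma NonlinearConnection.mem_horizontal_iff_adaptedForm
    (he : e ∈ IsManifold.maximalAtlas (𝓡 m) ∞ T)
    (he' : e' ∈ IsManifold.maximalAtlas (𝓡 n) ∞ M) {u : DualJet m n T M}
    (hu : u ∈ coordDomain e e') (v : TangentSpace (DualJetI m n) u) :
    v ∈ N.horizontal u ↔ (N.adaptedForm e e' u v).2.2 = 0 := by
  rw [N.mem_horizontal_iff, N.adaptedForm_apply]
  refine ⟨fun h ↦ by rw [h, map_zero]; rfl, fun h ↦ ?_⟩
  refine eq_zero_of_coordDiff_eq_zero he he' hu _ ?_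
  rw [coordDiff_of_vertical he he' hu (N.vertProj_mem v)]
  exact Prod.ext rfl (Prod.ext rfl h)

/-- A vector killed by the coframe is vertical, and on vertical vectors the coframe is the injective
coordinate differential; the dimensions agree. -/
lemma NonlinearConnection.isInvertible_adaptedForm (he : e ∈ IsManifold.maximalAtlas (𝓡 m) ∞ T)
    (he' : e' ∈ IsManifold.maximalAtlas (𝓡 n) ∞ M) {u : DualJet m n T M}
    (hu : u ∈ coordDomain e e') : (N.adaptedForm e e' u).IsInvertible := by
  have hd : Module.finrank ℝ (EuclideanSpace ℝ (Fin m)) + Module.finrank ℝ (EuclideanSpace ℝ (Fin n)) +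
      Module.finrank ℝ (DualJetModel m n) = Module.finrank ℝ (CoordSpace m n) := by
    rw [finrank_dualJetModel, finrank_coordSpace]
    simp [add_assoc]
  refine ContinuousLinearMap.isInvertible_of_ker_trivial_prod (E := EuclideanSpace ℝ (Fin m))
    (F := EuclideanSpace ℝ (Fin n)) (K := DualJetModel m n) (G := CoordSpace m n)
    (N.adaptedForm e e' u) (fun v hv ↦ ?_) hd
  have hvert : v ∈ verticalSpace u :=
    (N.mem_verticalSpace_iff_adaptedForm he he' hu v).2 ⟨congrArg Prod.fst hv,
      congrArg (fun w : CoordSpace m n ↦ w.2.1) hv⟩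
  exact eq_zero_of_coordDiff_eq_zero he he' hu v ((N.adaptedForm_of_vertical hvert).symm.trans hv)

/-- The linear map which sends coefficients `s` to the coordinate components of `∑ s_r y_r`. -/
def frameComponents {k : ℕ} (e : OpenPartialHomeomorph T (EuclideanSpace ℝ (Fin m)))
    (e' : OpenPartialHomeomorph M (EuclideanSpace ℝ (Fin n))) (u : DualJet m n T M)
    (y : Fin k → TangentSpace (DualJetI m n) u) : (Fin k → ℝ) →L[ℝ] CoordSpace m n :=
  ∑ r, (ContinuousLinearMap.proj (R := ℝ) (φ := fun _ : Fin k ↦ ℝ) r).smulRight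
    (coordDiff e e' u (y r))

lemma frameComponents_apply {k : ℕ} (u : DualJet m n T M)
    (y : Fin k → TangentSpace (DualJetI m n) u) (s : Fin k → ℝ) :
    frameComponents e e' u y s = coordDiff e e' u (∑ r, s r • y r) := by
  rw [map_sum]
  simp only [map_smul]
  exact _root_.sum_apply ..

lemma contMDiffAt_frameComponents (he : e ∈ IsManifold.maximalAtlas (𝓡 m) ∞ T)
    (he' : e' ∈ IsManifold.maximalAtlas (𝓡 n) ∞ M) {u₀ : DualJet m n T M}
    (hu₀ : u₀ ∈ coordDomain e e') {k : ℕ}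
    {Y : Fin k → (u : DualJet m n T M) → TangentSpace (DualJetI m n) u}
    (hY : ∀ r, ContMDiffAt (DualJetI m n) (DualJetI m n).tangent ∞
      (fun u ↦ (⟨u, Y r u⟩ : TangentBundle (DualJetI m n) (DualJet m n T M))) u₀) :
    ContMDiffAt (DualJetI m n) 𝓘(ℝ, (Fin k → ℝ) →L[ℝ] CoordSpace m n) ∞
      (fun u ↦ frameComponents e e' u fun r ↦ Y r u) u₀ := by
  have h (r : Fin k) : ContMDiffAt (DualJetI m n)
      𝓘(ℝ, (Fin k → ℝ) →L[ℝ] CoordSpace m n) ∞ (fun u ↦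
      (ContinuousLinearMap.proj (R := ℝ) (φ := fun _ : Fin k ↦ ℝ) r).smulRight
        (coordDiff e e' u (Y r u))) u₀ :=
    ContMDiffAt.clm_apply (contMDiffAt_const (c := ContinuousLinearMap.smulRightL ℝ
      (Fin k → ℝ) (CoordSpace m n)
      (ContinuousLinearMap.proj (R := ℝ) (φ := fun _ : Fin k ↦ ℝ) r)))
      ((smoothForm_coordDiff he he' hu₀).contMDiffAt_apply (hY r))
  exact contMDiffAt_finsetSum (t := Finset.univ) fun r _ ↦ h r

/-- A horizontal combination with zero base components is also vertical, hence zero. The rank `m +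
n` of the frame is the dimension of the base. -/
lemma NonlinearConnection.isInvertible_basePart_frameComponents
    (he : e ∈ IsManifold.maximalAtlas (𝓡 m) ∞ T)
    (he' : e' ∈ IsManifold.maximalAtlas (𝓡 n) ∞ M) {u : DualJet m n T M}
    (hu : u ∈ coordDomain e e') {y : Fin (m + n) → TangentSpace (DualJetI m n) u}
    (hy : LinearIndependent ℝ y) (hmem : ∀ r, y r ∈ N.horizontal u) :
    ((basePart m n).comp (frameComponents e e' u y)).IsInvertible := by
  refine ContinuousLinearMap.isInvertible_of_ker_trivial _ (fun s hs ↦ ?_) ?_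
  · have h1 : basePart m n (coordDiff e e' u (∑ r, s r • y r)) = 0 := by
      rw [← frameComponents_apply]; exact hs
    rw [basePart_apply] at h1
    have h2 := (mem_verticalSpace_iff_coordDiff he he' hu _).2 (Prod.mk_eq_zero.1 h1)
    have h3 := Submodule.disjoint_def.1 (N.isCompl u).disjoint _
      (Submodule.sum_mem _ fun r _ ↦ Submodule.smul_mem _ (s r) (hmem r)) h2
    have h4 := Fintype.linearIndependent_iff.1 hy s h3
    exact funext h4
  · rw [Module.finrank_prod]
    simp

/-- The horizontal vector `∑ s_r y_r` has the same base components as `v`, so it is the horizontal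
part of `v`, and `δp` arises by subtracting its `p`-components. -/
lemma NonlinearConnection.adaptedForm_apply_eq_of_frame
    (he : e ∈ IsManifold.maximalAtlas (𝓡 m) ∞ T)
    (he' : e' ∈ IsManifold.maximalAtlas (𝓡 n) ∞ M) {u : DualJet m n T M}
    (hu : u ∈ coordDomain e e') {y : Fin (m + n) → TangentSpace (DualJetI m n) u}
    (hmem : ∀ r, y r ∈ N.horizontal u) (v : TangentSpace (DualJetI m n) u) (s : Fin (m + n) → ℝ)
    (hs : basePart m n (frameComponents e e' u y s) = basePart m n (coordDiff e e' u v)) :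
    N.adaptedForm e e' u v =
      coordDiff e e' u v - momentumPart m n (frameComponents e e' u y s) := by
  have hsum : ∑ r, s r • y r ∈ N.horizontal u :=
    Submodule.sum_mem _ fun r _ ↦ Submodule.smul_mem _ (s r) (hmem r)
  rw [frameComponents_apply] at hs ⊢
  generalize ∑ r, s r • y r = z at hs hsum ⊢
  have h2 : v - z ∈ verticalSpace u := by
    rw [mem_verticalSpace_iff_coordDiff he he' hu, map_sub]
    rw [basePart_apply, basePart_apply] at hs
    exact ⟨sub_eq_zero.2 (congrArg Prod.fst hs).symm, sub_eq_zero.2 (congrArg Prod.snd hs).symm⟩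
  have h3 : N.vertProj u v = v - z := by
    have := N.vertProj_of_vertical h2
    rwa [map_sub, N.vertProj_of_horizontal hsum, sub_zero] at this
  rw [N.adaptedForm_apply, h3, map_sub, momentumPart_apply]
  refine Prod.ext ?_ (Prod.ext ?_ ?_) <;> simp

/-- The projection is chosen point by point, so smoothness has to come from a smooth local frame of
the distribution. If `B` holds the components of the frame and `A` is its base part, the coframe is
`(id - momentumPart ∘ B ∘ A⁻¹ ∘ basePart) ∘ coordDiff`, and `A⁻¹` is smooth because `A` is
invertible. -/
lemma NonlinearConnection.smoothForm_adaptedForm (he : e ∈ IsManifold.maximalAtlas (𝓡 m) ∞ T)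
    (he' : e' ∈ IsManifold.maximalAtlas (𝓡 n) ∞ M) {u₀ : DualJet m n T M}
    (hu₀ : u₀ ∈ coordDomain e e') : SmoothForm (N.adaptedForm e e') u₀ := by
  obtain ⟨U, hU, hU₀, Y, hY, hYU⟩ := N.isSmooth u₀
  have hmem {u : DualJet m n T M} (hu : u ∈ U) (r : Fin (m + n)) : Y r u ∈ N.horizontal u := by
    rw [(hYU u hu).2]
    exact Submodule.subset_span ⟨r, rfl⟩
  have hB := contMDiffAt_frameComponents he he' hu₀ fun r ↦ (hY r).contMDiffAt (hU.mem_nhds hU₀)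
  have hA := ContMDiffAt.clm_comp (contMDiffAt_const (c := basePart m n)) hB
  have hAi {u : DualJet m n T M} (hu : u ∈ U) (hu' : u ∈ coordDomain e e') :=
    N.isInvertible_basePart_frameComponents he he' hu' (hYU u hu).1 (hmem hu)
  have hAinv := (hAi hU₀ hu₀).contDiffAt_map_inverse (n := ∞) |>.contMDiffAt.comp u₀ hA
  have hL := ContMDiffAt.sub (contMDiffAt_const (c := ContinuousLinearMap.id ℝ (CoordSpace m n)))
    (ContMDiffAt.clm_comp (contMDiffAt_const (c := momentumPart m n)) (ContMDiffAt.clm_comp hB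
      (ContMDiffAt.clm_comp hAinv (contMDiffAt_const (c := basePart m n)))))
  refine SmoothForm.congr_of_eventuallyEq (SmoothForm.clm_comp (smoothForm_coordDiff he he' hu₀) hL) ?_
  filter_upwards [hU.eventually_mem hU₀, mem_coordDomain_eventually e e' hu₀] with u hu hu'
  exact ContinuousLinearMap.ext fun v ↦ N.adaptedForm_apply_eq_of_frame he he' hu' (hmem hu) v _
    ((hAi hu hu').self_apply_inverse _)

lemma NonlinearConnection.adaptedForm_fst (he : e ∈ IsManifold.maximalAtlas (𝓡 m) ∞ T)
    (he' : e' ∈ IsManifold.maximalAtlas (𝓡 n) ∞ M) {u : DualJet m n T M}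
    (hu : u ∈ coordDomain e e') (v : TangentSpace (DualJetI m n) u) :
    (N.adaptedForm e e' u v).1 = chartForm e u.proj.1 (baseT u v) := by
  rw [N.adaptedForm_apply, coordDiff_fst he he' hu]

lemma NonlinearConnection.adaptedForm_snd (he : e ∈ IsManifold.maximalAtlas (𝓡 m) ∞ T)
    (he' : e' ∈ IsManifold.maximalAtlas (𝓡 n) ∞ M) {u : DualJet m n T M}
    (hu : u ∈ coordDomain e e') (v : TangentSpace (DualJetI m n) u) :
    (N.adaptedForm e e' u v).2.1 = chartForm e' u.proj.2 (baseM u v) := by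
  rw [N.adaptedForm_apply, coordDiff_snd he he' hu]

lemma NonlinearConnection.adaptedForm_fst_transition (he : e ∈ IsManifold.maximalAtlas (𝓡 m) ∞ T)
    (he' : e' ∈ IsManifold.maximalAtlas (𝓡 n) ∞ M)
    (he₁ : e₁ ∈ IsManifold.maximalAtlas (𝓡 m) ∞ T)
    (he₁' : e₁' ∈ IsManifold.maximalAtlas (𝓡 n) ∞ M) {u : DualJet m n T M}
    (hu : u ∈ coordDomain e e') (hu₁ : u ∈ coordDomain e₁ e₁') (a : Fin m)
    (v : TangentSpace (DualJetI m n) u) :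
    (N.adaptedForm e e' u v).1 a =
      ∑ b, transition e e₁ a b u.proj.1 * (N.adaptedForm e₁ e₁' u v).1 b := by
  rw [N.adaptedForm_fst he he' hu, N.adaptedForm_fst he₁ he₁' hu₁]
  exact coordForm_eq_sum_transition he₁ hu₁.1 a _

lemma NonlinearConnection.adaptedForm_snd_transition (he : e ∈ IsManifold.maximalAtlas (𝓡 m) ∞ T)
    (he' : e' ∈ IsManifold.maximalAtlas (𝓡 n) ∞ M)
    (he₁ : e₁ ∈ IsManifold.maximalAtlas (𝓡 m) ∞ T)
    (he₁' : e₁' ∈ IsManifold.maximalAtlas (𝓡 n) ∞ M) {u : DualJet m n T M}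
    (hu : u ∈ coordDomain e e') (hu₁ : u ∈ coordDomain e₁ e₁') (i : Fin n)
    (v : TangentSpace (DualJetI m n) u) :
    (N.adaptedForm e e' u v).2.1 i =
      ∑ j, transition e' e₁' i j u.proj.2 * (N.adaptedForm e₁ e₁' u v).2.1 j := by
  rw [N.adaptedForm_snd he he' hu, N.adaptedForm_snd he₁ he₁' hu₁]
  exact coordForm_eq_sum_transition he₁' hu₁.2 i _

/-- `δp` is `dp` evaluated on the vertical projection. The projection involves no charts, and `dp`
is tensorial on vertical vectors. -/
lemma NonlinearConnection.adaptedForm_momentum_transition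
    (he : e ∈ IsManifold.maximalAtlas (𝓡 m) ∞ T)
    (he' : e' ∈ IsManifold.maximalAtlas (𝓡 n) ∞ M)
    (he₁ : e₁ ∈ IsManifold.maximalAtlas (𝓡 m) ∞ T)
    (he₁' : e₁' ∈ IsManifold.maximalAtlas (𝓡 n) ∞ M) {u : DualJet m n T M}
    (hu : u ∈ coordDomain e e') (hu₁ : u ∈ coordDomain e₁ e₁') (i : Fin n) (a : Fin m)
    (v : TangentSpace (DualJetI m n) u) :
    (N.adaptedForm e e' u v).2.2 i a = ∑ k, ∑ c, transition e₁' e' k i u.proj.2 *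
      (transition e e₁ a c u.proj.1 * (N.adaptedForm e₁ e₁' u v).2.2 k c) := by
  simp only [N.adaptedForm_apply, coordDiff_momentum he he' hu, coordDiff_momentum he₁ he₁' hu₁]
  exact mvfderiv_polymomentum_transition_of_vertical he he' he₁ he₁' hu hu₁ i a (N.vertProj_mem v)

end VerticalProjection

/-! ### Bilinear maps with smooth coefficients -/

section TensorBilin

lemma contMDiffAt_sum_smul {E : Type*} [NormedAddCommGroup E] [NormedSpace ℝ E]
    {H : Type*} [TopologicalSpace H] {I : ModelWithCorners ℝ E H}
    {X : Type*} [TopologicalSpace X] [ChartedSpace H X] {x : X}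
    {G : Type*} [NormedAddCommGroup G] [NormedSpace ℝ G] {d : ℕ} (L : Fin d → Fin d → Fin d → G)
    {A : X → Fin d → Fin d → Fin d → ℝ}
    (hA : ∀ a b c, ContMDiffAt I 𝓘(ℝ, ℝ) ∞ (fun y ↦ A y a b c) x) :
    ContMDiffAt I 𝓘(ℝ, G) ∞ (fun y ↦ ∑ a, ∑ b, ∑ c, A y a b c • L a b c) x := by
  have h (a b c : Fin d) : ContMDiffAt I 𝓘(ℝ, G) ∞ (fun y ↦ A y a b c • L a b c) x :=
    (hA a b c).smul (contMDiffAt_const (c := L a b c))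
  exact contMDiffAt_finsetSum (t := Finset.univ) fun a _ ↦
    contMDiffAt_finsetSum (t := Finset.univ) fun b _ ↦
      contMDiffAt_finsetSum (t := Finset.univ) fun c _ ↦ h a b c

variable {G : Type*} [NormedAddCommGroup G] [NormedSpace ℝ G] {m n : ℕ}
  (α : Fin m → G →L[ℝ] ℝ) (β : Fin m → Fin m → G →L[ℝ] G)
  (α' : Fin n → G →L[ℝ] ℝ) (β' : Fin n → Fin n → G →L[ℝ] G)

/-- The bilinear map `∑ A^a_{bc} α^c ⊗ β_a^b + ∑ B^i_{jk} α'^k ⊗ β'_i^j`. -/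
def tensorBilin (A : Fin m → Fin m → Fin m → ℝ) (B : Fin n → Fin n → Fin n → ℝ) :
    G →L[ℝ] G →L[ℝ] G :=
  ∑ a, ∑ b, ∑ c, A a b c • (α c).smulRight (β a b) +
    ∑ i, ∑ j, ∑ k, B i j k • (α' k).smulRight (β' i j)

lemma tensorBilin_apply (A : Fin m → Fin m → Fin m → ℝ) (B : Fin n → Fin n → Fin n → ℝ)
    (w z : G) : tensorBilin α β α' β' A B w z =
      ∑ a, ∑ b, (∑ c, A a b c * α c w) • β a b z +
        ∑ i, ∑ j, (∑ k, B i j k * α' k w) • β' i j z := by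
  simp only [tensorBilin, _root_.add_apply, _root_.sum_apply, _root_.smul_apply,
    ContinuousLinearMap.smulRight_apply, Finset.sum_smul, smul_smul]

lemma contMDiffAt_tensorBilin {E : Type*} [NormedAddCommGroup E] [NormedSpace ℝ E]
    {H : Type*} [TopologicalSpace H] {I : ModelWithCorners ℝ E H}
    {X : Type*} [TopologicalSpace X] [ChartedSpace H X] {x : X}
    {A : X → Fin m → Fin m → Fin m → ℝ} {B : X → Fin n → Fin n → Fin n → ℝ}
    (hA : ∀ a b c, ContMDiffAt I 𝓘(ℝ, ℝ) ∞ (fun y ↦ A y a b c) x)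
    (hB : ∀ i j k, ContMDiffAt I 𝓘(ℝ, ℝ) ∞ (fun y ↦ B y i j k) x) :
    ContMDiffAt I 𝓘(ℝ, G →L[ℝ] G →L[ℝ] G) ∞
      (fun y ↦ tensorBilin α β α' β' (A y) (B y)) x :=
  ContMDiffAt.add (contMDiffAt_sum_smul (fun a b c ↦ (α c).smulRight (β a b)) hA)
    (contMDiffAt_sum_smul (fun i j k ↦ (α' k).smulRight (β' i j)) hB)

end TensorBilin

/-! ### The block-diagonal action of matrices on `(t, x, p)` -/

section GaugeForm

variable {m n : ℕ}

/-- The elementary matrix `(a, b)` acting on the `t`- and `p`-components. -/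
def timeUnit (a b : Fin m) : CoordSpace m n →L[ℝ] CoordSpace m n :=
  LinearMap.toContinuousLinearMap
  { toFun w := (EuclideanSpace.single a (w.1 b), 0, fun i ↦ Pi.single a (w.2.2 i b))
    map_add' w w' := by
      refine Prod.ext ?_ (Prod.ext ?_ ?_)
      · ext c; rcases eq_or_ne c a with rfl | h <;> simp [*]
      · simp
      · ext i : 1
        exact Pi.single_add (f := fun _ : Fin m ↦ ℝ) a _ _
    map_smul' r w := by
      refine Prod.ext ?_ (Prod.ext ?_ ?_)
      · ext c; simp
      · simp
      · ext i c; simp [Pi.single_apply] }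

/-- The elementary matrix `(i, j)` acting on the `x`-components, and the negative of its transpose
acting on the `p`-components. -/
def spaceUnit (i j : Fin n) : CoordSpace m n →L[ℝ] CoordSpace m n :=
  LinearMap.toContinuousLinearMap
  { toFun w := (0, EuclideanSpace.single i (w.2.1 j), -Pi.single j (w.2.2 i))
    map_add' w w' := by
      refine Prod.ext ?_ (Prod.ext ?_ ?_)
      · simp
      · ext c; rcases eq_or_ne c i with rfl | h <;> simp [*]
      · simp only [Prod.snd_add, Pi.add_apply]
        rw [Pi.single_add (f := fun _ : Fin n ↦ Fin m → ℝ), neg_add]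
    map_smul' r w := by
      refine Prod.ext ?_ (Prod.ext ?_ ?_)
      · simp
      · ext c; simp
      · ext k c
        by_cases h : k = j
        · subst h; simp
        · simp [h] }

lemma timeUnit_apply (a b : Fin m) (w : CoordSpace m n) : timeUnit a b w =
    (EuclideanSpace.single a (w.1 b), 0, fun i ↦ Pi.single a (w.2.2 i b)) := rfl

lemma spaceUnit_apply (i j : Fin n) (w : CoordSpace m n) : spaceUnit i j w =
    (0, EuclideanSpace.single i (w.2.1 j), -Pi.single j (w.2.2 i)) := rfl

/-- The coordinate projection `(t, x, p) ↦ t^a`. -/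
def timeProj (a : Fin m) : CoordSpace m n →L[ℝ] ℝ :=
  (EuclideanSpace.proj a : EuclideanSpace ℝ (Fin m) →L[ℝ] ℝ).comp (ContinuousLinearMap.fst ℝ _ _)

/-- The coordinate projection `(t, x, p) ↦ x^i`. -/
def spaceProj (i : Fin n) : CoordSpace m n →L[ℝ] ℝ :=
  (EuclideanSpace.proj i : EuclideanSpace ℝ (Fin n) →L[ℝ] ℝ).comp
    ((ContinuousLinearMap.fst ℝ _ _).comp (ContinuousLinearMap.snd ℝ _ _))

/-- The bilinear map on coordinate vectors with coefficients `A` (for `t`) and `B` (for `x`). -/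
def gaugeBilin (A : Fin m → Fin m → Fin m → ℝ) (B : Fin n → Fin n → Fin n → ℝ) :
    CoordSpace m n →L[ℝ] CoordSpace m n →L[ℝ] CoordSpace m n :=
  tensorBilin timeProj timeUnit spaceProj spaceUnit A B

lemma gaugeBilin_apply (A : Fin m → Fin m → Fin m → ℝ) (B : Fin n → Fin n → Fin n → ℝ)
    (w z : CoordSpace m n) : gaugeBilin A B w z =
      ∑ a, ∑ b, (∑ c, A a b c * w.1 c) • timeUnit a b z +
        ∑ i, ∑ j, (∑ k, B i j k * w.2.1 k) • spaceUnit i j z := by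
  rw [gaugeBilin, tensorBilin_apply]
  rfl

lemma gaugeBilin_apply_fst (A : Fin m → Fin m → Fin m → ℝ) (B : Fin n → Fin n → Fin n → ℝ)
    (w z : CoordSpace m n) (a : Fin m) :
    (gaugeBilin A B w z).1 a = ∑ b, (∑ c, A a b c * w.1 c) * z.1 b := by
  rw [gaugeBilin_apply]
  simp [timeUnit_apply, spaceUnit_apply, Prod.fst_sum, Finset.sum_apply, Pi.single_apply]

lemma gaugeBilin_apply_snd (A : Fin m → Fin m → Fin m → ℝ) (B : Fin n → Fin n → Fin n → ℝ)
    (w z : CoordSpace m n) (i : Fin n) :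
    (gaugeBilin A B w z).2.1 i = ∑ j, (∑ k, B i j k * w.2.1 k) * z.2.1 j := by
  rw [gaugeBilin_apply]
  simp [timeUnit_apply, spaceUnit_apply, Prod.fst_sum, Prod.snd_sum, Finset.sum_apply,
    Pi.single_apply]

/-- The action induced on `p`: the upper index carries `A` itself, the lower one the dual action,
hence the minus sign and the transposed indices of `B`. -/
lemma gaugeBilin_apply_momentum (A : Fin m → Fin m → Fin m → ℝ) (B : Fin n → Fin n → Fin n → ℝ)
    (w z : CoordSpace m n) (i : Fin n) (a : Fin m) :
    (gaugeBilin A B w z).2.2 i a = ∑ b, (∑ c, A a b c * w.1 c) * z.2.2 i b -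
      ∑ j, (∑ k, B j i k * w.2.1 k) * z.2.2 j a := by
  rw [gaugeBilin_apply]
  have h (j l : Fin n) : (Pi.single (M := fun _ : Fin n ↦ Fin m → ℝ) l (z.2.2 j)) i a =
      if i = l then z.2.2 j a else 0 := by
    by_cases h : i = l
    · subst h; simp
    · simp [h]
  have h' (b c : Fin m) : (Pi.single (M := fun _ : Fin m ↦ ℝ) c (z.2.2 i b)) a =
      if a = c then z.2.2 i b else 0 := Pi.single_apply ..
  simp [timeUnit_apply, spaceUnit_apply, Prod.snd_sum, Finset.sum_apply, h, h', sub_eq_add_neg]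

lemma contMDiffAt_gaugeBilin {E : Type*} [NormedAddCommGroup E] [NormedSpace ℝ E]
    {H : Type*} [TopologicalSpace H] {I : ModelWithCorners ℝ E H}
    {X : Type*} [TopologicalSpace X] [ChartedSpace H X] {x : X}
    {A : X → Fin m → Fin m → Fin m → ℝ} {B : X → Fin n → Fin n → Fin n → ℝ}
    (hA : ∀ a b c, ContMDiffAt I 𝓘(ℝ, ℝ) ∞ (fun y ↦ A y a b c) x)
    (hB : ∀ i j k, ContMDiffAt I 𝓘(ℝ, ℝ) ∞ (fun y ↦ B y i j k) x) :
    ContMDiffAt I 𝓘(ℝ, CoordSpace m n →L[ℝ] CoordSpace m n →L[ℝ] CoordSpace m n) ∞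
      (fun y ↦ gaugeBilin (A y) (B y)) x :=
  contMDiffAt_tensorBilin _ _ _ _ hA hB

end GaugeForm

/-! ### The Berwald connection in one adapted coframe -/

section AdaptedConnection

variable {m n : ℕ}
  {T : Type*} [TopologicalSpace T] [ChartedSpace (EuclideanSpace ℝ (Fin m)) T]
  {M : Type*} [TopologicalSpace M] [ChartedSpace (EuclideanSpace ℝ (Fin n)) M]
  [IsManifold (𝓡 m) ∞ T] [IsManifold (𝓡 n) ∞ M]
  {e e₁ : OpenPartialHomeomorph T (EuclideanSpace ℝ (Fin m))}
  {e' e₁' : OpenPartialHomeomorph M (EuclideanSpace ℝ (Fin n))}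
  (χ : LinearConnection (𝓡 m) T) (Γ : LinearConnection (𝓡 n) M) (N : NonlinearConnection m n T M)

/-- The Christoffel symbols of the Berwald connection in an adapted coframe. -/
def gaugeForm (e : OpenPartialHomeomorph T (EuclideanSpace ℝ (Fin m)))
    (e' : OpenPartialHomeomorph M (EuclideanSpace ℝ (Fin n))) (u : DualJet m n T M) :
    CoordSpace m n →L[ℝ] CoordSpace m n →L[ℝ] CoordSpace m n :=
  gaugeBilin (fun a b c ↦ χ.coeff e a b c u.proj.1) (fun i j k ↦ Γ.coeff e' i j k u.proj.2)

lemma contMDiffAt_gaugeForm [T2Space T] [T2Space M] (he : e ∈ IsManifold.maximalAtlas (𝓡 m) ∞ T)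
    (he' : e' ∈ IsManifold.maximalAtlas (𝓡 n) ∞ M) {u : DualJet m n T M}
    (hu : u ∈ coordDomain e e') :
    ContMDiffAt (DualJetI m n) 𝓘(ℝ, CoordSpace m n →L[ℝ] CoordSpace m n →L[ℝ] CoordSpace m n) ∞
      (gaugeForm χ Γ e e') u :=
  contMDiffAt_gaugeBilin (fun a b c ↦ contMDiffAt_coeff_fst χ he hu.1 a b c)
    (fun i j k ↦ contMDiffAt_coeff_snd Γ he' hu.2 i j k)

lemma gaugeForm_adaptedForm_fst (he : e ∈ IsManifold.maximalAtlas (𝓡 m) ∞ T)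
    (he' : e' ∈ IsManifold.maximalAtlas (𝓡 n) ∞ M) {u : DualJet m n T M}
    (hu : u ∈ coordDomain e e') (v : TangentSpace (DualJetI m n) u) (w : CoordSpace m n)
    (a : Fin m) : (gaugeForm χ Γ e e' u (N.adaptedForm e e' u v) w).1 a =
      ∑ b, χ.connForm e a b u.proj.1 (baseT u v) * w.1 b := by
  rw [gaugeForm, gaugeBilin_apply_fst, N.adaptedForm_fst he he' hu]
  rfl

lemma gaugeForm_adaptedForm_snd (he : e ∈ IsManifold.maximalAtlas (𝓡 m) ∞ T)
    (he' : e' ∈ IsManifold.maximalAtlas (𝓡 n) ∞ M) {u : DualJet m n T M}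
    (hu : u ∈ coordDomain e e') (v : TangentSpace (DualJetI m n) u) (w : CoordSpace m n)
    (i : Fin n) : (gaugeForm χ Γ e e' u (N.adaptedForm e e' u v) w).2.1 i =
      ∑ j, Γ.connForm e' i j u.proj.2 (baseM u v) * w.2.1 j := by
  rw [gaugeForm, gaugeBilin_apply_snd, N.adaptedForm_snd he he' hu]
  rfl

lemma gaugeForm_adaptedForm_momentum (he : e ∈ IsManifold.maximalAtlas (𝓡 m) ∞ T)
    (he' : e' ∈ IsManifold.maximalAtlas (𝓡 n) ∞ M) {u : DualJet m n T M}
    (hu : u ∈ coordDomain e e') (v : TangentSpace (DualJetI m n) u) (w : CoordSpace m n)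
    (i : Fin n) (a : Fin m) : (gaugeForm χ Γ e e' u (N.adaptedForm e e' u v) w).2.2 i a =
      ∑ b, χ.connForm e a b u.proj.1 (baseT u v) * w.2.2 i b -
        ∑ j, Γ.connForm e' j i u.proj.2 (baseM u v) * w.2.2 j a := by
  rw [gaugeForm, gaugeBilin_apply_momentum, N.adaptedForm_fst he he' hu,
    N.adaptedForm_snd he he' hu]
  rfl

/-- The vector field with constant components `g` in the coframe adapted to `N`. -/
def NonlinearConnection.adaptedField (e : OpenPartialHomeomorph T (EuclideanSpace ℝ (Fin m)))
    (e' : OpenPartialHomeomorph M (EuclideanSpace ℝ (Fin n))) (g : CoordSpace m n)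
    (u : DualJet m n T M) : TangentSpace (DualJetI m n) u :=
  (N.adaptedForm e e' u).inverse g

lemma NonlinearConnection.adaptedForm_adaptedField (he : e ∈ IsManifold.maximalAtlas (𝓡 m) ∞ T)
    (he' : e' ∈ IsManifold.maximalAtlas (𝓡 n) ∞ M) {u : DualJet m n T M}
    (hu : u ∈ coordDomain e e') (g : CoordSpace m n) :
    N.adaptedForm e e' u (N.adaptedField e e' g u) = g :=
  (N.isInvertible_adaptedForm he he' hu).self_apply_inverse g

lemma NonlinearConnection.eventually_isInvertible_adaptedForm
    (he : e ∈ IsManifold.maximalAtlas (𝓡 m) ∞ T)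
    (he' : e' ∈ IsManifold.maximalAtlas (𝓡 n) ∞ M) {u : DualJet m n T M}
    (hu : u ∈ coordDomain e e') : ∀ᶠ w in 𝓝 u, (N.adaptedForm e e' w).IsInvertible :=
  (mem_coordDomain_eventually e e' hu).mono fun _ hw ↦ N.isInvertible_adaptedForm he he' hw

lemma NonlinearConnection.contMDiffAt_of_adaptedForm_eventuallyEq
    (he : e ∈ IsManifold.maximalAtlas (𝓡 m) ∞ T)
    (he' : e' ∈ IsManifold.maximalAtlas (𝓡 n) ∞ M) {u : DualJet m n T M}
    (hu : u ∈ coordDomain e e') {σ : (u : DualJet m n T M) → TangentSpace (DualJetI m n) u}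
    {g : CoordSpace m n} (hσ : ∀ᶠ w in 𝓝 u, N.adaptedForm e e' w (σ w) = g) :
    ContMDiffAt (DualJetI m n) (DualJetI m n).tangent ∞
      (fun w ↦ (⟨w, σ w⟩ : TangentBundle (DualJetI m n) (DualJet m n T M))) u :=
  (N.smoothForm_adaptedForm he he' hu).contMDiffAt_of_apply
    (N.eventually_isInvertible_adaptedForm he he' hu)
    ((contMDiffAt_const (c := g)).congr_of_eventuallyEq hσ)

/-- The Berwald connection in an adapted coframe. -/
def NonlinearConnection.localCov (e : OpenPartialHomeomorph T (EuclideanSpace ℝ (Fin m)))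
    (e' : OpenPartialHomeomorph M (EuclideanSpace ℝ (Fin n)))
    (σ : (u : DualJet m n T M) → TangentSpace (DualJetI m n) u) (u : DualJet m n T M) :
    TangentSpace (DualJetI m n) u →L[ℝ] TangentSpace (DualJetI m n) u :=
  frameCov (N.adaptedForm e e') (gaugeForm χ Γ e e') σ u

lemma NonlinearConnection.adaptedForm_localCov (he : e ∈ IsManifold.maximalAtlas (𝓡 m) ∞ T)
    (he' : e' ∈ IsManifold.maximalAtlas (𝓡 n) ∞ M) {u : DualJet m n T M}
    (hu : u ∈ coordDomain e e')
    (σ : (u : DualJet m n T M) → TangentSpace (DualJetI m n) u)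
    (v : TangentSpace (DualJetI m n) u) :
    N.adaptedForm e e' u (N.localCov χ Γ e e' σ u v) =
      mvfderiv (DualJetI m n) (fun w ↦ N.adaptedForm e e' w (σ w)) u v +
        gaugeForm χ Γ e e' u (N.adaptedForm e e' u v) (N.adaptedForm e e' u (σ u)) :=
  apply_frameCov _ σ (N.isInvertible_adaptedForm he he' hu) v

lemma NonlinearConnection.adaptedForm_localCov_of_eventuallyEq
    (he : e ∈ IsManifold.maximalAtlas (𝓡 m) ∞ T)
    (he' : e' ∈ IsManifold.maximalAtlas (𝓡 n) ∞ M) {u : DualJet m n T M}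
    (hu : u ∈ coordDomain e e')
    {σ : (u : DualJet m n T M) → TangentSpace (DualJetI m n) u} {g : CoordSpace m n}
    (hσ : ∀ᶠ w in 𝓝 u, N.adaptedForm e e' w (σ w) = g) (v : TangentSpace (DualJetI m n) u) :
    N.adaptedForm e e' u (N.localCov χ Γ e e' σ u v) =
      gaugeForm χ Γ e e' u (N.adaptedForm e e' u v) g := by
  have h : (fun w ↦ N.adaptedForm e e' w (σ w)) =ᶠ[𝓝 u] fun _ ↦ g := hσ
  rw [N.adaptedForm_localCov χ Γ he he' hu, h.mvfderiv_eq, mvfderiv_const, hσ.self_of_nhds]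
  exact zero_add _

lemma NonlinearConnection.isCovariantDerivativeOn_localCov
    (he : e ∈ IsManifold.maximalAtlas (𝓡 m) ∞ T) (he' : e' ∈ IsManifold.maximalAtlas (𝓡 n) ∞ M) :
    IsCovariantDerivativeOn ((EuclideanSpace ℝ (Fin m) × EuclideanSpace ℝ (Fin n)) ×
      DualJetModel m n) (I := DualJetI m n) (N.localCov χ Γ e e') (coordDomain e e') :=
  isCovariantDerivativeOn_frameCov _ (fun _ hu ↦ N.smoothForm_adaptedForm he he' hu)
    fun _ hu ↦ N.isInvertible_adaptedForm he he' hu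

end AdaptedConnection

/-! ### Independence of the local Berwald connections from the charts -/

section GaugeTransformation

lemma mvfderiv_mul_const_apply {E : Type*} [NormedAddCommGroup E] [NormedSpace ℝ E]
    {H : Type*} [TopologicalSpace H] {I : ModelWithCorners ℝ E H}
    {X : Type*} [TopologicalSpace X] [ChartedSpace H X] {f : X → ℝ} {x : X}
    (hf : MDifferentiableAt I 𝓘(ℝ, ℝ) f x) (r : ℝ) (v : TangentSpace I x) :
    mvfderiv I (fun y ↦ f y * r) x v = mvfderiv I f x v * r := by
  have h := mvfderiv_clm_apply (I := I) ((ContinuousLinearMap.id ℝ ℝ).smulRight r) hf v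
  exact h

/-- In matrix form, `(J A₁ - A J) g + A J g = J A₁ g`. -/
lemma linear_gauge_identity {d : ℕ} (J A A₁ : Fin d → Fin d → ℝ) (g : Fin d → ℝ) (a : Fin d) :
    ∑ b, (∑ c, J a c * A₁ c b - ∑ c, A a c * J c b) * g b + ∑ b, A a b * ∑ c, J b c * g c =
      ∑ b, J a b * ∑ c, A₁ b c * g c := by
  have h1 : ∑ b, A a b * ∑ c, J b c * g c = ∑ b, (∑ c, A a c * J c b) * g b := by
    simp only [Finset.mul_sum, Finset.sum_mul]
    rw [Finset.sum_comm]
    exact Finset.sum_congr rfl fun c _ ↦ Finset.sum_congr rfl fun b _ ↦ by ring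
  have h2 : ∑ b, J a b * ∑ c, A₁ b c * g c = ∑ b, (∑ c, J a c * A₁ c b) * g b := by
    simp only [Finset.mul_sum, Finset.sum_mul]
    rw [Finset.sum_comm]
    exact Finset.sum_congr rfl fun c _ ↦ Finset.sum_congr rfl fun b _ ↦ by ring
  rw [h1, h2, ← Finset.sum_add_distrib]
  exact Finset.sum_congr rfl fun b _ ↦ by ring

lemma timeProj_apply {m n : ℕ} (a : Fin m) (w : CoordSpace m n) : timeProj a w = w.1 a := rfl

lemma spaceProj_apply {m n : ℕ} (i : Fin n) (w : CoordSpace m n) : spaceProj i w = w.2.1 i := rfl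

lemma add_fst_apply {m n : ℕ} (w z : CoordSpace m n) (a : Fin m) :
    (w + z).1 a = w.1 a + z.1 a := rfl

lemma add_snd_apply {m n : ℕ} (w z : CoordSpace m n) (i : Fin n) :
    (w + z).2.1 i = w.2.1 i + z.2.1 i := rfl

variable {m n : ℕ}
  {T : Type*} [TopologicalSpace T] [ChartedSpace (EuclideanSpace ℝ (Fin m)) T]
  {M : Type*} [TopologicalSpace M] [ChartedSpace (EuclideanSpace ℝ (Fin n)) M]
  [IsManifold (𝓡 m) ∞ T] [IsManifold (𝓡 n) ∞ M]
  {e e₁ : OpenPartialHomeomorph T (EuclideanSpace ℝ (Fin m))}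
  {e' e₁' : OpenPartialHomeomorph M (EuclideanSpace ℝ (Fin n))}
  (χ : LinearConnection (𝓡 m) T) (Γ : LinearConnection (𝓡 n) M) (N : NonlinearConnection m n T M)

lemma mvfderiv_sum_transition_fst (he : e ∈ IsManifold.maximalAtlas (𝓡 m) ∞ T)
    (he₁ : e₁ ∈ IsManifold.maximalAtlas (𝓡 m) ∞ T) {u : DualJet m n T M}
    (hu : u.proj.1 ∈ e.source) (hu₁ : u.proj.1 ∈ e₁.source) (a : Fin m) (g : Fin m → ℝ)
    (v : TangentSpace (DualJetI m n) u) :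
    mvfderiv (DualJetI m n) (fun w : DualJet m n T M ↦
        ∑ b, transition e e₁ a b w.proj.1 * g b) u v =
      ∑ b, (∑ c, transition e e₁ a c u.proj.1 * χ.connForm e₁ c b u.proj.1 (baseT u v) -
        ∑ c, χ.connForm e a c u.proj.1 (baseT u v) * transition e e₁ c b u.proj.1) * g b := by
  have hT (b : Fin m) := mdifferentiableAt_transition he he₁ hu hu₁ a b
  have h (b : Fin m) : MDifferentiableAt (DualJetI m n) 𝓘(ℝ, ℝ)
      (fun w : DualJet m n T M ↦ transition e e₁ a b w.proj.1 * g b) u :=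
    (mdifferentiableAt_comp_fst (hT b)).mul mdifferentiableAt_const
  rw [mvfderiv_sum_apply _ fun b _ ↦ h b]
  refine Finset.sum_congr rfl fun b _ ↦ ?_
  rw [mvfderiv_mul_const_apply (mdifferentiableAt_comp_fst (hT b)), mvfderiv_comp_fst (hT b),
    χ.mvfderiv_transition he he₁ hu hu₁]

lemma mvfderiv_sum_transition_snd (he' : e' ∈ IsManifold.maximalAtlas (𝓡 n) ∞ M)
    (he₁' : e₁' ∈ IsManifold.maximalAtlas (𝓡 n) ∞ M) {u : DualJet m n T M}
    (hu : u.proj.2 ∈ e'.source) (hu₁ : u.proj.2 ∈ e₁'.source) (i : Fin n) (g : Fin n → ℝ)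
    (v : TangentSpace (DualJetI m n) u) :
    mvfderiv (DualJetI m n) (fun w : DualJet m n T M ↦
        ∑ j, transition e' e₁' i j w.proj.2 * g j) u v =
      ∑ j, (∑ k, transition e' e₁' i k u.proj.2 * Γ.connForm e₁' k j u.proj.2 (baseM u v) -
        ∑ k, Γ.connForm e' i k u.proj.2 (baseM u v) * transition e' e₁' k j u.proj.2) * g j := by
  have hT (j : Fin n) := mdifferentiableAt_transition he' he₁' hu hu₁ i j
  have h (j : Fin n) : MDifferentiableAt (DualJetI m n) 𝓘(ℝ, ℝ)
      (fun w : DualJet m n T M ↦ transition e' e₁' i j w.proj.2 * g j) u :=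
    (mdifferentiableAt_comp_snd (hT j)).mul mdifferentiableAt_const
  rw [mvfderiv_sum_apply _ fun j _ ↦ h j]
  refine Finset.sum_congr rfl fun j _ ↦ ?_
  rw [mvfderiv_mul_const_apply (mdifferentiableAt_comp_snd (hT j)), mvfderiv_comp_snd (hT j),
    Γ.mvfderiv_transition he' he₁' hu hu₁]

/-- The product with 0 stands where the derivative of the constant `g` would be, so that the right
side has the shape of `bilinear_gauge_identity` with `q = 0`. -/
lemma mvfderiv_sum_transition_momentum (he : e ∈ IsManifold.maximalAtlas (𝓡 m) ∞ T)
    (he' : e' ∈ IsManifold.maximalAtlas (𝓡 n) ∞ M)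
    (he₁ : e₁ ∈ IsManifold.maximalAtlas (𝓡 m) ∞ T)
    (he₁' : e₁' ∈ IsManifold.maximalAtlas (𝓡 n) ∞ M) {u : DualJet m n T M}
    (hu : u ∈ coordDomain e e') (hu₁ : u ∈ coordDomain e₁ e₁') (i : Fin n) (a : Fin m)
    (g : Fin n → Fin m → ℝ) (v : TangentSpace (DualJetI m n) u) :
    mvfderiv (DualJetI m n) (fun w : DualJet m n T M ↦ ∑ k, ∑ c,
        transition e₁' e' k i w.proj.2 * (transition e e₁ a c w.proj.1 * g k c)) u v =
      ∑ k, ∑ c, ((∑ l, transition e₁' e' k l u.proj.2 * Γ.connForm e' l i u.proj.2 (baseM u v) -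
          ∑ l, Γ.connForm e₁' k l u.proj.2 (baseM u v) * transition e₁' e' l i u.proj.2) *
          (transition e e₁ a c u.proj.1 * g k c) +
        transition e₁' e' k i u.proj.2 *
          ((∑ b, transition e e₁ a b u.proj.1 * χ.connForm e₁ b c u.proj.1 (baseT u v) -
            ∑ b, χ.connForm e a b u.proj.1 (baseT u v) * transition e e₁ b c u.proj.1) * g k c +
          transition e e₁ a c u.proj.1 * 0)) := by
  have hX (k : Fin n) := mdifferentiableAt_transition he₁' he' hu₁.2 hu.2 k i
  have hT (c : Fin m) := mdifferentiableAt_transition he he₁ hu.1 hu₁.1 a c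
  have hTp (k : Fin n) (c : Fin m) : MDifferentiableAt (DualJetI m n) 𝓘(ℝ, ℝ)
      (fun w : DualJet m n T M ↦ transition e e₁ a c w.proj.1 * g k c) u :=
    (mdifferentiableAt_comp_fst (hT c)).mul mdifferentiableAt_const
  have hXTp (k : Fin n) (c : Fin m) : MDifferentiableAt (DualJetI m n) 𝓘(ℝ, ℝ)
      (fun w : DualJet m n T M ↦ transition e₁' e' k i w.proj.2 *
        (transition e e₁ a c w.proj.1 * g k c)) u :=
    (mdifferentiableAt_comp_snd (hX k)).mul (hTp k c)
  rw [mvfderiv_sum_apply _ fun k _ ↦ mdifferentiableAt_fun_sum _ fun c _ ↦ hXTp k c]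
  refine Finset.sum_congr rfl fun k _ ↦ ?_
  rw [mvfderiv_sum_apply _ fun c _ ↦ hXTp k c]
  refine Finset.sum_congr rfl fun c _ ↦ ?_
  rw [mvfderiv_mul_apply (mdifferentiableAt_comp_snd (hX k)) (hTp k c),
    mvfderiv_mul_const_apply (mdifferentiableAt_comp_fst (hT c)), mvfderiv_comp_snd (hX k),
    mvfderiv_comp_fst (hT c), χ.mvfderiv_transition he he₁ hu.1 hu₁.1,
    Γ.mvfderiv_transition he₁' he' hu₁.2 hu.2, mul_zero, add_zero]

lemma NonlinearConnection.eventually_adaptedForm_adaptedField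
    (he : e ∈ IsManifold.maximalAtlas (𝓡 m) ∞ T)
    (he' : e' ∈ IsManifold.maximalAtlas (𝓡 n) ∞ M) {u : DualJet m n T M}
    (hu : u ∈ coordDomain e e') (g : CoordSpace m n) :
    ∀ᶠ w in 𝓝 u, N.adaptedForm e e' w (N.adaptedField e e' g w) = g :=
  (mem_coordDomain_eventually e e' hu).mono fun _ hw ↦ N.adaptedForm_adaptedField he he' hw g

lemma NonlinearConnection.mdifferentiableAt_adaptedForm_adaptedField
    (he : e ∈ IsManifold.maximalAtlas (𝓡 m) ∞ T)
    (he' : e' ∈ IsManifold.maximalAtlas (𝓡 n) ∞ M)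
    (he₁ : e₁ ∈ IsManifold.maximalAtlas (𝓡 m) ∞ T)
    (he₁' : e₁' ∈ IsManifold.maximalAtlas (𝓡 n) ∞ M) {u : DualJet m n T M}
    (hu : u ∈ coordDomain e e') (hu₁ : u ∈ coordDomain e₁ e₁') (g : CoordSpace m n) :
    MDifferentiableAt (DualJetI m n) 𝓘(ℝ, CoordSpace m n)
      (fun w ↦ N.adaptedForm e e' w (N.adaptedField e₁ e₁' g w)) u :=
  ((N.smoothForm_adaptedForm he he' hu).contMDiffAt_apply
    (N.contMDiffAt_of_adaptedForm_eventuallyEq he₁ he₁' hu₁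
      (N.eventually_adaptedForm_adaptedField he₁ he₁' hu₁ g))).mdifferentiableAt (by simp)

/-- The field has constant components `g` in the `e₁`-coframe. Its `t`-components in `e` are `J g`,
giving `dJ g + ω J g` on the left; the `e₁`-derivative is `ω₁ g`, giving `J ω₁ g` on the right. The
gauge law equates them. -/
lemma NonlinearConnection.localCov_adaptedField_fst
    (he : e ∈ IsManifold.maximalAtlas (𝓡 m) ∞ T)
    (he' : e' ∈ IsManifold.maximalAtlas (𝓡 n) ∞ M)
    (he₁ : e₁ ∈ IsManifold.maximalAtlas (𝓡 m) ∞ T)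
    (he₁' : e₁' ∈ IsManifold.maximalAtlas (𝓡 n) ∞ M) {u : DualJet m n T M}
    (hu : u ∈ coordDomain e e') (hu₁ : u ∈ coordDomain e₁ e₁') (g : CoordSpace m n)
    (a : Fin m) (v : TangentSpace (DualJetI m n) u) :
    (N.adaptedForm e e' u (N.localCov χ Γ e e' (N.adaptedField e₁ e₁' g) u v)).1 a =
      (N.adaptedForm e e' u (N.localCov χ Γ e₁ e₁' (N.adaptedField e₁ e₁' g) u v)).1 a := by
  have hz := N.adaptedForm_localCov_of_eventuallyEq χ Γ he₁ he₁' hu₁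
    (N.eventually_adaptedForm_adaptedField he₁ he₁' hu₁ g) v
  generalize N.localCov χ Γ e₁ e₁' (N.adaptedField e₁ e₁' g) u v = z at hz ⊢
  rw [N.adaptedForm_localCov χ Γ he he' hu]
  have h1 := mvfderiv_clm_apply (timeProj a : CoordSpace m n →L[ℝ] ℝ)
    (N.mdifferentiableAt_adaptedForm_adaptedField he he' he₁ he₁' hu hu₁ g) v
  have hev : (fun w ↦ timeProj a (N.adaptedForm e e' w (N.adaptedField e₁ e₁' g w))) =ᶠ[𝓝 u]
      fun w ↦ ∑ b, transition e e₁ a b w.proj.1 * g.1 b := by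
    filter_upwards [mem_coordDomain_eventually e e' hu, mem_coordDomain_eventually e₁ e₁' hu₁]
      with w hw hw₁
    rw [timeProj_apply, N.adaptedForm_fst_transition he he' he₁ he₁' hw hw₁,
      N.adaptedForm_adaptedField he₁ he₁' hw₁]
  rw [hev.mvfderiv_eq, mvfderiv_sum_transition_fst χ he he₁ hu.1 hu₁.1] at h1
  rw [timeProj_apply] at h1
  rw [add_fst_apply, ← h1, gaugeForm_adaptedForm_fst χ Γ N he he' hu]
  rw [N.adaptedForm_fst_transition he he' he₁ he₁' hu hu₁ a z, hz]
  simp only [N.adaptedForm_fst_transition he he' he₁ he₁' hu hu₁,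
    N.adaptedForm_adaptedField he₁ he₁' hu₁ g, gaugeForm_adaptedForm_fst χ Γ N he₁ he₁' hu₁]
  exact linear_gauge_identity (fun a b ↦ transition e e₁ a b u.proj.1)
    (fun a b ↦ χ.connForm e a b u.proj.1 (baseT u v))
    (fun a b ↦ χ.connForm e₁ a b u.proj.1 (baseT u v)) (fun b ↦ g.1 b) a

lemma NonlinearConnection.localCov_adaptedField_snd
    (he : e ∈ IsManifold.maximalAtlas (𝓡 m) ∞ T)
    (he' : e' ∈ IsManifold.maximalAtlas (𝓡 n) ∞ M)
    (he₁ : e₁ ∈ IsManifold.maximalAtlas (𝓡 m) ∞ T)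
    (he₁' : e₁' ∈ IsManifold.maximalAtlas (𝓡 n) ∞ M) {u : DualJet m n T M}
    (hu : u ∈ coordDomain e e') (hu₁ : u ∈ coordDomain e₁ e₁') (g : CoordSpace m n)
    (i : Fin n) (v : TangentSpace (DualJetI m n) u) :
    (N.adaptedForm e e' u (N.localCov χ Γ e e' (N.adaptedField e₁ e₁' g) u v)).2.1 i =
      (N.adaptedForm e e' u (N.localCov χ Γ e₁ e₁' (N.adaptedField e₁ e₁' g) u v)).2.1 i := by
  have hz := N.adaptedForm_localCov_of_eventuallyEq χ Γ he₁ he₁' hu₁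
    (N.eventually_adaptedForm_adaptedField he₁ he₁' hu₁ g) v
  generalize N.localCov χ Γ e₁ e₁' (N.adaptedField e₁ e₁' g) u v = z at hz ⊢
  rw [N.adaptedForm_localCov χ Γ he he' hu]
  have h1 := mvfderiv_clm_apply (spaceProj i : CoordSpace m n →L[ℝ] ℝ)
    (N.mdifferentiableAt_adaptedForm_adaptedField he he' he₁ he₁' hu hu₁ g) v
  have hev : (fun w ↦ spaceProj i (N.adaptedForm e e' w (N.adaptedField e₁ e₁' g w))) =ᶠ[𝓝 u]
      fun w ↦ ∑ j, transition e' e₁' i j w.proj.2 * g.2.1 j := by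
    filter_upwards [mem_coordDomain_eventually e e' hu, mem_coordDomain_eventually e₁ e₁' hu₁]
      with w hw hw₁
    rw [spaceProj_apply, N.adaptedForm_snd_transition he he' he₁ he₁' hw hw₁,
      N.adaptedForm_adaptedField he₁ he₁' hw₁]
  rw [hev.mvfderiv_eq, mvfderiv_sum_transition_snd Γ he' he₁' hu.2 hu₁.2] at h1
  rw [spaceProj_apply] at h1
  rw [add_snd_apply, ← h1, gaugeForm_adaptedForm_snd χ Γ N he he' hu]
  rw [N.adaptedForm_snd_transition he he' he₁ he₁' hu hu₁ i z, hz]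
  simp only [N.adaptedForm_snd_transition he he' he₁ he₁' hu hu₁,
    N.adaptedForm_adaptedField he₁ he₁' hu₁ g, gaugeForm_adaptedForm_snd χ Γ N he₁ he₁' hu₁]
  exact linear_gauge_identity (fun i j ↦ transition e' e₁' i j u.proj.2)
    (fun i j ↦ Γ.connForm e' i j u.proj.2 (baseM u v))
    (fun i j ↦ Γ.connForm e₁' i j u.proj.2 (baseM u v)) (fun j ↦ g.2.1 j) i

/-- The same comparison for the block with two indices, where the components are `X J g` and both
connections contribute. -/
lemma NonlinearConnection.localCov_adaptedField_momentum
    (he : e ∈ IsManifold.maximalAtlas (𝓡 m) ∞ T)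
    (he' : e' ∈ IsManifold.maximalAtlas (𝓡 n) ∞ M)
    (he₁ : e₁ ∈ IsManifold.maximalAtlas (𝓡 m) ∞ T)
    (he₁' : e₁' ∈ IsManifold.maximalAtlas (𝓡 n) ∞ M) {u : DualJet m n T M}
    (hu : u ∈ coordDomain e e') (hu₁ : u ∈ coordDomain e₁ e₁') (g : CoordSpace m n)
    (i : Fin n) (a : Fin m) (v : TangentSpace (DualJetI m n) u) :
    (N.adaptedForm e e' u (N.localCov χ Γ e e' (N.adaptedField e₁ e₁' g) u v)).2.2 i a =
      (N.adaptedForm e e' u (N.localCov χ Γ e₁ e₁' (N.adaptedField e₁ e₁' g) u v)).2.2 i a := by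
  have hz := N.adaptedForm_localCov_of_eventuallyEq χ Γ he₁ he₁' hu₁
    (N.eventually_adaptedForm_adaptedField he₁ he₁' hu₁ g) v
  generalize N.localCov χ Γ e₁ e₁' (N.adaptedField e₁ e₁' g) u v = z at hz ⊢
  rw [N.adaptedForm_localCov χ Γ he he' hu]
  have h1 := mvfderiv_clm_apply (momentumProj i a : CoordSpace m n →L[ℝ] ℝ)
    (N.mdifferentiableAt_adaptedForm_adaptedField he he' he₁ he₁' hu hu₁ g) v
  have hev : (fun w ↦ momentumProj i a (N.adaptedForm e e' w (N.adaptedField e₁ e₁' g w))) =ᶠ[𝓝 u]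
      fun w ↦ ∑ k, ∑ c, transition e₁' e' k i w.proj.2 *
        (transition e e₁ a c w.proj.1 * g.2.2 k c) := by
    filter_upwards [mem_coordDomain_eventually e e' hu, mem_coordDomain_eventually e₁ e₁' hu₁]
      with w hw hw₁
    change (N.adaptedForm e e' w (N.adaptedField e₁ e₁' g w)).2.2 i a = _
    rw [N.adaptedForm_momentum_transition he he' he₁ he₁' hw hw₁,
      N.adaptedForm_adaptedField he₁ he₁' hw₁]
  rw [hev.mvfderiv_eq, mvfderiv_sum_transition_momentum χ Γ he he' he₁ he₁' hu hu₁] at h1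
  refine (congrArg₂ (· + ·) h1.symm (gaugeForm_adaptedForm_momentum χ Γ N he he' hu v _ i a)).trans ?_
  rw [N.adaptedForm_momentum_transition he he' he₁ he₁' hu hu₁ i a z, hz]
  simp only [N.adaptedForm_momentum_transition he he' he₁ he₁' hu hu₁,
    N.adaptedForm_adaptedField he₁ he₁' hu₁ g, gaugeForm_adaptedForm_momentum χ Γ N he₁ he₁' hu₁]
  have h := bilinear_gauge_identity (fun k i ↦ transition e₁' e' k i u.proj.2)
    (fun a c ↦ transition e e₁ a c u.proj.1) (fun a b ↦ χ.connForm e a b u.proj.1 (baseT u v))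
    (fun a b ↦ χ.connForm e₁ a b u.proj.1 (baseT u v))
    (fun i j ↦ Γ.connForm e' i j u.proj.2 (baseM u v))
    (fun i j ↦ Γ.connForm e₁' i j u.proj.2 (baseM u v)) g.2.2 (fun _ _ ↦ 0) i a
  simp only [zero_add] at h
  rw [← h, add_sub_assoc]

lemma NonlinearConnection.localCov_adaptedField_eq (he : e ∈ IsManifold.maximalAtlas (𝓡 m) ∞ T)
    (he' : e' ∈ IsManifold.maximalAtlas (𝓡 n) ∞ M)
    (he₁ : e₁ ∈ IsManifold.maximalAtlas (𝓡 m) ∞ T)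
    (he₁' : e₁' ∈ IsManifold.maximalAtlas (𝓡 n) ∞ M) {u : DualJet m n T M}
    (hu : u ∈ coordDomain e e') (hu₁ : u ∈ coordDomain e₁ e₁') (g : CoordSpace m n) :
    N.localCov χ Γ e e' (N.adaptedField e₁ e₁' g) u =
      N.localCov χ Γ e₁ e₁' (N.adaptedField e₁ e₁' g) u := by
  refine ContinuousLinearMap.ext fun v ↦ ?_
  apply (N.isInvertible_adaptedForm he he' hu).injective
  refine Prod.ext ?_ (Prod.ext ?_ ?_)
  · ext a
    exact N.localCov_adaptedField_fst χ Γ he he' he₁ he₁' hu hu₁ g a v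
  · ext i
    exact N.localCov_adaptedField_snd χ Γ he he' he₁ he₁' hu hu₁ g i v
  · ext i a
    exact N.localCov_adaptedField_momentum χ Γ he he' he₁ he₁' hu hu₁ g i a v

/-- Fields with constant adapted components take every tangent vector at `u` as a value, so by
tensoriality of the difference it is enough that the two derivatives agree on them. -/
lemma NonlinearConnection.localCov_eq (he : e ∈ IsManifold.maximalAtlas (𝓡 m) ∞ T)
    (he' : e' ∈ IsManifold.maximalAtlas (𝓡 n) ∞ M)
    (he₁ : e₁ ∈ IsManifold.maximalAtlas (𝓡 m) ∞ T)
    (he₁' : e₁' ∈ IsManifold.maximalAtlas (𝓡 n) ∞ M) {u : DualJet m n T M}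
    (hu : u ∈ coordDomain e e') (hu₁ : u ∈ coordDomain e₁ e₁')
    {σ : (u : DualJet m n T M) → TangentSpace (DualJetI m n) u}
    (hσ : MDifferentiableAt (DualJetI m n) (DualJetI m n).tangent
      (fun w ↦ (⟨w, σ w⟩ : TangentBundle (DualJetI m n) (DualJet m n T M))) u) :
    N.localCov χ Γ e e' σ u = N.localCov χ Γ e₁ e₁' σ u := by
  refine IsCovariantDerivativeOn.eq_of_span_eq_top
    ((N.isCovariantDerivativeOn_localCov χ Γ he he').mono Set.inter_subset_left)
    ((N.isCovariantDerivativeOn_localCov χ Γ he₁ he₁').mono Set.inter_subset_right)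
    ⟨hu, hu₁⟩ (S := Set.univ) Submodule.span_univ (fun w _ ↦ ?_) hσ
  refine ⟨N.adaptedField e₁ e₁' (N.adaptedForm e₁ e₁' u w), ?_,
    (N.isInvertible_adaptedForm he₁ he₁' hu₁).inverse_apply_self w,
    N.localCov_adaptedField_eq χ Γ he he' he₁ he₁' hu hu₁ _⟩
  exact (N.contMDiffAt_of_adaptedForm_eventuallyEq he₁ he₁' hu₁
    (N.eventually_adaptedForm_adaptedField he₁ he₁' hu₁ _)).mdifferentiableAt (by simp)

end GaugeTransformation

/-! ### Gluing local covariant derivatives to a linear connection -/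

section LocallyFrameCov

variable {E : Type*} [NormedAddCommGroup E] [NormedSpace ℝ E] [CompleteSpace E]
  {H : Type*} [TopologicalSpace H] {I : ModelWithCorners ℝ E H}
  {X : Type*} [TopologicalSpace X] [ChartedSpace H X] [IsManifold I ∞ X]
  (G : Type*) [NormedAddCommGroup G] [NormedSpace ℝ G]

/-- `cov` is near every point of the form `frameCov` for a smooth coframe with values in `G`. -/
def IsLocallyFrameCov (cov : (Π x : X, TangentSpace I x) →
    (Π x : X, TangentSpace I x →L[ℝ] TangentSpace I x)) : Prop :=
  ∀ x₀ : X, ∃ (Θ : (x : X) → TangentSpace I x →L[ℝ] G) (Ω : X → G →L[ℝ] G →L[ℝ] G) (s : Set X),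
    IsOpen s ∧ x₀ ∈ s ∧ (∀ x ∈ s, SmoothForm Θ x) ∧ (∀ x ∈ s, (Θ x).IsInvertible) ∧
    (∀ x ∈ s, ContMDiffAt I 𝓘(ℝ, G →L[ℝ] G →L[ℝ] G) ∞ Ω x) ∧
    ∀ x ∈ s, ∀ σ : Π x : X, TangentSpace I x,
      MDifferentiableAt I I.tangent (fun x ↦ (⟨x, σ x⟩ : TangentBundle I X)) x →
        cov σ x = frameCov Θ Ω σ x

variable {G} {cov : (Π x : X, TangentSpace I x) →
    (Π x : X, TangentSpace I x →L[ℝ] TangentSpace I x)}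

omit [CompleteSpace E] in
lemma IsLocallyFrameCov.isCovariantDerivativeOn (h : IsLocallyFrameCov G cov) :
    IsCovariantDerivativeOn E (I := I) cov Set.univ where
  add {σ σ' x} hσ hσ' _ := by
    obtain ⟨Θ, Ω, s, hs, hx, hΘ, hi, -, hc⟩ := h x
    rw [hc x hx _ hσ, hc x hx _ hσ', hc x hx _ (mdifferentiableAt_add_section hσ hσ')]
    exact (isCovariantDerivativeOn_frameCov Ω hΘ hi).add hσ hσ' hx
  leibniz {σ g x} hσ hg _ := by
    obtain ⟨Θ, Ω, s, hs, hx, hΘ, hi, -, hc⟩ := h x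
    rw [hc x hx _ hσ, hc x hx _ (hg.smul_section hσ)]
    exact (isCovariantDerivativeOn_frameCov Ω hΘ hi).leibniz hσ hg hx

/-- A covariant derivative given locally by smooth coframes is a linear connection. -/
def IsLocallyFrameCov.linearConnection (h : IsLocallyFrameCov G cov) : LinearConnection I X where
  toFun := cov
  isCovariantDerivativeOnUniv := h.isCovariantDerivativeOn
  smooth := by
    refine ⟨⟨fun {σ} hσ x₀ _ ↦ ContMDiffAt.contMDiffWithinAt ?_⟩⟩
    have hσ' (x : X) : ContMDiffAt I I.tangent ∞ (fun x ↦ (⟨x, σ x⟩ : TangentBundle I X)) x :=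
      (hσ.of_le (by simp)).contMDiffAt Filter.univ_mem
    obtain ⟨Θ, Ω, s, hs, hx₀, hΘ, hi, hΩ, hc⟩ := h x₀
    refine (contMDiffAt_frameCov (hΘ x₀ hx₀) ((hs.eventually_mem hx₀).mono hi) (hΩ x₀ hx₀)
      (hσ' x₀)).congr_of_eventuallyEq ?_
    filter_upwards [hs.eventually_mem hx₀] with x hx
    exact congrArg _ (hc x hx σ ((hσ' x).mdifferentiableAt (by simp)))

end LocallyFrameCov

/-! ### The global Berwald connection and its preserved distributions -/

section BerwaldConnection

variable {m n : ℕ}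
  {T : Type*} [TopologicalSpace T] [ChartedSpace (EuclideanSpace ℝ (Fin m)) T]
  {M : Type*} [TopologicalSpace M] [ChartedSpace (EuclideanSpace ℝ (Fin n)) M]
  [IsManifold (𝓡 m) ∞ T] [IsManifold (𝓡 n) ∞ M]
  {e : OpenPartialHomeomorph T (EuclideanSpace ℝ (Fin m))}
  {e' : OpenPartialHomeomorph M (EuclideanSpace ℝ (Fin n))}
  (χ : LinearConnection (𝓡 m) T) (Γ : LinearConnection (𝓡 n) M) (N : NonlinearConnection m n T M)

/-- The covariant derivative on `E*` which is given by `localCov` in every chart. -/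
def NonlinearConnection.globalCov
    (σ : (u : DualJet m n T M) → TangentSpace (DualJetI m n) u) (u : DualJet m n T M) :
    TangentSpace (DualJetI m n) u →L[ℝ] TangentSpace (DualJetI m n) u :=
  N.localCov χ Γ (chartAt (EuclideanSpace ℝ (Fin m)) u.proj.1)
    (chartAt (EuclideanSpace ℝ (Fin n)) u.proj.2) σ u

lemma NonlinearConnection.globalCov_eq (he : e ∈ IsManifold.maximalAtlas (𝓡 m) ∞ T)
    (he' : e' ∈ IsManifold.maximalAtlas (𝓡 n) ∞ M) {u : DualJet m n T M}
    (hu : u ∈ coordDomain e e')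
    {σ : (u : DualJet m n T M) → TangentSpace (DualJetI m n) u}
    (hσ : MDifferentiableAt (DualJetI m n) (DualJetI m n).tangent
      (fun w ↦ (⟨w, σ w⟩ : TangentBundle (DualJetI m n) (DualJet m n T M))) u) :
    N.globalCov χ Γ σ u = N.localCov χ Γ e e' σ u :=
  N.localCov_eq χ Γ (IsManifold.chart_mem_maximalAtlas _) (IsManifold.chart_mem_maximalAtlas _)
    he he' (mem_coordDomain_chartAt u) hu hσ

lemma NonlinearConnection.isLocallyFrameCov_globalCov [T2Space T] [T2Space M] :
    IsLocallyFrameCov (I := DualJetI m n) (CoordSpace m n) (N.globalCov χ Γ) := by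
  intro u₀
  have he := IsManifold.chart_mem_maximalAtlas (I := 𝓡 m) (n := ∞) u₀.proj.1
  have he' := IsManifold.chart_mem_maximalAtlas (I := 𝓡 n) (n := ∞) u₀.proj.2
  exact ⟨N.adaptedForm _ _, gaugeForm χ Γ _ _, coordDomain _ _, isOpen_coordDomain _ _,
    mem_coordDomain_chartAt u₀, fun u hu ↦ N.smoothForm_adaptedForm he he' hu,
    fun u hu ↦ N.isInvertible_adaptedForm he he' hu,
    fun u hu ↦ contMDiffAt_gaugeForm χ Γ he he' hu, fun u hu σ hσ ↦ N.globalCov_eq χ Γ he he' hu hσ⟩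

/-- The Berwald connection on `E*` attached to linear connections on `T` and `M` and a nonlinear
connection. -/
def NonlinearConnection.berwaldConnection [T2Space T] [T2Space M] :
    LinearConnection (DualJetI m n) (DualJet m n T M) :=
  (N.isLocallyFrameCov_globalCov χ Γ).linearConnection

variable [T2Space T] [T2Space M]

lemma NonlinearConnection.adaptedForm_berwaldConnection
    (he : e ∈ IsManifold.maximalAtlas (𝓡 m) ∞ T)
    (he' : e' ∈ IsManifold.maximalAtlas (𝓡 n) ∞ M) {u : DualJet m n T M}
    (hu : u ∈ coordDomain e e')
    {σ : (u : DualJet m n T M) → TangentSpace (DualJetI m n) u}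
    (hσ : MDifferentiableAt (DualJetI m n) (DualJetI m n).tangent
      (fun w ↦ (⟨w, σ w⟩ : TangentBundle (DualJetI m n) (DualJet m n T M))) u)
    (v : TangentSpace (DualJetI m n) u) :
    N.adaptedForm e e' u ((N.berwaldConnection χ Γ).toFun σ u v) =
      mvfderiv (DualJetI m n) (fun w ↦ N.adaptedForm e e' w (σ w)) u v +
        gaugeForm χ Γ e e' u (N.adaptedForm e e' u v) (N.adaptedForm e e' u (σ u)) := by
  rw [← N.adaptedForm_localCov χ Γ he he' hu, ← N.globalCov_eq χ Γ he he' hu hσ]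
  rfl

lemma NonlinearConnection.adaptedForm_berwaldConnection_of_eventuallyEq
    (he : e ∈ IsManifold.maximalAtlas (𝓡 m) ∞ T)
    (he' : e' ∈ IsManifold.maximalAtlas (𝓡 n) ∞ M) {u : DualJet m n T M}
    (hu : u ∈ coordDomain e e')
    {σ : (u : DualJet m n T M) → TangentSpace (DualJetI m n) u} {g : CoordSpace m n}
    (hσ : ∀ᶠ w in 𝓝 u, N.adaptedForm e e' w (σ w) = g) (v : TangentSpace (DualJetI m n) u) :
    N.adaptedForm e e' u ((N.berwaldConnection χ Γ).toFun σ u v) =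
      gaugeForm χ Γ e e' u (N.adaptedForm e e' u v) g := by
  rw [← N.adaptedForm_localCov_of_eventuallyEq χ Γ he he' hu hσ, ← N.globalCov_eq χ Γ he he' hu
    ((N.contMDiffAt_of_adaptedForm_eventuallyEq he he' hu hσ).mdifferentiableAt (by simp))]
  rfl

/-! ### Preserved distributions -/

omit [T2Space T] [T2Space M] in
lemma NonlinearConnection.mem_timeHorizontal_iff (he : e ∈ IsManifold.maximalAtlas (𝓡 m) ∞ T)
    (he' : e' ∈ IsManifold.maximalAtlas (𝓡 n) ∞ M) {u : DualJet m n T M}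
    (hu : u ∈ coordDomain e e') (v : TangentSpace (DualJetI m n) u) :
    v ∈ N.timeHorizontal u ↔ (N.adaptedForm e e' u v).2.2 = 0 ∧ (N.adaptedForm e e' u v).2.1 = 0 := by
  rw [← N.mem_horizontal_iff_adaptedForm he he' hu, N.adaptedForm_snd he he' hu]
  refine and_congr_right fun _ ↦ ⟨fun h ↦ ?_, fun h ↦ ?_⟩
  · have h' : baseM u v = 0 := h
    rw [h', map_zero]
  · exact (isInvertible_chartForm he' hu.2).injective (h.trans (map_zero _).symm)

omit [T2Space T] [T2Space M] in
lemma NonlinearConnection.mem_spaceHorizontal_iff (he : e ∈ IsManifold.maximalAtlas (𝓡 m) ∞ T)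
    (he' : e' ∈ IsManifold.maximalAtlas (𝓡 n) ∞ M) {u : DualJet m n T M}
    (hu : u ∈ coordDomain e e') (v : TangentSpace (DualJetI m n) u) :
    v ∈ N.spaceHorizontal u ↔ (N.adaptedForm e e' u v).2.2 = 0 ∧ (N.adaptedForm e e' u v).1 = 0 := by
  rw [← N.mem_horizontal_iff_adaptedForm he he' hu, N.adaptedForm_fst he he' hu]
  refine and_congr_right fun _ ↦ ⟨fun h ↦ ?_, fun h ↦ ?_⟩
  · have h' : baseT u v = 0 := h
    rw [h', map_zero]
  · exact (isInvertible_chartForm he hu.1).injective (h.trans (map_zero _).symm)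

/-- Here `L` is a block projection and `f` the components of a field: the derivative term has zero
block when the components do nearby, leaving only the Christoffel term to check. -/
lemma clm_add_eq_zero {E : Type*} [NormedAddCommGroup E] [NormedSpace ℝ E]
    {H : Type*} [TopologicalSpace H] {I : ModelWithCorners ℝ E H}
    {X : Type*} [TopologicalSpace X] [ChartedSpace H X]
    {G G' : Type*} [NormedAddCommGroup G] [NormedSpace ℝ G] [NormedAddCommGroup G']
    [NormedSpace ℝ G'] (L : G →L[ℝ] G') {f : X → G} {x : X}
    (hf : MDifferentiableAt I 𝓘(ℝ, G) f x) (h : ∀ᶠ y in 𝓝 x, L (f y) = 0) (v : TangentSpace I x)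
    {g : G} (hg : L g = 0) : L (mvfderiv I f x v + g) = 0 := by
  have h' : (fun y ↦ L (f y)) =ᶠ[𝓝 x] fun _ ↦ 0 := h
  rw [map_add, hg, add_zero, ← mvfderiv_clm_apply L hf, h'.mvfderiv_eq, mvfderiv_const]
  rfl

section Components

variable (he : e ∈ IsManifold.maximalAtlas (𝓡 m) ∞ T)
    (he' : e' ∈ IsManifold.maximalAtlas (𝓡 n) ∞ M) {u : DualJet m n T M}
    (hu : u ∈ coordDomain e e')
    {σ : (u : DualJet m n T M) → TangentSpace (DualJetI m n) u}
    (hσ : ContMDiffAt (DualJetI m n) (DualJetI m n).tangent ∞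
      (fun w ↦ (⟨w, σ w⟩ : TangentBundle (DualJetI m n) (DualJet m n T M))) u)
include he he' hu hσ

/-- The Christoffel symbols are block diagonal, so the `t`-block of the derivative involves only the
`t`-block of the field. The next two lemmas are the same for the `x`- and `p`-blocks. -/
lemma NonlinearConnection.berwaldConnection_fst_eq_zero
    (h : ∀ w ∈ coordDomain e e', (N.adaptedForm e e' w (σ w)).1 = 0)
    (v : TangentSpace (DualJetI m n) u) :
    (N.adaptedForm e e' u ((N.berwaldConnection χ Γ).toFun σ u v)).1 = 0 := by
  rw [N.adaptedForm_berwaldConnection χ Γ he he' hu (hσ.mdifferentiableAt (by simp))]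
  refine clm_add_eq_zero (ContinuousLinearMap.fst ℝ (EuclideanSpace ℝ (Fin m))
    (EuclideanSpace ℝ (Fin n) × (Fin n → Fin m → ℝ)))
    (((N.smoothForm_adaptedForm he he' hu).contMDiffAt_apply hσ).mdifferentiableAt (by simp))
    ((mem_coordDomain_eventually e e' hu).mono h) v ?_
  change (gaugeForm χ Γ e e' u (N.adaptedForm e e' u v) (N.adaptedForm e e' u (σ u))).1 = 0
  ext a
  rw [gaugeForm_adaptedForm_fst χ Γ N he he' hu, h u hu]
  simp

lemma NonlinearConnection.berwaldConnection_snd_eq_zero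
    (h : ∀ w ∈ coordDomain e e', (N.adaptedForm e e' w (σ w)).2.1 = 0)
    (v : TangentSpace (DualJetI m n) u) :
    (N.adaptedForm e e' u ((N.berwaldConnection χ Γ).toFun σ u v)).2.1 = 0 := by
  rw [N.adaptedForm_berwaldConnection χ Γ he he' hu (hσ.mdifferentiableAt (by simp))]
  refine clm_add_eq_zero ((ContinuousLinearMap.fst ℝ (EuclideanSpace ℝ (Fin n))
    (Fin n → Fin m → ℝ)).comp (ContinuousLinearMap.snd ℝ (EuclideanSpace ℝ (Fin m)) _))
    (((N.smoothForm_adaptedForm he he' hu).contMDiffAt_apply hσ).mdifferentiableAt (by simp))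
    ((mem_coordDomain_eventually e e' hu).mono h) v ?_
  change (gaugeForm χ Γ e e' u (N.adaptedForm e e' u v) (N.adaptedForm e e' u (σ u))).2.1 = 0
  ext i
  rw [gaugeForm_adaptedForm_snd χ Γ N he he' hu, h u hu]
  simp

lemma NonlinearConnection.berwaldConnection_momentum_eq_zero
    (h : ∀ w ∈ coordDomain e e', (N.adaptedForm e e' w (σ w)).2.2 = 0)
    (v : TangentSpace (DualJetI m n) u) :
    (N.adaptedForm e e' u ((N.berwaldConnection χ Γ).toFun σ u v)).2.2 = 0 := by
  rw [N.adaptedForm_berwaldConnection χ Γ he he' hu (hσ.mdifferentiableAt (by simp))]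
  refine clm_add_eq_zero ((ContinuousLinearMap.snd ℝ (EuclideanSpace ℝ (Fin n))
    (Fin n → Fin m → ℝ)).comp (ContinuousLinearMap.snd ℝ (EuclideanSpace ℝ (Fin m)) _))
    (((N.smoothForm_adaptedForm he he' hu).contMDiffAt_apply hσ).mdifferentiableAt (by simp))
    ((mem_coordDomain_eventually e e' hu).mono h) v ?_
  change (gaugeForm χ Γ e e' u (N.adaptedForm e e' u v) (N.adaptedForm e e' u (σ u))).2.2 = 0
  ext i a
  rw [gaugeForm_adaptedForm_momentum χ Γ N he he' hu, h u hu]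
  simp

end Components

/-- Each of the three distributions is given by the vanishing of two blocks of the adapted coframe,
and vanishing of any single block is preserved. -/
lemma NonlinearConnection.isNLinear_berwaldConnection : IsNLinear N (N.berwaldConnection χ Γ) where
  time Y hY hmem u v := by
    have he := IsManifold.chart_mem_maximalAtlas (I := 𝓡 m) (n := ∞) u.proj.1
    have he' := IsManifold.chart_mem_maximalAtlas (I := 𝓡 n) (n := ∞) u.proj.2
    have hu := mem_coordDomain_chartAt u
    have h {w} hw := (N.mem_timeHorizontal_iff he he' (u := w) hw _).1 (hmem w)
    exact (N.mem_timeHorizontal_iff he he' hu _).2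
      ⟨N.berwaldConnection_momentum_eq_zero χ Γ he he' hu hY.contMDiffAt (fun w hw ↦ (h hw).1) v,
        N.berwaldConnection_snd_eq_zero χ Γ he he' hu hY.contMDiffAt (fun w hw ↦ (h hw).2) v⟩
  space Y hY hmem u v := by
    have he := IsManifold.chart_mem_maximalAtlas (I := 𝓡 m) (n := ∞) u.proj.1
    have he' := IsManifold.chart_mem_maximalAtlas (I := 𝓡 n) (n := ∞) u.proj.2
    have hu := mem_coordDomain_chartAt u
    have h {w} hw := (N.mem_spaceHorizontal_iff he he' (u := w) hw _).1 (hmem w)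
    exact (N.mem_spaceHorizontal_iff he he' hu _).2
      ⟨N.berwaldConnection_momentum_eq_zero χ Γ he he' hu hY.contMDiffAt (fun w hw ↦ (h hw).1) v,
        N.berwaldConnection_fst_eq_zero χ Γ he he' hu hY.contMDiffAt (fun w hw ↦ (h hw).2) v⟩
  vertical Y hY hmem u v := by
    have he := IsManifold.chart_mem_maximalAtlas (I := 𝓡 m) (n := ∞) u.proj.1
    have he' := IsManifold.chart_mem_maximalAtlas (I := 𝓡 n) (n := ∞) u.proj.2
    have hu := mem_coordDomain_chartAt u
    have h {w} hw := (N.mem_verticalSpace_iff_adaptedForm he he' (u := w) hw _).1 (hmem w)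
    exact (N.mem_verticalSpace_iff_adaptedForm he he' hu _).2
      ⟨N.berwaldConnection_fst_eq_zero χ Γ he he' hu hY.contMDiffAt (fun w hw ↦ (h hw).1) v,
        N.berwaldConnection_snd_eq_zero χ Γ he he' hu hY.contMDiffAt (fun w hw ↦ (h hw).2) v⟩

end BerwaldConnection

/-! ### The nine adapted coefficients of the Berwald connection -/

section AdaptedCoefficients

variable {m n : ℕ}

/-- The coordinate vector of `∂/∂t^a`. -/
abbrev timeVec (a : Fin m) : CoordSpace m n := (EuclideanSpace.single a 1, 0, 0)

/-- The coordinate vector of `∂/∂x^i`. -/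
abbrev spaceVec (i : Fin n) : CoordSpace m n := (0, EuclideanSpace.single i 1, 0)

/-- The coordinate vector of `∂/∂p_i^a`. -/
abbrev momentumVec (i : Fin n) (a : Fin m) : CoordSpace m n := (0, 0, Pi.single i (Pi.single a 1))

variable (A : Fin m → Fin m → Fin m → ℝ) (B : Fin n → Fin n → Fin n → ℝ)

lemma gaugeBilin_timeVec (c : Fin m) (z : CoordSpace m n) :
    gaugeBilin A B (timeVec c) z = ∑ a, ∑ b, A a b c • timeUnit a b z := by
  rw [gaugeBilin_apply]
  simp

lemma gaugeBilin_spaceVec (k : Fin n) (z : CoordSpace m n) :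
    gaugeBilin A B (spaceVec k) z = ∑ i, ∑ j, B i j k • spaceUnit i j z := by
  rw [gaugeBilin_apply]
  simp

/-- The Christoffel symbols involve only `dt` and `dx` in the direction slot; the three families of
`C`-coefficients vanish for this reason. -/
lemma gaugeBilin_momentumVec (k : Fin n) (c : Fin m) (z : CoordSpace m n) :
    gaugeBilin A B (momentumVec k c) z = 0 := by
  rw [gaugeBilin_apply]
  simp

lemma timeUnit_timeVec (a b b' : Fin m) :
    timeUnit a b (timeVec b' : CoordSpace m n) = if b = b' then timeVec a else 0 := by
  rw [timeUnit_apply]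
  split_ifs with h
  · subst h
    refine Prod.ext ?_ (Prod.ext rfl ?_)
    · simp
    · ext; simp
  · refine Prod.ext ?_ (Prod.ext rfl ?_)
    · simp [h]
    · ext; simp

lemma timeUnit_spaceVec (a b : Fin m) (j : Fin n) :
    timeUnit a b (spaceVec j : CoordSpace m n) = 0 := by
  rw [timeUnit_apply]
  refine Prod.ext ?_ (Prod.ext rfl ?_)
  · simp
  · ext; simp

lemma timeUnit_momentumVec (a b b' : Fin m) (j : Fin n) :
    timeUnit a b (momentumVec j b' : CoordSpace m n) =
      if b = b' then momentumVec j a else 0 := by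
  rw [timeUnit_apply]
  split_ifs with h
  · subst h
    refine Prod.ext ?_ (Prod.ext rfl ?_)
    · simp
    · ext i : 1
      rcases eq_or_ne i j with rfl | hi <;> simp [*]
  · refine Prod.ext ?_ (Prod.ext rfl ?_)
    · simp
    · ext i : 1
      rcases eq_or_ne i j with rfl | hi <;> simp [*]

lemma spaceUnit_timeVec (i j : Fin n) (b : Fin m) :
    spaceUnit i j (timeVec b : CoordSpace m n) = 0 := by
  rw [spaceUnit_apply]
  refine Prod.ext rfl (Prod.ext ?_ ?_) <;> simp

lemma spaceUnit_spaceVec (i j j' : Fin n) :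
    spaceUnit i j (spaceVec j' : CoordSpace m n) = if j = j' then spaceVec i else 0 := by
  rw [spaceUnit_apply]
  split_ifs with h
  · subst h
    refine Prod.ext rfl (Prod.ext ?_ ?_) <;> simp
  · refine Prod.ext rfl (Prod.ext ?_ ?_) <;> simp [h]

lemma spaceUnit_momentumVec (i j l : Fin n) (b : Fin m) :
    spaceUnit i j (momentumVec l b : CoordSpace m n) =
      if i = l then -momentumVec j b else 0 := by
  rw [spaceUnit_apply]
  split_ifs with h
  · subst h
    refine Prod.ext ?_ (Prod.ext ?_ ?_) <;> simp
  · refine Prod.ext rfl (Prod.ext ?_ ?_) <;> simp [h]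

variable
  {T : Type*} [TopologicalSpace T] [ChartedSpace (EuclideanSpace ℝ (Fin m)) T]
  {M : Type*} [TopologicalSpace M] [ChartedSpace (EuclideanSpace ℝ (Fin n)) M]
  [IsManifold (𝓡 m) ∞ T] [IsManifold (𝓡 n) ∞ M]
  {e : OpenPartialHomeomorph T (EuclideanSpace ℝ (Fin m))}
  {e' : OpenPartialHomeomorph M (EuclideanSpace ℝ (Fin n))}
  {N : NonlinearConnection m n T M} {K : DualJet m n T M → NonlinearCoeffs m n}

/-- Having the coefficients `K` makes this vector horizontal, which kills `δp`; the correction by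
`∂/∂p` does not affect the base components. -/
lemma NonlinearConnection.HasCoeffs.adaptedForm_deltaT (hN : N.HasCoeffs e e' K)
    (he : e ∈ IsManifold.maximalAtlas (𝓡 m) ∞ T) (he' : e' ∈ IsManifold.maximalAtlas (𝓡 n) ∞ M)
    {u : DualJet m n T M} (hu : u ∈ coordDomain e e') (a : Fin m) :
    N.adaptedForm e e' u (deltaT e e' K a u) = timeVec a := by
  have h : deltaT e e' K a u ∈ N.horizontal u := by
    rw [hN u hu]
    exact Submodule.subset_span (Or.inl ⟨a, rfl⟩)
  have h' := (N.mem_horizontal_iff_adaptedForm he he' hu _).1 h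
  refine Prod.ext ?_ (Prod.ext ?_ h')
  · rw [N.adaptedForm_apply, coordDiff_deltaT he he' hu]
  · rw [N.adaptedForm_apply, coordDiff_deltaT he he' hu]

lemma NonlinearConnection.HasCoeffs.adaptedForm_deltaX (hN : N.HasCoeffs e e' K)
    (he : e ∈ IsManifold.maximalAtlas (𝓡 m) ∞ T) (he' : e' ∈ IsManifold.maximalAtlas (𝓡 n) ∞ M)
    {u : DualJet m n T M} (hu : u ∈ coordDomain e e') (i : Fin n) :
    N.adaptedForm e e' u (deltaX e e' K i u) = spaceVec i := by
  have h : deltaX e e' K i u ∈ N.horizontal u := by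
    rw [hN u hu]
    exact Submodule.subset_span (Or.inr ⟨i, rfl⟩)
  have h' := (N.mem_horizontal_iff_adaptedForm he he' hu _).1 h
  refine Prod.ext ?_ (Prod.ext ?_ h')
  · rw [N.adaptedForm_apply, coordDiff_deltaX he he' hu]
  · rw [N.adaptedForm_apply, coordDiff_deltaX he he' hu]

lemma NonlinearConnection.adaptedForm_natP (N : NonlinearConnection m n T M)
    (he : e ∈ IsManifold.maximalAtlas (𝓡 m) ∞ T) (he' : e' ∈ IsManifold.maximalAtlas (𝓡 n) ∞ M)
    {u : DualJet m n T M} (hu : u ∈ coordDomain e e') (i : Fin n) (a : Fin m) :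
    N.adaptedForm e e' u (natP e e' i a u) = momentumVec i a := by
  have h := coordDiff_natP he he' hu i a
  rw [N.adaptedForm_of_vertical, h]
  rw [mem_verticalSpace_iff_coordDiff he he' hu, h]
  exact ⟨rfl, rfl⟩

lemma NonlinearConnection.adaptedForm_sum_smul {ι : Type*} [Fintype ι] {u : DualJet m n T M}
    {f : ι → ℝ} {y : ι → TangentSpace (DualJetI m n) u} {g : ι → CoordSpace m n}
    (hy : ∀ i, N.adaptedForm e e' u (y i) = g i) :
    N.adaptedForm e e' u (∑ i, f i • y i) = ∑ i, f i • g i := by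
  rw [map_sum]
  simp only [map_smul, hy]

variable [T2Space T] [T2Space M] (χ : LinearConnection (𝓡 m) T) (Γ : LinearConnection (𝓡 n) M)

section Evaluation

variable (he : e ∈ IsManifold.maximalAtlas (𝓡 m) ∞ T)
  (he' : e' ∈ IsManifold.maximalAtlas (𝓡 n) ∞ M) {u : DualJet m n T M}
  (hu : u ∈ coordDomain e e') {σ τ : (u : DualJet m n T M) → TangentSpace (DualJetI m n) u}
  {g h z : CoordSpace m n} (hσ : ∀ w ∈ coordDomain e e', N.adaptedForm e e' w (σ w) = g)
  (hτ : ∀ w ∈ coordDomain e e', N.adaptedForm e e' w (τ w) = h)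
include he he' hu hσ hτ

/-- For fields `σ`, `τ` with constant adapted components `g`, `h`, the derivative of `σ` along `τ`
has components `Ω(h, g)`, and the coframe is injective. Each of the nine formulas thus becomes an
evaluation on basis vectors. -/
lemma NonlinearConnection.berwaldConnection_eq_of_gaugeBilin
    (hz : gaugeBilin (fun a b c ↦ χ.coeff e a b c u.proj.1)
      (fun i j k ↦ Γ.coeff e' i j k u.proj.2) h g = z) {v : TangentSpace (DualJetI m n) u}
    (hv : N.adaptedForm e e' u v = z) :
    (N.berwaldConnection χ Γ).toFun σ u (τ u) = v := by
  apply (N.isInvertible_adaptedForm he he' hu).injective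
  rw [N.adaptedForm_berwaldConnection_of_eventuallyEq χ Γ he he' hu
    ((mem_coordDomain_eventually e e' hu).mono hσ), hτ u hu, hv]
  exact hz

end Evaluation

lemma NonlinearConnection.HasCoeffs.hasAdaptedCoeffs
    (hN : N.HasCoeffs e e' (berwaldNonlinearCoeffs e e' χ Γ))
    (he : e ∈ IsManifold.maximalAtlas (𝓡 m) ∞ T) (he' : e' ∈ IsManifold.maximalAtlas (𝓡 n) ∞ M) :
    HasAdaptedCoeffs e e' (berwaldNonlinearCoeffs e e' χ Γ) (N.berwaldConnection χ Γ)
      (berwaldCoeffs e e' χ Γ) where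
  tt u hu b c := by
    refine N.berwaldConnection_eq_of_gaugeBilin χ Γ he he' hu
      (fun w hw ↦ hN.adaptedForm_deltaT he he' hw b) (fun w hw ↦ hN.adaptedForm_deltaT he he' hw c)
      ?_ (N.adaptedForm_sum_smul fun a ↦ hN.adaptedForm_deltaT he he' hu a)
    simp [gaugeBilin_timeVec, timeUnit_timeVec, berwaldCoeffs]
  tx u hu j c := by
    refine N.berwaldConnection_eq_of_gaugeBilin χ Γ he he' hu
      (fun w hw ↦ hN.adaptedForm_deltaX he he' hw j) (fun w hw ↦ hN.adaptedForm_deltaT he he' hw c)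
      ?_ (N.adaptedForm_sum_smul fun i ↦ hN.adaptedForm_deltaX he he' hu i)
    simp [gaugeBilin_timeVec, timeUnit_spaceVec, berwaldCoeffs]
  tp u hu j b c := by
    -- The sign in the definition of the coefficients cancels the sign of the convention, and the
    -- Kronecker delta removes the sum over `i`.
    have h : -∑ a, ∑ i, (berwaldCoeffs e e' χ Γ u).A₃ a i j b c • natP e e' i a u =
        ∑ a, χ.coeff e a b c u.proj.1 • natP e e' j a u := by
      simp [berwaldCoeffs]
    rw [h]
    refine N.berwaldConnection_eq_of_gaugeBilin χ Γ he he' hu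
      (fun w hw ↦ N.adaptedForm_natP he he' hw j b) (fun w hw ↦ hN.adaptedForm_deltaT he he' hw c)
      ?_ (N.adaptedForm_sum_smul fun a ↦ N.adaptedForm_natP he he' hu j a)
    simp [gaugeBilin_timeVec, timeUnit_momentumVec]
  xt u hu b k := by
    refine N.berwaldConnection_eq_of_gaugeBilin χ Γ he he' hu
      (fun w hw ↦ hN.adaptedForm_deltaT he he' hw b) (fun w hw ↦ hN.adaptedForm_deltaX he he' hw k)
      ?_ (N.adaptedForm_sum_smul fun a ↦ hN.adaptedForm_deltaT he he' hu a)
    simp [gaugeBilin_spaceVec, spaceUnit_timeVec, berwaldCoeffs]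
  xx u hu j k := by
    refine N.berwaldConnection_eq_of_gaugeBilin χ Γ he he' hu
      (fun w hw ↦ hN.adaptedForm_deltaX he he' hw j) (fun w hw ↦ hN.adaptedForm_deltaX he he' hw k)
      ?_ (N.adaptedForm_sum_smul fun i ↦ hN.adaptedForm_deltaX he he' hu i)
    simp [gaugeBilin_spaceVec, spaceUnit_spaceVec, berwaldCoeffs]
  xp u hu j b k := by
    -- Here the Kronecker delta removes the sum over `a`, and the minus sign of the dual action
    -- stays.
    have h : -∑ a, ∑ i, (berwaldCoeffs e e' χ Γ u).H₃ a i j b k • natP e e' i a u =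
        ∑ i, (-Γ.coeff e' j i k u.proj.2) • natP e e' i b u := by
      rw [Finset.sum_comm]
      simp [berwaldCoeffs]
    rw [h]
    refine N.berwaldConnection_eq_of_gaugeBilin χ Γ he he' hu
      (fun w hw ↦ N.adaptedForm_natP he he' hw j b) (fun w hw ↦ hN.adaptedForm_deltaX he he' hw k)
      ?_ (N.adaptedForm_sum_smul fun i ↦ N.adaptedForm_natP he he' hu i b)
    rw [gaugeBilin_spaceVec, Finset.sum_comm]
    simp [spaceUnit_momentumVec]
  pt u hu b k c := by
    refine N.berwaldConnection_eq_of_gaugeBilin χ Γ he he' hu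
      (fun w hw ↦ hN.adaptedForm_deltaT he he' hw b) (fun w hw ↦ N.adaptedForm_natP he he' hw k c)
      ?_ (N.adaptedForm_sum_smul fun a ↦ hN.adaptedForm_deltaT he he' hu a)
    simp [gaugeBilin_momentumVec, berwaldCoeffs]
  px u hu j k c := by
    refine N.berwaldConnection_eq_of_gaugeBilin χ Γ he he' hu
      (fun w hw ↦ hN.adaptedForm_deltaX he he' hw j) (fun w hw ↦ N.adaptedForm_natP he he' hw k c)
      ?_ (N.adaptedForm_sum_smul fun i ↦ hN.adaptedForm_deltaX he he' hu i)
    simp [gaugeBilin_momentumVec, berwaldCoeffs]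
  pp u hu j b k c := by
    have h : -∑ a, ∑ i, (berwaldCoeffs e e' χ Γ u).C₃ a i j b k c • natP e e' i a u = 0 := by
      simp [berwaldCoeffs]
    rw [h]
    exact N.berwaldConnection_eq_of_gaugeBilin χ Γ he he' hu
      (fun w hw ↦ N.adaptedForm_natP he he' hw j b) (fun w hw ↦ N.adaptedForm_natP he he' hw k c)
      (gaugeBilin_momentumVec _ _ k c _) (map_zero _)

lemma isBerwald_berwaldConnection : IsBerwald χ Γ (berwaldNonlinearConnection χ Γ)
    ((berwaldNonlinearConnection χ Γ).berwaldConnection χ Γ) where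
  nonlinear _ he _ he' := berwaldNonlinearConnection_hasCoeffs χ Γ he he'
  linear _ he _ he' :=
    (berwaldNonlinearConnection_hasCoeffs χ Γ he he').hasAdaptedCoeffs χ Γ he he'

end AdaptedCoefficients

end

theorem mainTheorem5 {m n : ℕ}
    {T : Type*} [TopologicalSpace T] [ChartedSpace (EuclideanSpace ℝ (Fin m)) T]
    [IsManifold (𝓡 m) ∞ T] [T2Space T] [ParacompactSpace T]
    {M : Type*} [TopologicalSpace M] [ChartedSpace (EuclideanSpace ℝ (Fin n)) M]
    [IsManifold (𝓡 n) ∞ M] [T2Space M] [ParacompactSpace M] :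
    (∃ N : NonlinearConnection m n T M,
      ∃ D : LinearConnection (DualJetI m n) (DualJet m n T M), IsNLinear N D) ∧
    (∀ N : NonlinearConnection m n T M,
      ∃ D : LinearConnection (DualJetI m n) (DualJet m n T M), IsNLinear N D) ∧
    Nonempty (LinearConnection (𝓡 m) T) ∧ Nonempty (LinearConnection (𝓡 n) M) ∧
    (∀ (χ : LinearConnection (𝓡 m) T) (Γ : LinearConnection (𝓡 n) M),
      ∃ N : NonlinearConnection m n T M,
      ∃ D : LinearConnection (DualJetI m n) (DualJet m n T M),
        IsNLinear N D ∧ IsBerwald χ Γ N D) := by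
  obtain ⟨χ₀⟩ := nonempty_linearConnection m T
  obtain ⟨Γ₀⟩ := nonempty_linearConnection n M
  exact ⟨⟨berwaldNonlinearConnection χ₀ Γ₀, _,
      (berwaldNonlinearConnection χ₀ Γ₀).isNLinear_berwaldConnection χ₀ Γ₀⟩,
    -- For an arbitrary `N` any auxiliary connections on `T` and `M` will do; they need not be
    -- related to `N`.
    fun N ↦ ⟨_, N.isNLinear_berwaldConnection χ₀ Γ₀⟩, ⟨χ₀⟩, ⟨Γ₀⟩,
    fun χ Γ ↦ ⟨berwaldNonlinearConnection χ Γ, _,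
      (berwaldNonlinearConnection χ Γ).isNLinear_berwaldConnection χ Γ,
      isBerwald_berwaldConnection χ Γ⟩⟩
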